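/- A \emph{prop} is a strict symmetric monoidal category whose objects are the natural numbers, with addition as tensor product of objects; a \emph{morphism of props} is a strict symmetric monoidal functor that is the identity on objects. Write $[n]$ for an $n$-element set. Let $k$ be a field and $L$ a set, and consider the following props (compositions of the first two are by pushout, and tensor products are by disjoint union). \begin{itemize} \item $\mathrm{FinCospan}$: morphisms $m\to n$ are isomorphism classes of cospans of finite sets $[m]\to N\leftarrow [n]$. \item $\mathrm{Circ}_L$: morphisms $m\to n$ are isomorphism classes of $L$-circuits, i.e. cospans of finite sets $[m]\to N\leftarrow [n]$ together with a finite set $E$ of edges and functions $s,t\colon E\to N$, $\ell\colon E\to L$. \item $F(L)$: the free prop on the signature with one generator $\ell\colon 1\to 1$ for each $\ell\in L$. \item $\mathrm{FinCorel}$: morphisms $m\to n$ are corelations, i.e. partitions of $[m]+[n]$; two corelations are composed by gluing them to the finest partition of $[m]+[n]+[p]$ in which elements lie in the same part whenever they do so in one of the two given partitions, and restricting it to $[m]+[p]$. \item $\mathrm{LagRel}_k$: morphisms $m\to n$ are Lagrangian subspaces (isotropic subspaces not properly contained in another isotropic subspace) of $\overline{(k\oplus k)^m}\oplus(k\oplus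 k)^n$, where $k\oplus k$ has the symplectic form $\omega((\phi,I),(\phi',I'))=\phi I'-\phi' I$, direct sums have the sum of the forms, and the bar means that the form is negated; composition is composition of relations and the tensor product is direct sum. \end{itemize} Let $H\colon \mathrm{FinCospan}\to\mathrm{FinCorel}$ send a cospan $[m]\to N\leftarrow[n]$ to the partition of $[m]+[n]$ into the nonempty fibres of $[m]+[n]\to N$. There are morphisms of props $\mathrm{FinCospan}\to\mathrm{Circ}_L$ (a cospan is a circuit without edges) and $F(L)\to\mathrm{Circ}_L$ (the generator $\ell$ is sent to the circuit with one edge, labelled $\ell$, from its input to its output). Then: \begin{enumerate} \item These two morphisms make $\mathrm{Circ}_L$ a coproduct of props, $\mathrm{Circ}_L\cong\mathrm{FinCospan}+F(L)$. \item There is a unique morphism of props $K\colon\mathrm{FinCorel}\to\mathrm{LagRel}_k$ that sends the one-part corelations $2\to1$, $0\to1$, $1\to2$, $1\to0$ respectively to \[\{(\phi_1,I_1,\phi_2,I_2,\phi_3,I_3):\phi_1=\phi_2=\phi_3,\ I_1+I_2=I_3\},\qquad \{(\phi,I): I=0\},\] \[\{(\phi_1,I_1,\phi_2,I_2,\phi_3,I_3):\phi_1=\phi_2=\phi_3,\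 I_1=I_2+I_3\},\qquad \{(\phi,I): I=0\}.\] \item For every choice of a Lagrangian relation $R_\ell$ from $k\oplus k$ to itself for each $\ell\in L$, there is a unique morphism of props \[\blacksquare\colon \mathrm{Circ}_L\cong\mathrm{FinCospan}+F(L)\to\mathrm{LagRel}_k\] such that $\blacksquare|_{\mathrm{FinCospan}}=K\circ H$ and $\blacksquare|_{F(L)}$ sends each $\ell\in L$ to $R_\ell$. \end{enumerate} -/

import Mathlib

universe u v w

/-! ## Props -/

/-- Transport of a morphism along equalities of its source and target. -/
def castHom {Hom : ℕ → ℕ → Type v} {m m' n n' : ℕ} (hm : m = m') (hn : n = n')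
    (f : Hom m n) : Hom m' n' :=
  hm ▸ hn ▸ f

/-- A prop: a strict symmetric monoidal category whose objects are the natural numbers, with
addition as the tensor product of objects.  Composition is written in diagrammatic order.
The associator and the unitors are identities, which is what the transports `castHom` express. -/
structure PROP where
  Hom : ℕ → ℕ → Type v
  id : ∀ n, Hom n n
  comp : ∀ {m n p}, Hom m n → Hom n p → Hom m p
  tensor : ∀ {m n m' n'}, Hom m n → Hom m' n' → Hom (m + m') (n + n')
  braid : ∀ m n, Hom (m + n) (n + m)
  id_comp : ∀ {m n} (f : Hom m n), comp (id m) f = f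
  comp_id : ∀ {m n} (f : Hom m n), comp f (id n) = f
  assoc : ∀ {m n p q} (f : Hom m n) (g : Hom n p) (h : Hom p q),
    comp (comp f g) h = comp f (comp g h)
  tensor_id : ∀ m n, tensor (id m) (id n) = id (m + n)
  tensor_comp : ∀ {m n p m' n' p'} (f : Hom m n) (g : Hom n p) (f' : Hom m' n') (g' : Hom n' p'),
    tensor (comp f g) (comp f' g') = comp (tensor f f') (tensor g g')
  tensor_assoc : ∀ {m n m' n' m'' n''} (f : Hom m n) (g : Hom m' n') (h : Hom m'' n''),
    castHom (Hom := Hom) (Nat.add_assoc m m' m'') (Nat.add_assoc n n' n'')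
      (tensor (tensor f g) h) = tensor f (tensor g h)
  id_tensor : ∀ {m n} (f : Hom m n),
    castHom (Hom := Hom) (Nat.zero_add m) (Nat.zero_add n) (tensor (id 0) f) = f
  tensor_unit : ∀ {m n} (f : Hom m n),
    castHom (Hom := Hom) (Nat.add_zero m) (Nat.add_zero n) (tensor f (id 0)) = f
  braid_natural : ∀ {m n m' n'} (f : Hom m n) (g : Hom m' n'),
    comp (tensor f g) (braid n n') = comp (braid m m') (tensor g f)
  braid_braid : ∀ m n, comp (braid m n) (braid n m) = id (m + n)
  hexagon : ∀ m n p,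
    castHom (Hom := Hom) (Nat.add_assoc m n p).symm (Nat.add_assoc n p m) (braid m (n + p)) =
      comp (castHom (Hom := Hom) rfl (Nat.add_assoc n m p) (tensor (braid m n) (id p)))
        (tensor (id n) (braid m p))

namespace PROP

/-- A morphism of props: a strict symmetric monoidal functor that is the identity on objects. -/
@[ext]
structure Morphism (P : PROP.{v}) (Q : PROP.{w}) where
  map : ∀ {m n}, P.Hom m n → Q.Hom m n
  map_id : ∀ n, map (P.id n) = Q.id n
  map_comp : ∀ {m n p} (f : P.Hom m n) (g : P.Hom n p),
    map (P.comp f g) = Q.comp (map f) (map g)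
  map_tensor : ∀ {m n m' n'} (f : P.Hom m n) (g : P.Hom m' n'),
    map (P.tensor f g) = Q.tensor (map f) (map g)
  map_braid : ∀ m n, map (P.braid m n) = Q.braid m n

/-- Composition of morphisms of props: first `F`, then `G`. -/
def Morphism.comp {P : PROP.{u}} {Q : PROP.{v}} {R : PROP.{w}} (F : Morphism P Q)
    (G : Morphism Q R) : Morphism P R where
  map f := G.map (F.map f)
  map_id n := by rw [F.map_id, G.map_id]
  map_comp f g := by rw [F.map_comp, G.map_comp]
  map_tensor f g := by rw [F.map_tensor, G.map_tensor]
  map_braid m n := by rw [F.map_braid, G.map_braid]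

/-- `i : P → C` and `j : Q → C` make `C` a coproduct of the props `P` and `Q`
(the universal property is tested on props in the universe `t`). -/
def IsCoproduct.{t, a, b, c} {P : PROP.{a}} {Q : PROP.{b}} {C : PROP.{c}}
    (i : Morphism P C) (j : Morphism Q C) : Prop :=
  ∀ (T : PROP.{t}) (f : Morphism P T) (g : Morphism Q T),
    ∃! h : Morphism C T, i.comp h = f ∧ j.comp h = g

end PROP

/-! ## The free prop on a signature -/

/-- Formal expressions in a signature `S`, where `S m n` is the set of generators `m → n`. -/
inductive PropTerm (S : ℕ → ℕ → Type u) : ℕ → ℕ → Type u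
  | gen {m n : ℕ} (s : S m n) : PropTerm S m n
  | id (n : ℕ) : PropTerm S n n
  | comp {m n p : ℕ} (f : PropTerm S m n) (g : PropTerm S n p) : PropTerm S m p
  | tensor {m n m' n' : ℕ} (f : PropTerm S m n) (g : PropTerm S m' n') :
      PropTerm S (m + m') (n + n')
  | braid (m n : ℕ) : PropTerm S (m + n) (n + m)

namespace PropTerm

/-- The congruence on expressions generated by the laws of a prop. -/
inductive Rel (S : ℕ → ℕ → Type u) : ∀ {m n : ℕ}, PropTerm S m n → PropTerm S m n → Prop
  | refl {m n} (f : PropTerm S m n) : Rel S f f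
  | symm {m n} {f g : PropTerm S m n} : Rel S f g → Rel S g f
  | trans {m n} {f g h : PropTerm S m n} : Rel S f g → Rel S g h → Rel S f h
  | comp_congr {m n p} {f f' : PropTerm S m n} {g g' : PropTerm S n p} :
      Rel S f f' → Rel S g g' → Rel S (comp f g) (comp f' g')
  | tensor_congr {m n m' n'} {f f' : PropTerm S m n} {g g' : PropTerm S m' n'} :
      Rel S f f' → Rel S g g' → Rel S (tensor f g) (tensor f' g')
  | id_comp {m n} (f : PropTerm S m n) : Rel S (comp (id m) f) f
  | comp_id {m n} (f : PropTerm S m n) : Rel S (comp f (id n)) f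
  | assoc {m n p q} (f : PropTerm S m n) (g : PropTerm S n p) (h : PropTerm S p q) :
      Rel S (comp (comp f g) h) (comp f (comp g h))
  | tensor_id (m n) : Rel S (tensor (id m) (id n)) (id (m + n))
  | tensor_comp {m n p m' n' p'} (f : PropTerm S m n) (g : PropTerm S n p)
      (f' : PropTerm S m' n') (g' : PropTerm S n' p') :
      Rel S (tensor (comp f g) (comp f' g')) (comp (tensor f f') (tensor g g'))
  | tensor_assoc {m n m' n' m'' n''} (f : PropTerm S m n) (g : PropTerm S m' n')
      (h : PropTerm S m'' n'') :
      Rel S (castHom (Hom := PropTerm S) (Nat.add_assoc m m' m'') (Nat.add_assoc n n' n'')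
        (tensor (tensor f g) h)) (tensor f (tensor g h))
  | id_tensor {m n} (f : PropTerm S m n) :
      Rel S (castHom (Hom := PropTerm S) (Nat.zero_add m) (Nat.zero_add n) (tensor (id 0) f)) f
  | tensor_unit {m n} (f : PropTerm S m n) :
      Rel S (castHom (Hom := PropTerm S) (Nat.add_zero m) (Nat.add_zero n) (tensor f (id 0))) f
  | braid_natural {m n m' n'} (f : PropTerm S m n) (g : PropTerm S m' n') :
      Rel S (comp (tensor f g) (braid n n')) (comp (braid m m') (tensor g f))
  | braid_braid (m n) : Rel S (comp (braid m n) (braid n m)) (id (m + n))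
  | hexagon (m n p) :
      Rel S (castHom (Hom := PropTerm S) (Nat.add_assoc m n p).symm (Nat.add_assoc n p m)
          (braid m (n + p)))
        (comp (castHom (Hom := PropTerm S) rfl (Nat.add_assoc n m p) (tensor (braid m n) (id p)))
          (tensor (id n) (braid m p)))

instance setoid (S : ℕ → ℕ → Type u) (m n : ℕ) : Setoid (PropTerm S m n) where
  r := Rel S
  iseqv := ⟨Rel.refl, Rel.symm, Rel.trans⟩

/-- The value of an expression in a prop, given the values of the generators. -/
def eval {S : ℕ → ℕ → Type u} (P : PROP.{v}) (φ : ∀ m n, S m n → P.Hom m n) :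
    ∀ {m n : ℕ}, PropTerm S m n → P.Hom m n
  | _, _, gen s => φ _ _ s
  | _, _, id n => P.id n
  | _, _, comp f g => P.comp (eval P φ f) (eval P φ g)
  | _, _, tensor f g => P.tensor (eval P φ f) (eval P φ g)
  | _, _, braid m n => P.braid m n

theorem eval_castHom {S : ℕ → ℕ → Type u} (P : PROP.{v}) (φ : ∀ m n, S m n → P.Hom m n)
    {m n m' n' : ℕ} (hm : m = m') (hn : n = n') (f : PropTerm S m n) :
    eval P φ (castHom (Hom := PropTerm S) hm hn f) =
      castHom (Hom := P.Hom) hm hn (eval P φ f) := by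
  subst hm hn; rfl

theorem eval_rel {S : ℕ → ℕ → Type u} (P : PROP.{v}) (φ : ∀ m n, S m n → P.Hom m n)
    {m n : ℕ} {f g : PropTerm S m n} (h : Rel S f g) : eval P φ f = eval P φ g := by
  induction h with
  | refl => rfl
  | symm _ ih => exact ih.symm
  | trans _ _ ih₁ ih₂ => exact ih₁.trans ih₂
  | comp_congr _ _ ih₁ ih₂ => simp only [eval, ih₁, ih₂]
  | tensor_congr _ _ ih₁ ih₂ => simp only [eval, ih₁, ih₂]
  | id_comp => exact P.id_comp _
  | comp_id => exact P.comp_id _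
  | assoc => exact P.assoc _ _ _
  | tensor_id => exact P.tensor_id _ _
  | tensor_comp => exact P.tensor_comp _ _ _ _
  | tensor_assoc => rw [eval_castHom]; exact P.tensor_assoc _ _ _
  | id_tensor => rw [eval_castHom]; exact P.id_tensor _
  | tensor_unit => rw [eval_castHom]; exact P.tensor_unit _
  | braid_natural => exact P.braid_natural _ _
  | braid_braid => exact P.braid_braid _ _
  | hexagon => simp only [eval, eval_castHom]; exact P.hexagon _ _ _

theorem mk_castHom {S : ℕ → ℕ → Type u} {m n m' n' : ℕ} (hm : m = m') (hn : n = n')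
    (f : PropTerm S m n) :
    castHom (Hom := fun m n => Quotient (setoid S m n)) hm hn (Quotient.mk _ f) =
      Quotient.mk _ (castHom (Hom := PropTerm S) hm hn f) := by
  subst hm hn; rfl

end PropTerm

/-- The free prop on a signature: expressions modulo the laws of a prop. -/
def freeProp (S : ℕ → ℕ → Type u) : PROP.{u} where
  Hom m n := Quotient (PropTerm.setoid S m n)
  id n := Quotient.mk _ (.id n)
  comp := Quotient.map₂ .comp fun _ _ h _ _ h' => .comp_congr h h'
  tensor := Quotient.map₂ .tensor fun _ _ h _ _ h' => .tensor_congr h h'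
  braid m n := Quotient.mk _ (.braid m n)
  id_comp := by rintro m n ⟨f⟩; exact Quotient.sound (.id_comp f)
  comp_id := by rintro m n ⟨f⟩; exact Quotient.sound (.comp_id f)
  assoc := by rintro m n p q ⟨f⟩ ⟨g⟩ ⟨h⟩; exact Quotient.sound (.assoc f g h)
  tensor_id m n := Quotient.sound (.tensor_id m n)
  tensor_comp := by
    rintro m n p m' n' p' ⟨f⟩ ⟨g⟩ ⟨f'⟩ ⟨g'⟩; exact Quotient.sound (.tensor_comp f g f' g')
  tensor_assoc := by
    rintro m n m' n' m'' n'' ⟨f⟩ ⟨g⟩ ⟨h⟩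
    exact (PropTerm.mk_castHom _ _ _).trans (Quotient.sound (.tensor_assoc f g h))
  id_tensor := by
    rintro m n ⟨f⟩
    exact (PropTerm.mk_castHom _ _ _).trans (Quotient.sound (.id_tensor f))
  tensor_unit := by
    rintro m n ⟨f⟩
    exact (PropTerm.mk_castHom _ _ _).trans (Quotient.sound (.tensor_unit f))
  braid_natural := by
    rintro m n m' n' ⟨f⟩ ⟨g⟩; exact Quotient.sound (.braid_natural f g)
  braid_braid m n := Quotient.sound (.braid_braid m n)
  hexagon m n p := by
    simp only [Quotient.map₂_mk]
    rw [PropTerm.mk_castHom, PropTerm.mk_castHom]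
    exact Quotient.sound (PropTerm.Rel.hexagon m n p)

/-- A generator, as a morphism of the free prop. -/
def freeProp.of {S : ℕ → ℕ → Type u} {m n : ℕ} (s : S m n) : (freeProp S).Hom m n :=
  Quotient.mk (PropTerm.setoid S m n) (.gen s)

/-- The morphism out of a free prop with prescribed values on the generators. -/
def freeProp.lift {S : ℕ → ℕ → Type u} (P : PROP.{v}) (φ : ∀ m n, S m n → P.Hom m n) :
    PROP.Morphism (freeProp S) P where
  map := Quotient.lift (PropTerm.eval P φ) fun _ _ h => PropTerm.eval_rel P φ h
  map_id _ := rfl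
  map_comp := by rintro m n p ⟨f⟩ ⟨g⟩; rfl
  map_tensor := by rintro m n m' n' ⟨f⟩ ⟨g⟩; rfl
  map_braid _ _ := rfl

/-- The signature with one generator `1 → 1` for each element of `L`, and no others. -/
inductive LabelSig (L : Type u) : ℕ → ℕ → Type u
  | label (l : L) : LabelSig L 1 1

/-- `F(L)`, the prop for `L`-actions. -/
def labelProp (L : Type u) : PROP.{u} := freeProp (LabelSig L)

/-! ## Symmetric monoidal categories of finite sets, and the props they give -/

/-- The operations of a symmetric monoidal category whose objects are the finite sets, with
disjoint union as tensor product.  Every bijection `X ≃ Y` gives a morphism `ofEquiv`; the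
identities, associators, unitors and braidings are those given by the obvious bijections. -/
structure FinSetOps where
  Hom : ∀ (X Y : Type) [Fintype X] [Fintype Y], Type v
  ofEquiv : ∀ {X Y : Type} [Fintype X] [Fintype Y], X ≃ Y → Hom X Y
  comp : ∀ {X Y Z : Type} [Fintype X] [Fintype Y] [Fintype Z], Hom X Y → Hom Y Z → Hom X Z
  tensor : ∀ {X Y X' Y' : Type} [Fintype X] [Fintype Y] [Fintype X'] [Fintype Y'],
    Hom X Y → Hom X' Y' → Hom (X ⊕ X') (Y ⊕ Y')

namespace FinSetOps

/-- The laws of a symmetric monoidal category for such operations. -/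
structure Lawful (O : FinSetOps.{v}) : Prop where
  id_comp : ∀ {X Y : Type} [Fintype X] [Fintype Y] (f : O.Hom X Y),
    O.comp (O.ofEquiv (Equiv.refl X)) f = f
  comp_id : ∀ {X Y : Type} [Fintype X] [Fintype Y] (f : O.Hom X Y),
    O.comp f (O.ofEquiv (Equiv.refl Y)) = f
  assoc : ∀ {X Y Z W : Type} [Fintype X] [Fintype Y] [Fintype Z] [Fintype W]
    (f : O.Hom X Y) (g : O.Hom Y Z) (h : O.Hom Z W),
    O.comp (O.comp f g) h = O.comp f (O.comp g h)
  ofEquiv_trans : ∀ {X Y Z : Type} [Fintype X] [Fintype Y] [Fintype Z] (e : X ≃ Y) (e' : Y ≃ Z),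
    O.comp (O.ofEquiv e) (O.ofEquiv e') = O.ofEquiv (e.trans e')
  tensor_ofEquiv : ∀ {X Y X' Y' : Type} [Fintype X] [Fintype Y] [Fintype X'] [Fintype Y']
    (e : X ≃ Y) (e' : X' ≃ Y'),
    O.tensor (O.ofEquiv e) (O.ofEquiv e') = O.ofEquiv (Equiv.sumCongr e e')
  tensor_comp : ∀ {X Y Z X' Y' Z' : Type} [Fintype X] [Fintype Y] [Fintype Z] [Fintype X']
    [Fintype Y'] [Fintype Z'] (f : O.Hom X Y) (g : O.Hom Y Z) (f' : O.Hom X' Y')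
    (g' : O.Hom Y' Z'),
    O.tensor (O.comp f g) (O.comp f' g') = O.comp (O.tensor f f') (O.tensor g g')
  assoc_natural : ∀ {X Y X' Y' X'' Y'' : Type} [Fintype X] [Fintype Y] [Fintype X']
    [Fintype Y'] [Fintype X''] [Fintype Y''] (f : O.Hom X Y) (g : O.Hom X' Y')
    (h : O.Hom X'' Y''),
    O.comp (O.tensor (O.tensor f g) h) (O.ofEquiv (Equiv.sumAssoc Y Y' Y'')) =
      O.comp (O.ofEquiv (Equiv.sumAssoc X X' X'')) (O.tensor f (O.tensor g h))
  unit_natural : ∀ {X Y : Type} [Fintype X] [Fintype Y] (f : O.Hom X Y),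
    O.comp (O.tensor (O.ofEquiv (Equiv.refl (Fin 0))) f) (O.ofEquiv (Equiv.emptySum (Fin 0) Y)) =
      O.comp (O.ofEquiv (Equiv.emptySum (Fin 0) X)) f
  braid_natural : ∀ {X Y X' Y' : Type} [Fintype X] [Fintype Y] [Fintype X'] [Fintype Y']
    (f : O.Hom X Y) (g : O.Hom X' Y'),
    O.comp (O.tensor f g) (O.ofEquiv (Equiv.sumComm Y Y')) =
      O.comp (O.ofEquiv (Equiv.sumComm X X')) (O.tensor g f)

theorem castHom_eq {O : FinSetOps.{v}} (hO : O.Lawful) {m n m' n' : ℕ} (hm : m = m') (hn : n = n')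
    (f : O.Hom (Fin m) (Fin n)) :
    castHom (Hom := fun m n => O.Hom (Fin m) (Fin n)) hm hn f =
      O.comp (O.ofEquiv (finCongr hm.symm)) (O.comp f (O.ofEquiv (finCongr hn))) := by
  subst hm hn
  simp only [finCongr_refl, hO.id_comp, hO.comp_id]
  rfl

/-- Precomposition and postcomposition with bijections. -/
def conj (O : FinSetOps.{v}) {X Y X' Y' : Type} [Fintype X] [Fintype Y] [Fintype X'] [Fintype Y']
    (e : X' ≃ X) (f : O.Hom X Y) (e' : Y ≃ Y') : O.Hom X' Y' :=
  O.comp (O.ofEquiv e) (O.comp f (O.ofEquiv e'))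

theorem conj_refl {O : FinSetOps.{v}} (hO : O.Lawful) {X Y : Type} [Fintype X] [Fintype Y] (f : O.Hom X Y) :
    O.conj (Equiv.refl X) f (Equiv.refl Y) = f := by
  rw [conj, hO.id_comp, hO.comp_id]

theorem conj_conj {O : FinSetOps.{v}} (hO : O.Lawful) {X Y X' Y' X'' Y'' : Type} [Fintype X] [Fintype Y] [Fintype X']
    [Fintype Y'] [Fintype X''] [Fintype Y''] (a : X'' ≃ X') (e : X' ≃ X) (f : O.Hom X Y)
    (e' : Y ≃ Y') (b : Y' ≃ Y'') :
    O.conj a (O.conj e f e') b = O.conj (a.trans e) f (e'.trans b) := by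
  simp only [conj, ← hO.ofEquiv_trans, hO.assoc]

theorem conj_comp_conj {O : FinSetOps.{v}} (hO : O.Lawful) {X Y Z X' Y' Z' : Type} [Fintype X] [Fintype Y] [Fintype Z]
    [Fintype X'] [Fintype Y'] [Fintype Z'] (a : X' ≃ X) (f : O.Hom X Y) (b : Y ≃ Y')
    (c : Y' ≃ Y) (g : O.Hom Y Z) (d : Z ≃ Z') (h : b.trans c = Equiv.refl Y) :
    O.comp (O.conj a f b) (O.conj c g d) = O.conj a (O.comp f g) d := by
  simp only [conj, hO.assoc]
  rw [← hO.assoc (O.ofEquiv b), hO.ofEquiv_trans, h, hO.id_comp]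

theorem tensor_conj {O : FinSetOps.{v}} (hO : O.Lawful) {X Y X' Y' A B A' B' : Type} [Fintype X] [Fintype Y]
    [Fintype X'] [Fintype Y'] [Fintype A] [Fintype B] [Fintype A'] [Fintype B']
    (a : A ≃ X) (f : O.Hom X Y) (b : Y ≃ B) (a' : A' ≃ X') (f' : O.Hom X' Y') (b' : Y' ≃ B') :
    O.tensor (O.conj a f b) (O.conj a' f' b') =
      O.conj (Equiv.sumCongr a a') (O.tensor f f') (Equiv.sumCongr b b') := by
  simp only [conj, hO.tensor_comp, hO.tensor_ofEquiv]

theorem conj_ofEquiv {O : FinSetOps.{v}} (hO : O.Lawful) {X Y X' Y' : Type} [Fintype X] [Fintype Y] [Fintype X']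
    [Fintype Y'] (e : X' ≃ X) (f : X ≃ Y) (e' : Y ≃ Y') :
    O.conj e (O.ofEquiv f) e' = O.ofEquiv (e.trans (f.trans e')) := by
  simp only [conj, hO.ofEquiv_trans]

theorem comp_ofEquiv_eq {O : FinSetOps.{v}} (hO : O.Lawful) {X Y Y' : Type} [Fintype X] [Fintype Y] [Fintype Y']
    (f : O.Hom X Y) (e : Y ≃ Y') : O.comp f (O.ofEquiv e) = O.conj (Equiv.refl X) f e := by
  rw [conj, hO.id_comp]

theorem ofEquiv_comp_eq {O : FinSetOps.{v}} (hO : O.Lawful) {X Y X' : Type} [Fintype X] [Fintype Y] [Fintype X']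
    (e : X' ≃ X) (f : O.Hom X Y) : O.comp (O.ofEquiv e) f = O.conj e f (Equiv.refl Y) := by
  rw [conj, hO.comp_id]

theorem conj_eq_iff {O : FinSetOps.{v}} (hO : O.Lawful) {X Y X' Y' A B : Type} [Fintype X] [Fintype Y] [Fintype X']
    [Fintype Y'] [Fintype A] [Fintype B] {f : O.Hom X Y} {g : O.Hom X' Y'} {a : X ≃ X'}
    {b : Y ≃ Y'} (h : O.comp f (O.ofEquiv b) = O.comp (O.ofEquiv a) g)
    (p : A ≃ X) (q : Y ≃ B) (p' : A ≃ X') (q' : Y' ≃ B) (hp : p' = p.trans a)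
    (hq : q = b.trans q') : O.conj p f q = O.conj p' g q' := by
  subst hp hq
  simp only [conj, ← hO.ofEquiv_trans, hO.assoc]
  rw [← hO.assoc f, h, hO.assoc]

/-- The prop given by such a category: `Hom m n` consists of the morphisms between the standard
finite sets `Fin m` and `Fin n`, and disjoint unions of standard finite sets are identified with
standard finite sets by listing the elements of the first summand first. -/
def toPROP (O : FinSetOps.{v}) (hO : O.Lawful) : PROP.{v} where
  Hom m n := O.Hom (Fin m) (Fin n)
  id n := O.ofEquiv (Equiv.refl (Fin n))
  comp f g := O.comp f g
  tensor f g := O.conj finSumFinEquiv.symm (O.tensor f g) finSumFinEquiv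
  braid m n := O.ofEquiv ((finSumFinEquiv.symm.trans (Equiv.sumComm _ _)).trans finSumFinEquiv)
  id_comp f := hO.id_comp f
  comp_id f := hO.comp_id f
  assoc f g h := hO.assoc f g h
  tensor_id m n := by
    rw [hO.tensor_ofEquiv, conj_ofEquiv hO]
    congr 1
    ext; simp
  tensor_comp f g f' g' := by
    rw [hO.tensor_comp, conj_comp_conj hO _ _ _ _ _ _ (by ext; simp)]
  tensor_assoc {m n m' n' m'' n''} f g h := by
    rw [castHom_eq hO]
    change O.conj _ _ _ = _
    conv_lhs => rw [← conj_refl hO h]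
    conv_rhs => rw [← conj_refl hO f]
    simp only [tensor_conj hO, conj_conj hO]
    refine conj_eq_iff hO (hO.assoc_natural f g h) _ _ _ _ ?_ ?_
    · apply Equiv.symm_bijective.injective
      ext (x | x | x) <;> simp [finSumFinEquiv, Nat.add_assoc]
    · ext ((x | x) | x) <;> simp [finSumFinEquiv, Nat.add_assoc]
  id_tensor {m n} f := by
    rw [castHom_eq hO]
    change O.conj _ _ _ = _
    conv_rhs => rw [← conj_refl hO f]
    rw [conj_conj hO]
    refine conj_eq_iff hO (hO.unit_natural f) _ _ _ _ ?_ ?_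
    · apply Equiv.symm_bijective.injective
      ext x; simp [finSumFinEquiv]
    · ext (x | x)
      · exact x.elim0
      · simp [finSumFinEquiv]
  tensor_unit {m n} f := by
    rw [castHom_eq hO]
    change O.conj _ _ _ = _
    conv_rhs => rw [← conj_refl hO f]
    rw [conj_conj hO]
    have h₁ := hO.braid_natural f (O.ofEquiv (Equiv.refl (Fin 0)))
    rw [← conj_refl hO (O.tensor f (O.ofEquiv (Equiv.refl (Fin 0))))]
    rw [conj_eq_iff hO h₁ _ _ (Equiv.sumComm _ _) (Equiv.sumComm _ _) rfl (by ext x; simp),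
      conj_conj hO]
    refine conj_eq_iff hO (hO.unit_natural f) _ _ _ _ ?_ ?_
    · apply Equiv.symm_bijective.injective
      ext x; simp [finSumFinEquiv]
    · ext (x | x)
      · exact x.elim0
      · simp [finSumFinEquiv]
  braid_natural {m n m' n'} f g := by
    rw [comp_ofEquiv_eq hO, ofEquiv_comp_eq hO, conj_conj hO, conj_conj hO]
    refine conj_eq_iff hO (hO.braid_natural f g) _ _ _ _ ?_ ?_
    · apply Equiv.symm_bijective.injective
      ext (x | x) <;> simp [finSumFinEquiv]
    · ext (x | x) <;> simp [finSumFinEquiv]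
  braid_braid m n := by
    rw [hO.ofEquiv_trans]
    congr 1
    ext x; simp
  hexagon m n p := by
    rw [castHom_eq hO, castHom_eq hO]
    simp only [hO.tensor_ofEquiv, conj_ofEquiv hO, hO.ofEquiv_trans]
    congr 1
    apply Equiv.symm_bijective.injective
    ext x
    obtain ⟨x | x, rfl⟩ := finSumFinEquiv.surjective x
    · have h₁ : Fin.cast (Nat.add_assoc n p m).symm (finSumFinEquiv (Sum.inl x)) =
          finSumFinEquiv (Sum.inl (finSumFinEquiv (Sum.inl x))) := by ext; simp [finSumFinEquiv]
      have h₂ : Fin.cast (Nat.add_assoc n m p).symm (finSumFinEquiv (Sum.inl x)) =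
          finSumFinEquiv (Sum.inl (finSumFinEquiv (Sum.inl x))) := by ext; simp [finSumFinEquiv]
      simp [h₁, h₂, -finSumFinEquiv_apply_left]
      try simp [finSumFinEquiv]
    · obtain ⟨x | x, rfl⟩ := finSumFinEquiv.surjective x
      · have h₁ : Fin.cast (Nat.add_assoc n p m).symm
            (finSumFinEquiv (Sum.inr (finSumFinEquiv (Sum.inl x)))) =
            finSumFinEquiv (Sum.inl (finSumFinEquiv (Sum.inr x))) := by
          ext; simp [finSumFinEquiv]
        have h₂ : Fin.cast (Nat.add_assoc n m p).symm
            (finSumFinEquiv (Sum.inr (finSumFinEquiv (Sum.inr x)))) =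
            finSumFinEquiv (Sum.inr x) := by
          ext; simp [finSumFinEquiv, Nat.add_assoc]
        simp [h₁, h₂, -finSumFinEquiv_apply_left, -finSumFinEquiv_apply_right]
        try simp [finSumFinEquiv, Nat.add_assoc]
      · have h₁ : Fin.cast (Nat.add_assoc n p m).symm
            (finSumFinEquiv (Sum.inr (finSumFinEquiv (Sum.inr x)))) =
            finSumFinEquiv (Sum.inr x) := by
          ext; simp [finSumFinEquiv, Nat.add_assoc]
        have h₂ : Fin.cast (Nat.add_assoc n m p).symm
            (finSumFinEquiv (Sum.inr (finSumFinEquiv (Sum.inl x)))) =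
            finSumFinEquiv (Sum.inl (finSumFinEquiv (Sum.inr x))) := by
          ext; simp [finSumFinEquiv]
        simp [h₁, h₂, -finSumFinEquiv_apply_left, -finSumFinEquiv_apply_right]
        try simp [finSumFinEquiv]

/-- A map of such operations that is the identity on objects. -/
structure Map (O : FinSetOps.{v}) (O' : FinSetOps.{w}) where
  map : ∀ {X Y : Type} [Fintype X] [Fintype Y], O.Hom X Y → O'.Hom X Y
  map_ofEquiv : ∀ {X Y : Type} [Fintype X] [Fintype Y] (e : X ≃ Y),
    map (O.ofEquiv e) = O'.ofEquiv e
  map_comp : ∀ {X Y Z : Type} [Fintype X] [Fintype Y] [Fintype Z] (f : O.Hom X Y)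
    (g : O.Hom Y Z), map (O.comp f g) = O'.comp (map f) (map g)
  map_tensor : ∀ {X Y X' Y' : Type} [Fintype X] [Fintype Y] [Fintype X'] [Fintype Y']
    (f : O.Hom X Y) (g : O.Hom X' Y'), map (O.tensor f g) = O'.tensor (map f) (map g)

/-- The morphism of props given by such a map. -/
def Map.toMorphism {O : FinSetOps.{v}} {O' : FinSetOps.{w}} (F : Map O O') (hO : O.Lawful)
    (hO' : O'.Lawful) : PROP.Morphism (O.toPROP hO) (O'.toPROP hO') where
  map f := F.map f
  map_id _ := F.map_ofEquiv _
  map_comp f g := F.map_comp f g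
  map_tensor f g := by
    have h := F.map_tensor f g
    simp only [toPROP, conj, F.map_comp, F.map_ofEquiv]
    exact congrArg (fun t => O'.comp _ (O'.comp t _)) h
  map_braid _ _ := F.map_ofEquiv _

theorem Map.lawful {O : FinSetOps.{v}} {O' : FinSetOps.{w}} (F : Map O O')
    (hF : ∀ (X Y : Type) [Fintype X] [Fintype Y],
      Function.Surjective (F.map : O.Hom X Y → O'.Hom X Y))
    (hO : O.Lawful) : O'.Lawful where
  id_comp f := by
    obtain ⟨f, rfl⟩ := hF _ _ f
    simp only [← F.map_ofEquiv, ← F.map_comp, hO.id_comp]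
  comp_id f := by
    obtain ⟨f, rfl⟩ := hF _ _ f
    simp only [← F.map_ofEquiv, ← F.map_comp, hO.comp_id]
  assoc f g h := by
    obtain ⟨f, rfl⟩ := hF _ _ f
    obtain ⟨g, rfl⟩ := hF _ _ g
    obtain ⟨h, rfl⟩ := hF _ _ h
    simp only [← F.map_comp, hO.assoc]
  ofEquiv_trans e e' := by
    simp only [← F.map_ofEquiv, ← F.map_comp, hO.ofEquiv_trans]
  tensor_ofEquiv e e' := by
    simp only [← F.map_ofEquiv, ← F.map_tensor, hO.tensor_ofEquiv]
  tensor_comp f g f' g' := by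
    obtain ⟨f, rfl⟩ := hF _ _ f
    obtain ⟨g, rfl⟩ := hF _ _ g
    obtain ⟨f', rfl⟩ := hF _ _ f'
    obtain ⟨g', rfl⟩ := hF _ _ g'
    simp only [← F.map_comp, ← F.map_tensor, hO.tensor_comp]
  assoc_natural f g h := by
    obtain ⟨f, rfl⟩ := hF _ _ f
    obtain ⟨g, rfl⟩ := hF _ _ g
    obtain ⟨h, rfl⟩ := hF _ _ h
    simp only [← F.map_comp, ← F.map_tensor, ← F.map_ofEquiv, hO.assoc_natural]
  unit_natural f := by
    obtain ⟨f, rfl⟩ := hF _ _ f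
    simp only [← F.map_comp, ← F.map_tensor, ← F.map_ofEquiv, hO.unit_natural]
  braid_natural f g := by
    obtain ⟨f, rfl⟩ := hF _ _ f
    obtain ⟨g, rfl⟩ := hF _ _ g
    simp only [← F.map_comp, ← F.map_tensor, ← F.map_ofEquiv, hO.braid_natural]

end FinSetOps

/-! ## Cospans and circuits -/

/-- The pushout of `f : Y → A` and `g : Y → B` in the category of sets. -/
def Pushout {Y A B : Type} (f : Y → A) (g : Y → B) : Type :=
  Quot fun a b : A ⊕ B => ∃ y, a = Sum.inl (f y) ∧ b = Sum.inr (g y)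

namespace Pushout

variable {Y A B : Type} {f : Y → A} {g : Y → B}

/-- The first coprojection. -/
def inl (f : Y → A) (g : Y → B) (a : A) : Pushout f g := Quot.mk _ (Sum.inl a)

/-- The second coprojection. -/
def inr (f : Y → A) (g : Y → B) (b : B) : Pushout f g := Quot.mk _ (Sum.inr b)

theorem glue (y : Y) : inl f g (f y) = inr f g (g y) := Quot.sound ⟨y, rfl, rfl⟩

/-- The map out of a pushout given by two compatible maps. -/
def desc {T : Type} (a : A → T) (b : B → T) (h : ∀ y, a (f y) = b (g y)) : Pushout f g → T :=
  Quot.lift (Sum.elim a b) (by rintro _ _ ⟨y, rfl, rfl⟩; exact h y)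

@[simp] theorem desc_inl {T : Type} (a : A → T) (b : B → T) (h : ∀ y, a (f y) = b (g y)) (x : A) :
    desc a b h (inl f g x) = a x := rfl

@[simp] theorem desc_inr {T : Type} (a : A → T) (b : B → T) (h : ∀ y, a (f y) = b (g y)) (x : B) :
    desc a b h (inr f g x) = b x := rfl

theorem ind {motive : Pushout f g → Prop} (hl : ∀ a, motive (inl f g a))
    (hr : ∀ b, motive (inr f g b)) (x : Pushout f g) : motive x := by
  rcases x with ⟨a | b⟩
  exacts [hl a, hr b]

instance [Finite A] [Finite B] : Finite (Pushout f g) := Quot.finite _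

end Pushout

/-- A cospan of finite sets from `X` to `Y`. -/
structure Cospan (X Y : Type) where
  N : Type
  finite_N : Finite N
  inp : X → N
  out : Y → N

attribute [instance] Cospan.finite_N

/-- An `L`-circuit from `X` to `Y`: a cospan `X → N ← Y` of finite sets together with an
`L`-graph with `N` as its set of nodes. -/
structure Circuit (L : Type u) (X Y : Type) extends Cospan X Y where
  E : Type
  finite_E : Finite E
  src : E → N
  tgt : E → N
  lab : E → L

attribute [instance] Circuit.finite_E

namespace Cospan

/-- Isomorphism of cospans. -/
def Iso {X Y : Type} (c d : Cospan X Y) : Prop :=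
  ∃ e : c.N ≃ d.N, (∀ x, e (c.inp x) = d.inp x) ∧ ∀ y, e (c.out y) = d.out y

instance setoid (X Y : Type) : Setoid (Cospan X Y) where
  r := Iso
  iseqv :=
    { refl := fun _ => ⟨Equiv.refl _, fun _ => rfl, fun _ => rfl⟩
      symm := by
        rintro c d ⟨e, hi, ho⟩
        exact ⟨e.symm, fun x => by rw [← hi, e.symm_apply_apply],
          fun y => by rw [← ho, e.symm_apply_apply]⟩
      trans := by
        rintro c d k ⟨e, hi, ho⟩ ⟨e', hi', ho'⟩
        exact ⟨e.trans e', fun x => by simp [hi, hi'], fun y => by simp [ho, ho']⟩ }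

/-- A bijection as a cospan. -/
def ofEquiv {X Y : Type} [Fintype Y] (e : X ≃ Y) : Cospan X Y where
  N := Y
  finite_N := inferInstance
  inp := e
  out := id

/-- Composition of cospans by pushout. -/
def comp {X Y Z : Type} (c : Cospan X Y) (d : Cospan Y Z) : Cospan X Z where
  N := Pushout c.out d.inp
  finite_N := inferInstance
  inp x := Pushout.inl _ _ (c.inp x)
  out z := Pushout.inr _ _ (d.out z)

/-- Disjoint union of cospans. -/
def tensor {X Y X' Y' : Type} (c : Cospan X Y) (d : Cospan X' Y') :
    Cospan (X ⊕ X') (Y ⊕ Y') where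
  N := c.N ⊕ d.N
  finite_N := inferInstance
  inp := Sum.map c.inp d.inp
  out := Sum.map c.out d.out

end Cospan

namespace Circuit

variable {L : Type u}

/-- Isomorphism of circuits: bijections between the nodes and between the edges that preserve
inputs, outputs, sources, targets and labels. -/
def Iso {X Y : Type} (c d : Circuit L X Y) : Prop :=
  ∃ (e : c.N ≃ d.N) (a : c.E ≃ d.E), (∀ x, e (c.inp x) = d.inp x) ∧
    (∀ y, e (c.out y) = d.out y) ∧ (∀ i, e (c.src i) = d.src (a i)) ∧
    (∀ i, e (c.tgt i) = d.tgt (a i)) ∧ ∀ i, c.lab i = d.lab (a i)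

instance setoid (L : Type u) (X Y : Type) : Setoid (Circuit L X Y) where
  r := Iso
  iseqv :=
    { refl := fun _ => ⟨Equiv.refl _, Equiv.refl _, fun _ => rfl, fun _ => rfl, fun _ => rfl,
        fun _ => rfl, fun _ => rfl⟩
      symm := by
        rintro c d ⟨e, a, hi, ho, hs, ht, hl⟩
        refine ⟨e.symm, a.symm, fun x => ?_, fun x => ?_, fun x => ?_, fun x => ?_, fun x => ?_⟩
        · rw [← hi, e.symm_apply_apply]
        · rw [← ho, e.symm_apply_apply]
        · rw [e.symm_apply_eq, hs, a.apply_symm_apply]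
        · rw [e.symm_apply_eq, ht, a.apply_symm_apply]
        · rw [hl, a.apply_symm_apply]
      trans := by
        rintro c d k ⟨e, a, hi, ho, hs, ht, hl⟩ ⟨e', a', hi', ho', hs', ht', hl'⟩
        exact ⟨e.trans e', a.trans a', fun x => by simp [hi, hi'], fun y => by simp [ho, ho'],
          fun x => by simp [hs, hs'], fun x => by simp [ht, ht'], fun x => by simp [hl, hl']⟩ }

/-- A cospan as a circuit without edges. -/
def ofCospan (L : Type u) {X Y : Type} (c : Cospan X Y) : Circuit L X Y where
  toCospan := c
  E := Empty
  finite_E := inferInstance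
  src := Empty.elim
  tgt := Empty.elim
  lab := Empty.elim

instance {X Y : Type} (c : Cospan X Y) : IsEmpty (ofCospan L c).E :=
  inferInstanceAs (IsEmpty Empty)

/-- The circuit with one edge, labelled `l`, from its input to its output. -/
def edge (l : L) : Circuit L (Fin 1) (Fin 1) where
  N := Fin 2
  finite_N := inferInstance
  inp _ := 0
  out _ := 1
  E := Unit
  finite_E := inferInstance
  src _ := 0
  tgt _ := 1
  lab _ := l

/-- Composition of circuits: the underlying cospans are composed by pushout, and the graphs are
glued along the identified nodes. -/
def comp {X Y Z : Type} (c : Circuit L X Y) (d : Circuit L Y Z) : Circuit L X Z where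
  toCospan := c.toCospan.comp d.toCospan
  E := c.E ⊕ d.E
  finite_E := inferInstance
  src := Sum.elim (fun i => Pushout.inl _ _ (c.src i)) fun i => Pushout.inr _ _ (d.src i)
  tgt := Sum.elim (fun i => Pushout.inl _ _ (c.tgt i)) fun i => Pushout.inr _ _ (d.tgt i)
  lab := Sum.elim c.lab d.lab

/-- Disjoint union of circuits. -/
def tensor {X Y X' Y' : Type} (c : Circuit L X Y) (d : Circuit L X' Y') :
    Circuit L (X ⊕ X') (Y ⊕ Y') where
  toCospan := c.toCospan.tensor d.toCospan
  E := c.E ⊕ d.E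
  finite_E := inferInstance
  src := Sum.map c.src d.src
  tgt := Sum.map c.tgt d.tgt
  lab := Sum.elim c.lab d.lab

theorem comp_congr {X Y Z : Type} {c c' : Circuit L X Y} {d d' : Circuit L Y Z} (h : c ≈ c')
    (h' : d ≈ d') : c.comp d ≈ c'.comp d' := by
  obtain ⟨e, a, hi, ho, hs, ht, hl⟩ := h
  obtain ⟨e', a', hi', ho', hs', ht', hl'⟩ := h'
  refine ⟨⟨Pushout.desc (fun x => Pushout.inl _ _ (e x)) (fun x => Pushout.inr _ _ (e' x)) ?_,
    Pushout.desc (fun x => Pushout.inl _ _ (e.symm x)) (fun x => Pushout.inr _ _ (e'.symm x)) ?_,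
    ?_, ?_⟩, Equiv.sumCongr a a', ?_, ?_, ?_, ?_, ?_⟩
  · intro y
    rw [ho, hi']
    exact Pushout.glue y
  · intro y
    rw [← ho, ← hi', e.symm_apply_apply, e'.symm_apply_apply]
    exact Pushout.glue y
  · exact Pushout.ind (fun x => congrArg (Pushout.inl _ _) (e.symm_apply_apply x))
      (fun x => congrArg (Pushout.inr _ _) (e'.symm_apply_apply x))
  · exact Pushout.ind (fun x => congrArg (Pushout.inl _ _) (e.apply_symm_apply x))
      (fun x => congrArg (Pushout.inr _ _) (e'.apply_symm_apply x))
  · exact fun x => congrArg (Pushout.inl _ _) (hi x)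
  · exact fun x => congrArg (Pushout.inr _ _) (ho' x)
  · rintro (x | x)
    exacts [congrArg (Pushout.inl _ _) (hs x), congrArg (Pushout.inr _ _) (hs' x)]
  · rintro (x | x)
    exacts [congrArg (Pushout.inl _ _) (ht x), congrArg (Pushout.inr _ _) (ht' x)]
  · rintro (x | x)
    exacts [hl x, hl' x]

theorem tensor_congr {X Y X' Y' : Type} {c c' : Circuit L X Y} {d d' : Circuit L X' Y'}
    (h : c ≈ c') (h' : d ≈ d') : c.tensor d ≈ c'.tensor d' := by
  obtain ⟨e, a, hi, ho, hs, ht, hl⟩ := h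
  obtain ⟨e', a', hi', ho', hs', ht', hl'⟩ := h'
  refine ⟨Equiv.sumCongr e e', Equiv.sumCongr a a', ?_, ?_, ?_, ?_, ?_⟩ <;> rintro (x | x)
  exacts [congrArg Sum.inl (hi x), congrArg Sum.inr (hi' x), congrArg Sum.inl (ho x),
    congrArg Sum.inr (ho' x), congrArg Sum.inl (hs x), congrArg Sum.inr (hs' x),
    congrArg Sum.inl (ht x), congrArg Sum.inr (ht' x), hl x, hl' x]

/-- Change of inputs and outputs along functions. -/
def reindex {X Y X' Y' : Type} (f : X' → X) (c : Circuit L X Y) (g : Y' → Y) :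
    Circuit L X' Y' where
  N := c.N
  finite_N := c.finite_N
  inp := c.inp ∘ f
  out := c.out ∘ g
  E := c.E
  finite_E := c.finite_E
  src := c.src
  tgt := c.tgt
  lab := c.lab

theorem ofEquiv_comp {X Y Z : Type} [Fintype Y] (e : X ≃ Y) (c : Circuit L Y Z) :
    (ofCospan L (Cospan.ofEquiv e)).comp c ≈ c.reindex e id := by
  refine ⟨⟨Pushout.desc (fun y => c.inp y) id fun _ => rfl, fun x => Pushout.inr _ _ x, ?_, ?_⟩,
    Equiv.emptySum _ _, ?_, ?_, ?_, ?_, ?_⟩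
  · refine Pushout.ind (fun y => ?_) fun x => rfl
    exact (Pushout.glue (f := (Cospan.ofEquiv e).out) (g := c.inp) y).symm
  · intro x; rfl
  · intro x; rfl
  · intro x; rfl
  all_goals rintro (x | x)
  all_goals first | exact isEmptyElim (α := Empty) x | rfl

theorem comp_ofEquiv {X Y Z : Type} [Fintype Z] (c : Circuit L X Y) (e : Y ≃ Z) :
    c.comp (ofCospan L (Cospan.ofEquiv e)) ≈ c.reindex id e.symm := by
  refine ⟨⟨Pushout.desc id (fun z => c.out (e.symm z)) fun y => ?_, fun x => Pushout.inl _ _ x,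
    ?_, ?_⟩, Equiv.sumEmpty _ _, ?_, ?_, ?_, ?_, ?_⟩
  · exact congrArg c.out (e.symm_apply_apply y).symm
  · refine Pushout.ind (fun x => rfl) fun z => ?_
    refine (Pushout.glue (f := c.out) (g := (Cospan.ofEquiv e).inp) (e.symm z)).trans ?_
    exact congrArg (Pushout.inr _ _) (e.apply_symm_apply z)
  · intro x; rfl
  · intro x; rfl
  · intro x; rfl
  all_goals rintro (x | x)
  all_goals first | exact isEmptyElim (α := Empty) x | rfl

theorem comp_assoc {X Y Z W : Type} (c : Circuit L X Y) (d : Circuit L Y Z) (k : Circuit L Z W) :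
    (c.comp d).comp k ≈ c.comp (d.comp k) := by
  refine ⟨⟨Pushout.desc (Pushout.desc (fun x => Pushout.inl _ _ x)
      (fun x => Pushout.inr _ _ (Pushout.inl _ _ x)) ?_)
      (fun x => Pushout.inr _ _ (Pushout.inr _ _ x)) ?_,
    Pushout.desc (fun x => Pushout.inl _ _ (Pushout.inl _ _ x))
      (Pushout.desc (fun x => Pushout.inl _ _ (Pushout.inr _ _ x))
      (fun x => Pushout.inr _ _ x) ?_) ?_, ?_, ?_⟩, Equiv.sumAssoc _ _ _, ?_, ?_, ?_, ?_, ?_⟩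
  · exact fun y => Pushout.glue (f := c.out) (g := (d.toCospan.comp k.toCospan).inp) y
  · exact fun z => congrArg (Pushout.inr _ _) (Pushout.glue (f := d.out) (g := k.inp) z)
  · exact fun z => Pushout.glue (f := (c.toCospan.comp d.toCospan).out) (g := k.inp) z
  · exact fun y => congrArg (Pushout.inl _ _) (Pushout.glue (f := c.out) (g := d.inp) y)
  · exact Pushout.ind (Pushout.ind (fun _ => rfl) fun _ => rfl) fun _ => rfl
  · exact Pushout.ind (fun _ => rfl) (Pushout.ind (fun _ => rfl) fun _ => rfl)
  · intro x; rfl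
  · intro x; rfl
  all_goals rintro ((x | x) | x) <;> rfl

theorem tensor_comp {X Y Z X' Y' Z' : Type} (c : Circuit L X Y) (d : Circuit L Y Z)
    (c' : Circuit L X' Y') (d' : Circuit L Y' Z') :
    (c.comp d).tensor (c'.comp d') ≈ (c.tensor c').comp (d.tensor d') := by
  refine ⟨⟨Sum.elim (Pushout.desc (fun x => Pushout.inl _ _ (Sum.inl x))
      (fun x => Pushout.inr _ _ (Sum.inl x)) ?_)
      (Pushout.desc (fun x => Pushout.inl _ _ (Sum.inr x))
      (fun x => Pushout.inr _ _ (Sum.inr x)) ?_),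
    Pushout.desc (Sum.map (Pushout.inl _ _) (Pushout.inl _ _))
      (Sum.map (Pushout.inr _ _) (Pushout.inr _ _)) ?_, ?_, ?_⟩,
      Equiv.sumSumSumComm _ _ _ _, ?_, ?_, ?_, ?_, ?_⟩
  · exact fun y => Pushout.glue (f := (c.tensor c').out) (g := (d.tensor d').inp) (Sum.inl y)
  · exact fun y => Pushout.glue (f := (c.tensor c').out) (g := (d.tensor d').inp) (Sum.inr y)
  · rintro (y | y)
    · exact congrArg Sum.inl (Pushout.glue (f := c.out) (g := d.inp) y)
    · exact congrArg Sum.inr (Pushout.glue (f := c'.out) (g := d'.inp) y)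
  · rintro (x | x)
    · revert x
      exact Pushout.ind (fun _ => rfl) fun _ => rfl
    · revert x
      exact Pushout.ind (fun _ => rfl) fun _ => rfl
  · refine Pushout.ind ?_ ?_ <;> rintro (x | x) <;> rfl
  · rintro (x | x) <;> rfl
  · rintro (x | x) <;> rfl
  all_goals rintro ((x | x) | x | x) <;> rfl

theorem ofEquiv_trans {X Y Z : Type} [Fintype Y] [Fintype Z] (e : X ≃ Y) (e' : Y ≃ Z) :
    (ofCospan L (Cospan.ofEquiv e)).comp (ofCospan L (Cospan.ofEquiv e')) ≈
      ofCospan L (Cospan.ofEquiv (e.trans e')) :=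
  Setoid.trans (ofEquiv_comp _ _) (Setoid.refl _)

theorem tensor_ofEquiv {X Y X' Y' : Type} [Fintype Y] [Fintype Y'] (e : X ≃ Y) (e' : X' ≃ Y') :
    (ofCospan L (Cospan.ofEquiv e)).tensor (ofCospan L (Cospan.ofEquiv e')) ≈
      ofCospan L (Cospan.ofEquiv (Equiv.sumCongr e e')) := by
  refine ⟨Equiv.refl _, Equiv.emptySum _ _, ?_, ?_, ?_, ?_, ?_⟩
  · rintro (x | x) <;> rfl
  · rintro (x | x) <;> rfl
  all_goals rintro (x | x) <;> exact isEmptyElim (α := Empty) x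

theorem assoc_natural {X Y X' Y' X'' Y'' : Type} (c : Circuit L X Y) (d : Circuit L X' Y')
    (k : Circuit L X'' Y'') :
    ((c.tensor d).tensor k).reindex id (Equiv.sumAssoc Y Y' Y'').symm ≈
      (c.tensor (d.tensor k)).reindex (Equiv.sumAssoc X X' X'') id := by
  refine ⟨Equiv.sumAssoc _ _ _, Equiv.sumAssoc _ _ _, ?_, ?_, ?_, ?_, ?_⟩
  · rintro ((x | x) | x) <;> rfl
  · rintro (x | x | x) <;> rfl
  all_goals rintro ((x | x) | x) <;> rfl

theorem unit_natural {X Y : Type} (c : Circuit L X Y) :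
    ((ofCospan L (Cospan.ofEquiv (Equiv.refl (Fin 0)))).tensor c).reindex id
        (Equiv.emptySum (Fin 0) Y).symm ≈ c.reindex (Equiv.emptySum (Fin 0) X) id := by
  refine ⟨Equiv.emptySum (Fin 0) _, Equiv.emptySum _ _, ?_, ?_, ?_, ?_, ?_⟩
  · rintro (x | x)
    · exact x.elim0
    · rfl
  · intro x; rfl
  all_goals rintro (x | x)
  all_goals first | exact isEmptyElim (α := Empty) x | rfl

theorem braid_natural {X Y X' Y' : Type} (c : Circuit L X Y) (d : Circuit L X' Y') :
    (c.tensor d).reindex id (Equiv.sumComm Y Y').symm ≈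
      (d.tensor c).reindex (Equiv.sumComm X X') id := by
  refine ⟨Equiv.sumComm _ _, Equiv.sumComm _ _, ?_, ?_, ?_, ?_, ?_⟩ <;>
    rintro (x | x) <;> rfl

/-- The operations of the category of isomorphism classes of `L`-circuits. -/
def ops (L : Type u) : FinSetOps.{max 1 u} where
  Hom X Y := Quotient (setoid L X Y)
  ofEquiv e := Quotient.mk _ (ofCospan L (Cospan.ofEquiv e))
  comp := Quotient.map₂ comp fun _ _ h _ _ h' => comp_congr h h'
  tensor := Quotient.map₂ tensor fun _ _ h _ _ h' => tensor_congr h h'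

theorem lawful (L : Type u) : (ops L).Lawful where
  id_comp := by
    rintro X Y _ _ ⟨f⟩; exact Quotient.sound (ofEquiv_comp (Equiv.refl X) f)
  comp_id := by
    rintro X Y _ _ ⟨f⟩; exact Quotient.sound (comp_ofEquiv f (Equiv.refl Y))
  assoc := by
    rintro X Y Z W _ _ _ _ ⟨f⟩ ⟨g⟩ ⟨h⟩; exact Quotient.sound (comp_assoc f g h)
  ofEquiv_trans e e' := Quotient.sound (ofEquiv_trans e e')
  tensor_ofEquiv e e' := Quotient.sound (tensor_ofEquiv e e')
  tensor_comp := by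
    rintro X Y Z X' Y' Z' _ _ _ _ _ _ ⟨f⟩ ⟨g⟩ ⟨f'⟩ ⟨g'⟩
    exact Quotient.sound (tensor_comp f g f' g')
  assoc_natural := by
    rintro X Y X' Y' X'' Y'' _ _ _ _ _ _ ⟨f⟩ ⟨g⟩ ⟨h⟩
    exact Quotient.sound (Setoid.trans (comp_ofEquiv _ _)
      (Setoid.trans (assoc_natural f g h) (Setoid.symm (ofEquiv_comp _ _))))
  unit_natural := by
    rintro X Y _ _ ⟨f⟩
    exact Quotient.sound (Setoid.trans (comp_ofEquiv _ _)
      (Setoid.trans (unit_natural f) (Setoid.symm (ofEquiv_comp _ _))))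
  braid_natural := by
    rintro X Y X' Y' _ _ _ _ ⟨f⟩ ⟨g⟩
    exact Quotient.sound (Setoid.trans (comp_ofEquiv _ _)
      (Setoid.trans (braid_natural f g) (Setoid.symm (ofEquiv_comp _ _))))

end Circuit

namespace Cospan

theorem iso_of_circuit {X Y : Type} {c d : Cospan X Y}
    (h : Circuit.ofCospan Empty c ≈ Circuit.ofCospan Empty d) : c ≈ d := by
  obtain ⟨e, _, hi, ho, _⟩ := h
  exact ⟨e, hi, ho⟩

theorem circuit_of_iso (L : Type u) {X Y : Type} {c d : Cospan X Y} (h : c ≈ d) :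
    Circuit.ofCospan L c ≈ Circuit.ofCospan L d := by
  obtain ⟨e, hi, ho⟩ := h
  exact ⟨e, Equiv.refl _, hi, ho, fun x => x.elim, fun x => x.elim, fun x => x.elim⟩

theorem circuit_comp (L : Type u) {X Y Z : Type} (c : Cospan X Y) (d : Cospan Y Z) :
    Circuit.ofCospan L (c.comp d) ≈ (Circuit.ofCospan L c).comp (Circuit.ofCospan L d) :=
  ⟨Equiv.refl _, (Equiv.emptySum Empty Empty).symm, fun _ => rfl, fun _ => rfl, fun x => x.elim,
    fun x => x.elim, fun x => x.elim⟩

theorem circuit_tensor (L : Type u) {X Y X' Y' : Type} (c : Cospan X Y) (d : Cospan X' Y') :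
    Circuit.ofCospan L (c.tensor d) ≈ (Circuit.ofCospan L c).tensor (Circuit.ofCospan L d) :=
  ⟨Equiv.refl _, (Equiv.emptySum Empty Empty).symm, fun _ => rfl, fun _ => rfl, fun x => x.elim,
    fun x => x.elim, fun x => x.elim⟩

theorem iso_of_circuit_iso {L : Type u} {X Y : Type} {c d : Circuit L X Y} (h : c ≈ d) :
    c.toCospan ≈ d.toCospan := by
  obtain ⟨e, _, hi, ho, _⟩ := h
  exact ⟨e, hi, ho⟩

theorem comp_congr {X Y Z : Type} {c c' : Cospan X Y} {d d' : Cospan Y Z} (h : c ≈ c')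
    (h' : d ≈ d') : c.comp d ≈ c'.comp d' :=
  iso_of_circuit_iso (Circuit.comp_congr (circuit_of_iso Empty h) (circuit_of_iso Empty h'))

theorem tensor_congr {X Y X' Y' : Type} {c c' : Cospan X Y} {d d' : Cospan X' Y'} (h : c ≈ c')
    (h' : d ≈ d') : c.tensor d ≈ c'.tensor d' :=
  iso_of_circuit_iso (Circuit.tensor_congr (circuit_of_iso Empty h) (circuit_of_iso Empty h'))

/-- The operations of the category of isomorphism classes of cospans of finite sets. -/
def ops : FinSetOps.{1} where
  Hom X Y := Quotient (setoid X Y)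
  ofEquiv e := Quotient.mk _ (ofEquiv e)
  comp := Quotient.map₂ comp fun _ _ h _ _ h' => comp_congr h h'
  tensor := Quotient.map₂ tensor fun _ _ h _ _ h' => tensor_congr h h'

/-- The underlying cospan of a circuit. -/
def ofCircuitMap (L : Type u) : FinSetOps.Map (Circuit.ops L) ops where
  map := Quotient.map Circuit.toCospan fun _ _ h => iso_of_circuit_iso h
  map_ofEquiv _ := rfl
  map_comp := by rintro X Y Z _ _ _ ⟨f⟩ ⟨g⟩; rfl
  map_tensor := by rintro X Y X' Y' _ _ _ _ ⟨f⟩ ⟨g⟩; rfl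

theorem lawful : ops.Lawful :=
  (ofCircuitMap Empty).lawful
    (by rintro X Y _ _ ⟨f⟩; exact ⟨Quotient.mk _ (Circuit.ofCospan Empty f), rfl⟩)
    (Circuit.lawful Empty)

/-- Cospans as circuits without edges. -/
def toCircuitMap (L : Type u) : FinSetOps.Map ops (Circuit.ops L) where
  map := Quotient.map (Circuit.ofCospan L) fun _ _ h => circuit_of_iso L h
  map_ofEquiv _ := rfl
  map_comp := by rintro X Y Z _ _ _ ⟨f⟩ ⟨g⟩; exact Quotient.sound (circuit_comp L f g)
  map_tensor := by
    rintro X Y X' Y' _ _ _ _ ⟨f⟩ ⟨g⟩; exact Quotient.sound (circuit_tensor L f g)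

end Cospan

/-- The prop `FinCospan`: morphisms `m → n` are isomorphism classes of cospans of finite sets
from `Fin m` to `Fin n`. -/
def FinCospan : PROP.{1} := Cospan.ops.toPROP Cospan.lawful

/-- The prop `Circ_L`: morphisms `m → n` are isomorphism classes of `L`-circuits from `Fin m` to
`Fin n`. -/
def Circ (L : Type u) : PROP.{max 1 u} := (Circuit.ops L).toPROP (Circuit.lawful L)

/-- The inclusion of `FinCospan` in `Circ_L`, as the circuits without edges. -/
def cospanIncl (L : Type u) : PROP.Morphism FinCospan (Circ L) :=
  (Cospan.toCircuitMap L).toMorphism Cospan.lawful (Circuit.lawful L)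

/-- The inclusion of `F(L)` in `Circ_L`, sending each label to the circuit with one edge that has
this label. -/
def labelIncl (L : Type u) : PROP.Morphism (labelProp L) (Circ L) :=
  freeProp.lift (Circ L) fun _ _ s =>
    match s with
    | .label l => Quotient.mk (Circuit.setoid L (Fin 1) (Fin 1)) (Circuit.edge l)

/-! ## Corelations -/

/-- A corelation from `X` to `Y`: a partition of `X ⊕ Y`. -/
def Corel (X Y : Type) : Type := Setoid (X ⊕ Y)

namespace Corel

/-- The partition whose parts are the nonempty fibres of a function. -/
def ofFun {X Y T : Type} (f : X ⊕ Y → T) : Corel X Y := Setoid.ker f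

/-- The parts of a corelation. -/
def Parts {X Y : Type} (R : Corel X Y) : Type := Quotient (show Setoid (X ⊕ Y) from R)

/-- The part that contains a given element. -/
def part {X Y : Type} (R : Corel X Y) (p : X ⊕ Y) : R.Parts := Quotient.mk _ p

theorem part_eq {X Y : Type} (R : Corel X Y) {p q : X ⊕ Y} :
    R.part p = R.part q ↔ Setoid.r (self := R) p q := Quotient.eq (r := R)

theorem ofFun_part {X Y : Type} (R : Corel X Y) : ofFun R.part = R :=
  Setoid.ker_mk_eq R

/-- The finest partition of `X ⊕ Y ⊕ Z` in which elements are in the same part whenever they are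
in the same part of `R` or of `S`. -/
def glue {X Y Z : Type} (R : Corel X Y) (S : Corel Y Z) : Setoid (X ⊕ Y ⊕ Z) :=
  Relation.EqvGen.setoid fun a b =>
    (∃ p q, R.part p = R.part q ∧ a = Sum.map id Sum.inl p ∧ b = Sum.map id Sum.inl q) ∨
    (∃ p q, S.part p = S.part q ∧ a = Sum.inr p ∧ b = Sum.inr q)

/-- Composition of corelations: glue the two partitions along `Y` and restrict to `X ⊕ Z`. -/
def comp {X Y Z : Type} (R : Corel X Y) (S : Corel Y Z) : Corel X Z :=
  Setoid.comap (Sum.map id Sum.inr) (glue R S)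

/-- Disjoint union of corelations. -/
def tensor {X Y X' Y' : Type} (R : Corel X Y) (S : Corel X' Y') : Corel (X ⊕ X') (Y ⊕ Y') :=
  ofFun fun p => Sum.map R.part S.part (Equiv.sumSumSumComm X X' Y Y' p)

/-- A bijection as a corelation: each `x` is in the same part as its image only. -/
def ofEquiv {X Y : Type} (e : X ≃ Y) : Corel X Y := ofFun (Sum.elim e id)

/-- The operations of the category of corelations between finite sets. -/
def ops : FinSetOps.{0} where
  Hom X Y := Corel X Y
  ofEquiv e := ofEquiv e
  comp R S := comp R S
  tensor R S := tensor R S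

/-- The corelation of a cospan `X → N ← Y`: elements of `X ⊕ Y` are in the same part when they
have the same image in `N`. -/
def ofCospan {X Y : Type} (c : Cospan X Y) : Corel X Y := ofFun (Sum.elim c.inp c.out)

theorem ofFun_congr {X Y T T' : Type} {f : X ⊕ Y → T} {f' : X ⊕ Y → T'}
    (h : ∀ p q, f p = f q ↔ f' p = f' q) : ofFun f = ofFun f' :=
  Setoid.ext fun p q => h p q

theorem part_ofFun {X Y T : Type} (f : X ⊕ Y → T) {p q : X ⊕ Y} :
    (ofFun f).part p = (ofFun f).part q ↔ f p = f q := part_eq _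

theorem ofCospan_congr {X Y : Type} {c d : Cospan X Y} (h : c ≈ d) : ofCospan c = ofCospan d := by
  obtain ⟨e, hi, ho⟩ := h
  have he : ∀ p, Sum.elim d.inp d.out p = e (Sum.elim c.inp c.out p) := by
    rintro (p | p)
    exacts [(hi p).symm, (ho p).symm]
  exact ofFun_congr fun p q => by rw [he, he, e.apply_eq_iff_eq]

theorem ofCospan_comp {X Y Z : Type} (c : Cospan X Y) (d : Cospan Y Z) :
    ofCospan (c.comp d) = comp (ofCospan c) (ofCospan d) := by
  apply Setoid.ext
  intro p q
  change Sum.elim (c.comp d).inp (c.comp d).out p = Sum.elim (c.comp d).inp (c.comp d).out q ↔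
    (glue (ofCospan c) (ofCospan d)) (Sum.map id Sum.inr p) (Sum.map id Sum.inr q)
  let G := glue (ofCospan c) (ofCospan d)
  let cl : X ⊕ Y ⊕ Z → Quotient G := Quotient.mk G
  let F : X ⊕ Y ⊕ Z → Pushout c.out d.inp := Sum.elim (fun x => Pushout.inl _ _ (c.inp x))
    fun r => Pushout.inr _ _ (Sum.elim d.inp d.out r)
  have hF : ∀ p : X ⊕ Z, F (Sum.map id Sum.inr p) = Sum.elim (c.comp d).inp (c.comp d).out p := by
    rintro (p | p) <;> rfl
  have hFl : ∀ p : X ⊕ Y, F (Sum.map id Sum.inl p) =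
      Pushout.inl _ _ (Sum.elim c.inp c.out p) := by
    rintro (p | p)
    · rfl
    · exact (Pushout.glue p).symm
  rw [← hF, ← hF]
  constructor
  · intro h
    let a : c.N → Set (Quotient G) := fun n =>
      {t | ∃ r : X ⊕ Y, Sum.elim c.inp c.out r = n ∧ t = cl (Sum.map id Sum.inl r)}
    let b : d.N → Set (Quotient G) := fun n =>
      {t | ∃ r : Y ⊕ Z, Sum.elim d.inp d.out r = n ∧ t = cl (Sum.inr r)}
    have ha : ∀ r, a (Sum.elim c.inp c.out r) = {cl (Sum.map id Sum.inl r)} := by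
      intro r
      ext t
      constructor
      · rintro ⟨r', hr', rfl⟩
        exact Quotient.sound (Relation.EqvGen.rel _ _
          (Or.inl ⟨r', r, (part_ofFun _).2 hr', rfl, rfl⟩))
      · rintro rfl
        exact ⟨r, rfl, rfl⟩
    have hb : ∀ r, b (Sum.elim d.inp d.out r) = {cl (Sum.inr r)} := by
      intro r
      ext t
      constructor
      · rintro ⟨r', hr', rfl⟩
        exact Quotient.sound (Relation.EqvGen.rel _ _
          (Or.inr ⟨r', r, (part_ofFun _).2 hr', rfl, rfl⟩))
      · rintro rfl
        exact ⟨r, rfl, rfl⟩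
    have hab : ∀ y, a (c.out y) = b (d.inp y) := fun y => (ha (Sum.inr y)).trans (hb (Sum.inl y)).symm
    have key : ∀ r, Pushout.desc a b hab (F r) = {cl r} := by
      rintro (r | r)
      · exact ha (Sum.inl r)
      · exact hb r
    have h' := congrArg (Pushout.desc a b hab) h
    rw [key, key] at h'
    exact Quotient.exact (Set.singleton_injective h')
  · intro h
    have : ∀ r s, G r s → F r = F s := by
      intro r s hrs
      induction (show Relation.EqvGen _ r s from hrs) with
      | rel r s h =>
        obtain ⟨p, q, h, rfl, rfl⟩ | ⟨p, q, h, rfl, rfl⟩ := h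
        · rw [hFl, hFl, (part_ofFun _).1 h]
        · exact congrArg (Pushout.inr _ _) ((part_ofFun _).1 h)
      | refl => rfl
      | symm _ _ h ih => exact (ih h).symm
      | trans _ _ _ h₁ h₂ ih₁ ih₂ => exact (ih₁ h₁).trans (ih₂ h₂)
    exact this _ _ h

theorem ofCospan_tensor {X Y X' Y' : Type} (c : Cospan X Y) (d : Cospan X' Y') :
    ofCospan (c.tensor d) = tensor (ofCospan c) (ofCospan d) := by
  have hc := fun p q => part_ofFun (Sum.elim c.inp c.out) (p := p) (q := q)
  have hd := fun p q => part_ofFun (Sum.elim d.inp d.out) (p := p) (q := q)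
  refine ofFun_congr ?_
  rintro ((p | p) | p | p) ((q | q) | q | q) <;>
    simp [Cospan.tensor, ofCospan, hc, hd]

/-- Corelations from cospans, by discarding the elements of the apex that are not in the image of
the feet. -/
def ofCospanMap : FinSetOps.Map Cospan.ops ops where
  map := Quotient.lift ofCospan fun _ _ h => ofCospan_congr h
  map_ofEquiv _ := rfl
  map_comp := by rintro X Y Z _ _ _ ⟨f⟩ ⟨g⟩; exact ofCospan_comp f g
  map_tensor := by rintro X Y X' Y' _ _ _ _ ⟨f⟩ ⟨g⟩; exact ofCospan_tensor f g

theorem lawful : ops.Lawful := by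
  refine ofCospanMap.lawful ?_ Cospan.lawful
  intro X Y _ _ R
  refine ⟨Quotient.mk _ ⟨Parts R, Quotient.finite _, fun x => part R (Sum.inl x),
    fun y => part R (Sum.inr y)⟩, ?_⟩
  refine Eq.trans (ofFun_congr fun p q => ?_) (ofFun_part R)
  rcases p with p | p <;> rcases q with q | q <;> rfl

end Corel

/-- The prop `FinCorel`: morphisms `m → n` are corelations from `Fin m` to `Fin n`. -/
def FinCorel : PROP.{0} := Corel.ops.toPROP Corel.lawful

/-- The morphism `H : FinCospan → FinCorel` that turns a cospan into a corelation. -/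
def cospanToCorel : PROP.Morphism FinCospan FinCorel :=
  Corel.ofCospanMap.toMorphism Cospan.lawful Corel.lawful

/-- The corelation `m → n` with a single part.  For `(m, n) = (2, 1), (0, 1), (1, 2), (1, 0)` these
are the multiplication, unit, comultiplication and counit of the Frobenius monoid `1`. -/
def corelTop (m n : ℕ) : FinCorel.Hom m n := (⊤ : Setoid (Fin m ⊕ Fin n))

/-! ## Lagrangian relations -/

section Lagrangian

variable {k : Type u} [Field k]

/-- A subspace is isotropic if the form vanishes on it. -/
def IsIsotropic {V : Type v} [AddCommGroup V] [Module k V] (ω : LinearMap.BilinForm k V)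
    (S : Submodule k V) : Prop :=
  ∀ v ∈ S, ∀ w ∈ S, ω v w = 0

/-- A subspace is Lagrangian if it is isotropic and not properly contained in any other isotropic
subspace. -/
def IsLagrangian {V : Type v} [AddCommGroup V] [Module k V] (ω : LinearMap.BilinForm k V)
    (S : Submodule k V) : Prop :=
  IsIsotropic ω S ∧ ∀ T, IsIsotropic ω T → S ≤ T → T = S

/-- The symplectic structure on `(k ⊕ k)^X`: the direct sum of copies of the structure
`ω((φ, I), (φ', I')) = φ I' - φ' I` on `k ⊕ k`. -/
def sympForm (k : Type u) [Field k] (X : Type) [Fintype X] :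
    LinearMap.BilinForm k (X → k × k) :=
  LinearMap.mk₂ k (fun u v => ∑ x, ((u x).1 * (v x).2 - (v x).1 * (u x).2))
    (fun a b c => by simp only [Pi.add_apply, Prod.fst_add, Prod.snd_add]
                     rw [← Finset.sum_add_distrib]; exact Finset.sum_congr rfl fun _ _ => by ring)
    (fun t a b => by simp only [Pi.smul_apply, Prod.smul_fst, Prod.smul_snd, smul_eq_mul]
                     rw [Finset.mul_sum]; exact Finset.sum_congr rfl fun _ _ => by ring)
    (fun a b c => by simp only [Pi.add_apply, Prod.fst_add, Prod.snd_add]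
                     rw [← Finset.sum_add_distrib]; exact Finset.sum_congr rfl fun _ _ => by ring)
    (fun t a b => by simp only [Pi.smul_apply, Prod.smul_fst, Prod.smul_snd, smul_eq_mul]
                     rw [Finset.mul_sum]; exact Finset.sum_congr rfl fun _ _ => by ring)

/-- The form on `V ⊕ W` given by the conjugate `-ω` of the form on `V` and the form `ω'` on `W`. -/
def conjSum {V W : Type u} [AddCommGroup V] [Module k V] [AddCommGroup W] [Module k W]
    (ω : LinearMap.BilinForm k V) (ω' : LinearMap.BilinForm k W) :
    LinearMap.BilinForm k (V × W) :=
  (-ω).compl₁₂ (LinearMap.fst k V W) (LinearMap.fst k V W) +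
    ω'.compl₁₂ (LinearMap.snd k V W) (LinearMap.snd k V W)

theorem conjSum_apply {V W : Type u} [AddCommGroup V] [Module k V] [AddCommGroup W] [Module k W]
    (ω : LinearMap.BilinForm k V) (ω' : LinearMap.BilinForm k W) (p q : V × W) :
    conjSum ω ω' p q = -ω p.1 q.1 + ω' p.2 q.2 := rfl

theorem sympForm_apply {X : Type} [Fintype X] (u v : X → k × k) :
    sympForm k X u v = ∑ x, ((u x).1 * (v x).2 - (v x).1 * (u x).2) := rfl

theorem sympForm_isAlt (X : Type) [Fintype X] : (sympForm k X).IsAlt := fun u => by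
  rw [sympForm_apply]; exact Finset.sum_eq_zero fun _ _ => sub_self _

theorem sympForm_sep {k : Type u} [Field k] {X : Type} [Fintype X] {v : X → k × k} (h : ∀ u, sympForm k X u v = 0) :
    v = 0 := by
  classical
  funext x
  have h₁ := h (Pi.single x (1, 0))
  have h₂ := h (Pi.single x (0, 1))
  rw [sympForm_apply, Finset.sum_eq_single x (fun y _ hy => by simp [Pi.single_eq_of_ne hy])
    (by simp)] at h₁ h₂
  simp at h₁ h₂
  exact Prod.ext h₂ h₁

theorem conjSum_isAlt {V W : Type u} [AddCommGroup V] [Module k V] [AddCommGroup W] [Module k W]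
    {ω : LinearMap.BilinForm k V} {ω' : LinearMap.BilinForm k W} (h : ω.IsAlt) (h' : ω'.IsAlt) :
    (conjSum ω ω').IsAlt := fun p => by
  rw [conjSum_apply, h, h']; simp

theorem conjSum_sep {V W : Type u} [AddCommGroup V] [Module k V] [AddCommGroup W] [Module k W]
    {ω : LinearMap.BilinForm k V} {ω' : LinearMap.BilinForm k W}
    (h : ∀ v, (∀ u, ω u v = 0) → v = 0) (h' : ∀ v, (∀ u, ω' u v = 0) → v = 0)
    (q : V × W) (hq : ∀ p, conjSum ω ω' p q = 0) : q = 0 := by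
  refine Prod.ext (h _ fun u => ?_) (h' _ fun u => ?_)
  · simpa [conjSum_apply] using hq (u, 0)
  · simpa [conjSum_apply] using hq (0, u)

theorem isLagrangian_iff {V : Type v} [AddCommGroup V] [Module k V] {ω : LinearMap.BilinForm k V}
    (hω : ω.IsAlt) {S : Submodule k V} : IsLagrangian ω S ↔ ∀ v, (∀ w ∈ S, ω w v = 0) ↔ v ∈ S := by
  constructor
  · rintro ⟨h₁, h₂⟩ v
    refine ⟨fun hv => ?_, fun hv w hw => h₁ w hw v hv⟩
    rw [← h₂ (S ⊔ Submodule.span k {v}) ?_ le_sup_left]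
    · exact Submodule.mem_sup_right (Submodule.mem_span_singleton_self v)
    · intro a ha b hb
      obtain ⟨a', ha', x, hx, rfl⟩ := Submodule.mem_sup.1 ha
      obtain ⟨b', hb', y, hy, rfl⟩ := Submodule.mem_sup.1 hb
      obtain ⟨s, rfl⟩ := Submodule.mem_span_singleton.1 hx
      obtain ⟨t, rfl⟩ := Submodule.mem_span_singleton.1 hy
      have h₃ : ω v b' = 0 := by rw [← hω.neg_eq, hv b' hb', neg_zero]
      simp [h₁ a' ha' b' hb', hv a' ha', h₃, hω v]
  · intro h
    refine ⟨fun v hv w hw => (h w).2 hw v hv, fun T hT hST => le_antisymm (fun v hv => ?_) hST⟩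
    exact (h v).1 fun w hw => hT w (hST hw) v hv

variable (k) in
/-- A Lagrangian relation from `(k ⊕ k)^X` to `(k ⊕ k)^Y`: a Lagrangian subspace of the direct sum
of the conjugate of `(k ⊕ k)^X` and `(k ⊕ k)^Y`. -/
def LagHom (X Y : Type) [Fintype X] [Fintype Y] : Type u :=
  {S : Submodule k ((X → k × k) × (Y → k × k)) //
    IsLagrangian (conjSum (sympForm k X) (sympForm k Y)) S}

namespace LagHom

theorem isAlt (X Y : Type) [Fintype X] [Fintype Y] :
    (conjSum (sympForm k X) (sympForm k Y)).IsAlt :=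
  conjSum_isAlt (sympForm_isAlt X) (sympForm_isAlt Y)

theorem sep (X Y : Type) [Fintype X] [Fintype Y] (q : (X → k × k) × (Y → k × k))
    (hq : ∀ p, conjSum (sympForm k X) (sympForm k Y) p q = 0) : q = 0 :=
  conjSum_sep (fun _ => sympForm_sep) (fun _ => sympForm_sep) q hq

/-- The composite of linear relations. -/
def relComp {U V W : Type u} [AddCommGroup U] [Module k U] [AddCommGroup V] [Module k V]
    [AddCommGroup W] [Module k W] (S : Submodule k (U × V)) (T : Submodule k (V × W)) :
    Submodule k (U × W) where
  carrier := {p | ∃ v, (p.1, v) ∈ S ∧ (v, p.2) ∈ T}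
  zero_mem' := ⟨0, S.zero_mem, T.zero_mem⟩
  add_mem' := by
    rintro p q ⟨v, h₁, h₂⟩ ⟨w, h₃, h₄⟩
    exact ⟨v + w, S.add_mem h₁ h₃, T.add_mem h₂ h₄⟩
  smul_mem' := by
    rintro c p ⟨v, h₁, h₂⟩
    exact ⟨c • v, S.smul_mem c h₁, T.smul_mem c h₂⟩

/-- The relation given by a bijection. -/
def relEquiv (k : Type u) [Field k] {X Y : Type} (e : X ≃ Y) :
    Submodule k ((X → k × k) × (Y → k × k)) where
  carrier := {p | p.1 = p.2 ∘ e}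
  zero_mem' := rfl
  add_mem' := by
    rintro p q (h : p.1 = _) (h' : q.1 = _)
    change p.1 + q.1 = _
    rw [h, h']; rfl
  smul_mem' := by
    rintro c p (h : p.1 = _)
    change c • p.1 = _
    rw [h]; rfl

/-- The direct sum of linear relations. -/
def relSum {X Y X' Y' : Type} (S : Submodule k ((X → k × k) × (Y → k × k)))
    (T : Submodule k ((X' → k × k) × (Y' → k × k))) :
    Submodule k ((X ⊕ X' → k × k) × (Y ⊕ Y' → k × k)) where
  carrier := {p | (p.1 ∘ Sum.inl, p.2 ∘ Sum.inl) ∈ S ∧ (p.1 ∘ Sum.inr, p.2 ∘ Sum.inr) ∈ T}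
  zero_mem' := ⟨S.zero_mem, T.zero_mem⟩
  add_mem' := by
    rintro p q ⟨h₁, h₂⟩ ⟨h₃, h₄⟩
    exact ⟨S.add_mem h₁ h₃, T.add_mem h₂ h₄⟩
  smul_mem' := by
    rintro c p ⟨h₁, h₂⟩
    exact ⟨S.smul_mem c h₁, T.smul_mem c h₂⟩

theorem relComp_isLagrangian {X Y Z : Type} [Fintype X] [Fintype Y] [Fintype Z]
    {S : Submodule k ((X → k × k) × (Y → k × k))} {T : Submodule k ((Y → k × k) × (Z → k × k))}
    (hS : IsLagrangian (conjSum (sympForm k X) (sympForm k Y)) S)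
    (hT : IsLagrangian (conjSum (sympForm k Y) (sympForm k Z)) T) :
    IsLagrangian (conjSum (sympForm k X) (sympForm k Z)) (relComp S T) := by
  rw [isLagrangian_iff (isAlt _ _)] at hS hT ⊢
  rintro ⟨u, w⟩
  constructor
  · intro h
    let B : LinearMap.BilinForm k
        (((X → k × k) × (Y → k × k)) × ((Y → k × k) × (Z → k × k))) :=
      conjSum (-(conjSum (sympForm k X) (sympForm k Y))) (conjSum (sympForm k Y) (sympForm k Z))
    have hB : ∀ p q, B p q = conjSum (sympForm k X) (sympForm k Y) p.1 q.1 +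
        conjSum (sympForm k Y) (sympForm k Z) p.2 q.2 := by
      intro p q; simp [B, conjSum_apply]
    have hAlt : B.IsAlt := fun p => by rw [hB, isAlt, isAlt, add_zero]
    have hnd : B.Nondegenerate := by
      refine (LinearMap.IsRefl.nondegenerate_iff_separatingRight hAlt.isRefl).2 ?_
      intro q hq
      refine Prod.ext (sep _ _ _ fun p => ?_) (sep _ _ _ fun p => ?_)
      · simpa [hB] using hq (p, 0)
      · simpa [hB] using hq (0, p)
    let D : Submodule k (((X → k × k) × (Y → k × k)) × ((Y → k × k) × (Z → k × k))) :=
      LinearMap.range (LinearMap.prod (LinearMap.inr k (X → k × k) (Y → k × k))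
        (LinearMap.inl k (Y → k × k) (Z → k × k)))
    have hD : B.orthogonal (S.prod T ⊔ D) ≤ S.prod T := by
      intro p hp
      rw [LinearMap.BilinForm.mem_orthogonal_iff] at hp
      refine ⟨(hS p.1).1 fun r hr => ?_, (hT p.2).1 fun r hr => ?_⟩
      · simpa [hB] using hp (r, 0) (Submodule.mem_sup_left ⟨hr, T.zero_mem⟩)
      · simpa [hB] using hp (0, r) (Submodule.mem_sup_left ⟨S.zero_mem, hr⟩)
    have hD' : ∀ p ∈ B.orthogonal (S.prod T ⊔ D), p.1.2 = p.2.1 := by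
      intro p hp
      rw [LinearMap.BilinForm.mem_orthogonal_iff] at hp
      refine sub_eq_zero.1 (sympForm_sep fun v => ?_)
      have := hp ((0, v), (v, 0)) (Submodule.mem_sup_right ⟨v, rfl⟩)
      rw [hB, conjSum_apply, conjSum_apply] at this
      simp only [map_zero, LinearMap.zero_apply, neg_zero, zero_add, add_zero] at this
      rw [map_sub, sub_eq_add_neg]
      exact this
    have hmem : ((u, (0 : Y → k × k)), ((0 : Y → k × k), w)) ∈ S.prod T ⊔ D := by
      rw [← LinearMap.BilinForm.orthogonal_orthogonal hnd hAlt.isRefl (S.prod T ⊔ D),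
        LinearMap.BilinForm.mem_orthogonal_iff]
      intro p hp
      have h₁ := hD hp
      have h₂ := hD' p hp
      have := h (p.1.1, p.2.2) ⟨p.1.2, h₁.1, by rw [h₂]; exact h₁.2⟩
      rw [hB, conjSum_apply, conjSum_apply]
      rw [conjSum_apply] at this
      simpa using this
    obtain ⟨p, hp, q, ⟨v, rfl⟩, hpq⟩ := Submodule.mem_sup.1 hmem
    obtain ⟨⟨a, b⟩, ⟨c, d⟩⟩ := p
    have ha : a + 0 = u := congrArg (fun r => r.1.1) hpq
    have hb : b + v = 0 := congrArg (fun r => r.1.2) hpq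
    have hc : c + v = 0 := congrArg (fun r => r.2.1) hpq
    have hd : d + 0 = w := congrArg (fun r => r.2.2) hpq
    rw [add_zero] at ha hd
    subst ha hd
    have hbc : b = c := add_right_cancel (hb.trans hc.symm)
    subst hbc
    exact ⟨b, hp.1, hp.2⟩
  · rintro ⟨v, h₁, h₂⟩ ⟨u', w'⟩ ⟨v', h₁', h₂'⟩
    have e₁ := (hS _).2 h₁ _ h₁'
    have e₂ := (hT _).2 h₂ _ h₂'
    simp only [conjSum_apply] at e₁ e₂ ⊢
    linear_combination e₁ + e₂

theorem relEquiv_isLagrangian {X Y : Type} [Fintype X] [Fintype Y] (e : X ≃ Y) :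
    IsLagrangian (conjSum (sympForm k X) (sympForm k Y)) (relEquiv k e) := by
  have he : ∀ (v : Y → k × k) (u : X → k × k),
      sympForm k X (v ∘ e) u = sympForm k Y v (u ∘ e.symm) := by
    intro v u
    rw [sympForm_apply, sympForm_apply, ← e.sum_comp]
    simp
  rw [isLagrangian_iff (isAlt _ _)]
  rintro ⟨u, w⟩
  constructor
  · intro h
    have : w - u ∘ e.symm = 0 := sympForm_sep fun v => by
      have := h (v ∘ e, v) rfl
      rw [conjSum_apply, he] at this
      rw [map_sub, sub_eq_add_neg, add_comm]
      exact this
    rw [sub_eq_zero] at this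
    change u = w ∘ e
    rw [this]
    funext x
    simp
  · rintro (h : u = w ∘ e) ⟨u', w'⟩ (h' : u' = w' ∘ e)
    subst h h'
    rw [conjSum_apply, he]
    have : (w ∘ e) ∘ e.symm = w := by funext x; simp
    rw [this, neg_add_cancel]

theorem relSum_isLagrangian {X Y X' Y' : Type} [Fintype X] [Fintype Y] [Fintype X'] [Fintype Y']
    {S : Submodule k ((X → k × k) × (Y → k × k))} {T : Submodule k ((X' → k × k) × (Y' → k × k))}
    (hS : IsLagrangian (conjSum (sympForm k X) (sympForm k Y)) S)
    (hT : IsLagrangian (conjSum (sympForm k X') (sympForm k Y')) T) :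
    IsLagrangian (conjSum (sympForm k (X ⊕ X')) (sympForm k (Y ⊕ Y'))) (relSum S T) := by
  have hsum : ∀ p q : (X ⊕ X' → k × k) × (Y ⊕ Y' → k × k),
      conjSum (sympForm k (X ⊕ X')) (sympForm k (Y ⊕ Y')) p q =
      conjSum (sympForm k X) (sympForm k Y) (p.1 ∘ Sum.inl, p.2 ∘ Sum.inl)
        (q.1 ∘ Sum.inl, q.2 ∘ Sum.inl) +
      conjSum (sympForm k X') (sympForm k Y') (p.1 ∘ Sum.inr, p.2 ∘ Sum.inr)
        (q.1 ∘ Sum.inr, q.2 ∘ Sum.inr) := by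
    intro p q
    simp only [conjSum_apply, sympForm_apply, Fintype.sum_sum_type, Function.comp_apply]
    ring
  rw [isLagrangian_iff (isAlt _ _)] at hS hT ⊢
  intro p
  constructor
  · intro h
    refine ⟨(hS _).1 fun r hr => ?_, (hT _).1 fun r hr => ?_⟩
    · have := h (Sum.elim r.1 0, Sum.elim r.2 0) ⟨hr, T.zero_mem⟩
      rw [hsum] at this
      simpa [conjSum_apply] using this
    · have := h (Sum.elim 0 r.1, Sum.elim 0 r.2) ⟨S.zero_mem, hr⟩
      rw [hsum] at this
      simpa [conjSum_apply] using this
  · rintro ⟨h₁, h₂⟩ q ⟨h₃, h₄⟩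
    rw [hsum, (hS _).2 h₁ _ h₃, (hT _).2 h₂ _ h₄, add_zero]

variable (k) in
/-- The operations of the category of Lagrangian relations between the spaces `(k ⊕ k)^X`. -/
def ops : FinSetOps.{u} where
  Hom X Y := LagHom k X Y
  ofEquiv e := ⟨relEquiv k e, relEquiv_isLagrangian e⟩
  comp S T := ⟨relComp S.1 T.1, relComp_isLagrangian S.2 T.2⟩
  tensor S T := ⟨relSum S.1 T.1, relSum_isLagrangian S.2 T.2⟩

theorem ext' {X Y : Type} [Fintype X] [Fintype Y] {S T : LagHom k X Y}
    (h : ∀ u v, (u, v) ∈ S.1 ↔ (u, v) ∈ T.1) : S = T :=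
  Subtype.ext (Submodule.ext fun p => h p.1 p.2)

theorem mem_ofEquiv_comp {X Y Z : Type} [Fintype X] [Fintype Y] [Fintype Z] (e : X ≃ Y)
    (S : LagHom k Y Z) (u : X → k × k) (w : Z → k × k) :
    (u, w) ∈ ((ops k).comp ((ops k).ofEquiv e) S : LagHom k X Z).1 ↔
      (u ∘ e.symm, w) ∈ S.1 := by
  constructor
  · rintro ⟨v, h, h'⟩
    obtain rfl : u = v ∘ e := h
    have : (v ∘ e) ∘ e.symm = v := by funext x; simp
    rw [this]; exact h'
  · intro h
    refine ⟨_, ?_, h⟩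
    change u = (u ∘ e.symm) ∘ e
    funext x; simp

theorem mem_comp_ofEquiv {X Y Z : Type} [Fintype X] [Fintype Y] [Fintype Z]
    (S : LagHom k X Y) (e : Y ≃ Z) (u : X → k × k) (w : Z → k × k) :
    (u, w) ∈ ((ops k).comp S ((ops k).ofEquiv e) : LagHom k X Z).1 ↔ (u, w ∘ e) ∈ S.1 := by
  constructor
  · rintro ⟨v, h, h'⟩
    obtain rfl : v = w ∘ e := h'
    exact h
  · intro h
    exact ⟨_, h, rfl⟩

variable (k) in
theorem lawful : (ops k).Lawful where
  id_comp f := ext' fun u v => mem_ofEquiv_comp _ _ _ _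
  comp_id f := ext' fun u v => mem_comp_ofEquiv _ _ _ _
  assoc f g h := by
    refine ext' fun u v => ⟨?_, ?_⟩
    · rintro ⟨b, ⟨a, h₁, h₂⟩, h₃⟩
      exact ⟨a, h₁, b, h₂, h₃⟩
    · rintro ⟨a, h₁, b, h₂, h₃⟩
      exact ⟨b, ⟨a, h₁, h₂⟩, h₃⟩
  ofEquiv_trans e e' := ext' fun u v => mem_comp_ofEquiv _ _ _ _
  tensor_ofEquiv e e' := by
    refine ext' fun u v => ⟨?_, ?_⟩
    · rintro ⟨h₁, h₂⟩
      change u = _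
      funext x
      rcases x with x | x
      exacts [congrFun h₁ x, congrFun h₂ x]
    · intro h
      obtain rfl : u = v ∘ Equiv.sumCongr e e' := h
      exact ⟨rfl, rfl⟩
  tensor_comp f g f' g' := by
    refine ext' fun u v => ⟨?_, ?_⟩
    · rintro ⟨⟨a, h₁, h₂⟩, b, h₃, h₄⟩
      exact ⟨Sum.elim a b, ⟨h₁, h₃⟩, h₂, h₄⟩
    · rintro ⟨a, ⟨h₁, h₃⟩, h₂, h₄⟩
      exact ⟨⟨_, h₁, h₂⟩, _, h₃, h₄⟩
  assoc_natural f g h := by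
    refine ext' fun u v => (mem_comp_ofEquiv _ _ _ _).trans
      (Iff.trans ?_ (mem_ofEquiv_comp _ _ _ _).symm)
    exact and_assoc
  unit_natural f := by
    refine ext' fun u v => (mem_comp_ofEquiv _ _ _ _).trans
      (Iff.trans ?_ (mem_ofEquiv_comp _ _ _ _).symm)
    exact and_iff_right (funext fun x => x.elim0)
  braid_natural f g := by
    refine ext' fun u v => (mem_comp_ofEquiv _ _ _ _).trans
      (Iff.trans ?_ (mem_ofEquiv_comp _ _ _ _).symm)
    exact and_comm

end LagHom

variable (k) in
/-- The prop `LagRel_k`: morphisms `m → n` are linear Lagrangian relations from `(k ⊕ k)^m` to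
`(k ⊕ k)^n`. -/
def LagRel : PROP.{u} := (LagHom.ops k).toPROP (LagHom.lawful k)

end Lagrangian

/-- The Lagrangian subspace underlying a morphism of `LagRel_k`. -/
def LagRel.rel {k : Type u} [Field k] {m n : ℕ} (f : (LagRel k).Hom m n) :
    Submodule k ((Fin m → k × k) × (Fin n → k × k)) :=
  Subtype.val (show LagHom k (Fin m) (Fin n) from f)

/-- `K : FinCorel → LagRel_k` sends the Frobenius monoid `1` of `FinCorel` to `k ⊕ k`, where the
first copy of `k` (the potentials) has the duplicative Frobenius structure and the second copy
(the currents) has the additive one.  The four conditions are about the multiplication, the unit,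
the comultiplication and the counit. -/
def SendsFrobenius {k : Type u} [Field k] (K : PROP.Morphism FinCorel (LagRel k)) : Prop :=
  (∀ (u : Fin 2 → k × k) (v : Fin 1 → k × k), (u, v) ∈ LagRel.rel (K.map (corelTop 2 1)) ↔
    (u 0).1 = (v 0).1 ∧ (u 1).1 = (v 0).1 ∧ (u 0).2 + (u 1).2 = (v 0).2) ∧
  (∀ (u : Fin 0 → k × k) (v : Fin 1 → k × k), (u, v) ∈ LagRel.rel (K.map (corelTop 0 1)) ↔
    (v 0).2 = 0) ∧
  (∀ (u : Fin 1 → k × k) (v : Fin 2 → k × k), (u, v) ∈ LagRel.rel (K.map (corelTop 1 2)) ↔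
    (u 0).1 = (v 0).1 ∧ (u 0).1 = (v 1).1 ∧ (u 0).2 = (v 0).2 + (v 1).2) ∧
  (∀ (u : Fin 1 → k × k) (v : Fin 0 → k × k), (u, v) ∈ LagRel.rel (K.map (corelTop 1 0)) ↔
    (u 0).2 = 0)

/-! Everything in `FinCospan` comes from functions used forwards (`fwd`) and backwards (`bwd`): a
cospan is its input leg forwards followed by its output leg backwards, and a pushout square
exchanges the two directions (`bwd_comp_fwd`). Functions between finite sets are generated under
composition and disjoint union by `2 → 1`, `0 → 1`, identities and swaps. Hence a morphism out of
`FinCospan` is determined by the Frobenius monoid `1`, and since `H` is full, so is a morphism out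
of `FinCorel`. This is the uniqueness of `K`.

For the existence of `K`, a corelation is sent to Kirchhoff's laws: the potential is constant on
each part, and the currents balance when tested against every function that is constant on the
parts. These two conditions are each other's annihilators, so the subspace equals its own
orthogonal. Because Lagrangian subspaces are maximal, functoriality only needs one inclusion for
each operation. For composition the inclusion holds because a function constant on the parts of the
composite extends over the middle set (`Compat.exists_extension`).

For the coproduct, take a morphism out of `FinCospan` into `T` and a value `1 → 1` in `T` for each
label. `addEdge` splits a wire off the node `s`, applies the value, and merges the result into the
node `t`. Such endomorphisms slide along functions in both directions, by the pushout square of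
`copair_sumMap_isPushout`; they commute (`addEdge_comm`); and an edge between two otherwise isolated
nodes gives back the chosen value (`addEdge_two`). So an unordered finite family of edges has a
product, and a circuit can be evaluated as inputs forwards, product of edges, outputs backwards.
Sliding shows that this respects isomorphism and composition.

Uniqueness holds because in `Circ L` the same formula, applied to the one-edge circuits, returns the
circuit itself (`evalWith_edge`); any morphism of props must therefore be the evaluation (`map_mk`).
The black box is the evaluation for `K ∘ H` and the relations assigned to the labels, as a morphism
out of `F(L)` is determined by its values on the labels. -/

/-! ## Functions between standard finite sets -/

/-- The copairing of two functions, on a disjoint union of standard finite sets. -/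
def finCopair {T : Type} {m n : ℕ} (a : Fin m → T) (b : Fin n → T) : Fin (m + n) → T :=
  Sum.elim a b ∘ finSumFinEquiv.symm

/-- The disjoint union of two functions between standard finite sets. -/
def finSumMap {m n m' n' : ℕ} (a : Fin m → Fin n) (b : Fin m' → Fin n') :
    Fin (m + m') → Fin (n + n') :=
  finSumFinEquiv ∘ Sum.map a b ∘ finSumFinEquiv.symm

/-- The first coprojection. -/
def finInl {m n : ℕ} (x : Fin m) : Fin (m + n) := finSumFinEquiv (Sum.inl x)

/-- The second coprojection. -/
def finInr {m n : ℕ} (x : Fin n) : Fin (m + n) := finSumFinEquiv (Sum.inr x)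

/-- The exchange of the two summands. -/
def finSwap (m n : ℕ) : Fin (m + n) ≃ Fin (n + m) :=
  (finSumFinEquiv.symm.trans (Equiv.sumComm _ _)).trans finSumFinEquiv

section FinFunctions

variable {T : Type} {m n m' n' : ℕ}

@[simp] theorem finCopair_inl (a : Fin m → T) (b : Fin n → T) (x : Fin m) :
    finCopair a b (finInl x) = a x := by
  simp [finCopair, finInl, -finSumFinEquiv_apply_left]

@[simp] theorem finCopair_inr (a : Fin m → T) (b : Fin n → T) (x : Fin n) :
    finCopair a b (finInr x) = b x := by
  simp [finCopair, finInr, -finSumFinEquiv_apply_right]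

@[simp] theorem finSumMap_inl (a : Fin m → Fin n) (b : Fin m' → Fin n') (x : Fin m) :
    finSumMap a b (finInl x) = finInl (a x) := by
  simp [finSumMap, finInl, -finSumFinEquiv_apply_left]

@[simp] theorem finSumMap_inr (a : Fin m → Fin n) (b : Fin m' → Fin n') (x : Fin m') :
    finSumMap a b (finInr x) = finInr (b x) := by
  simp [finSumMap, finInr, -finSumFinEquiv_apply_right]

@[simp] theorem finSwap_inl (x : Fin m) : finSwap m n (finInl x) = finInr x := by
  simp [finSwap, finInl, finInr, -finSumFinEquiv_apply_left, -finSumFinEquiv_apply_right]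

@[simp] theorem finSwap_inr (x : Fin n) : finSwap m n (finInr x) = finInl x := by
  simp [finSwap, finInl, finInr, -finSumFinEquiv_apply_left, -finSumFinEquiv_apply_right]

theorem fin_add_ind {P : Fin (m + n) → Prop} (hl : ∀ x, P (finInl x)) (hr : ∀ x, P (finInr x))
    (x : Fin (m + n)) : P x := by
  obtain ⟨x | x, rfl⟩ := finSumFinEquiv.surjective x
  exacts [hl x, hr x]

theorem fin_add_ext {f g : Fin (m + n) → T} (hl : ∀ x, f (finInl x) = g (finInl x))
    (hr : ∀ x, f (finInr x) = g (finInr x)) : f = g :=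
  funext (fin_add_ind hl hr)

theorem finCopair_comp {T' : Type} (φ : T → T') (a : Fin m → T) (b : Fin n → T) :
    φ ∘ finCopair a b = finCopair (φ ∘ a) (φ ∘ b) :=
  fin_add_ext (fun x => by simp) fun x => by simp

theorem finCopair_comp_sumMap (a : Fin n → T) (b : Fin n' → T) (c : Fin m → Fin n)
    (d : Fin m' → Fin n') : finCopair a b ∘ finSumMap c d = finCopair (a ∘ c) (b ∘ d) :=
  fin_add_ext (fun x => by simp) fun x => by simp

end FinFunctions

/-! ## Cospans of functions -/

namespace Cospan

/-- A recognition principle for composites of cospans. -/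
theorem comp_iso {X Y Z : Type} {c : Cospan X Y} {d : Cospan Y Z} {k : Cospan X Z}
    (a : c.N → k.N) (b : d.N → k.N) (h : ∀ y, a (c.out y) = b (d.inp y))
    (hbij : Function.Bijective (Pushout.desc a b h)) (hi : ∀ x, a (c.inp x) = k.inp x)
    (ho : ∀ z, b (d.out z) = k.out z) : c.comp d ≈ k :=
  ⟨Equiv.ofBijective _ hbij, hi, ho⟩

theorem ofEquiv_comp {X Y Z : Type} [Fintype Y] (e : X ≃ Y) (c : Cospan Y Z) :
    (ofEquiv e).comp c ≈ ⟨c.N, c.finite_N, c.inp ∘ e, c.out⟩ :=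
  iso_of_circuit_iso (Circuit.ofEquiv_comp e (Circuit.ofCospan Empty c))

end Cospan

/-- The coprojections jointly cover the pushout, so a candidate inverse `r` need only be tested on
them and on `T`. Most of the concrete pushout squares below are recognised in this way. -/
theorem Pushout.desc_bijective {Y A B T : Type} {f : Y → A} {g : Y → B} {a : A → T} {b : B → T}
    {h : ∀ y, a (f y) = b (g y)} (r : T → Pushout f g)
    (hl : ∀ x, r (a x) = Pushout.inl f g x) (hr : ∀ x, r (b x) = Pushout.inr f g x)
    (hs : ∀ t, Pushout.desc a b h (r t) = t) : Function.Bijective (Pushout.desc a b h) :=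
  Function.bijective_iff_has_inverse.2 ⟨r, Pushout.ind hl hr, hs⟩

namespace FinCospan

/-- The class of a cospan. -/
def mk {m n : ℕ} (c : Cospan (Fin m) (Fin n)) : FinCospan.Hom m n :=
  Quotient.mk (Cospan.setoid (Fin m) (Fin n)) c

/-- A function as a cospan. -/
def fwd {m n : ℕ} (φ : Fin m → Fin n) : FinCospan.Hom m n := mk ⟨Fin n, inferInstance, φ, id⟩

/-- A function as a cospan, backwards. -/
def bwd {m n : ℕ} (φ : Fin m → Fin n) : FinCospan.Hom n m := mk ⟨Fin n, inferInstance, id, φ⟩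

theorem fwd_id (n : ℕ) : fwd (id : Fin n → Fin n) = FinCospan.id n := rfl

theorem bwd_id (n : ℕ) : bwd (id : Fin n → Fin n) = FinCospan.id n := rfl

theorem fwd_finSwap (m n : ℕ) : fwd (finSwap m n) = FinCospan.braid m n := rfl

theorem fwd_comp {m n p : ℕ} (φ : Fin m → Fin n) (ψ : Fin n → Fin p) :
    FinCospan.comp (fwd φ) (fwd ψ) = fwd (ψ ∘ φ) := by
  refine Quotient.sound (Cospan.comp_iso (k := ⟨Fin p, inferInstance, ψ ∘ φ, id⟩) ψ id
    (fun _ => rfl) (Pushout.desc_bijective (Pushout.inr _ _) (fun x => ?_) (fun _ => rfl)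
      fun _ => rfl) (fun _ => rfl) fun _ => rfl)
  exact (Pushout.glue (f := (id : Fin n → Fin n)) (g := ψ) x).symm

theorem bwd_comp {m n p : ℕ} (φ : Fin m → Fin n) (ψ : Fin n → Fin p) :
    FinCospan.comp (bwd ψ) (bwd φ) = bwd (ψ ∘ φ) := by
  refine Quotient.sound (Cospan.comp_iso (k := ⟨Fin p, inferInstance, id, ψ ∘ φ⟩) id ψ
    (fun _ => rfl) (Pushout.desc_bijective (Pushout.inl _ _) (fun _ => rfl) (fun x => ?_)
      fun _ => rfl) (fun _ => rfl) fun _ => rfl)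
  exact Pushout.glue (f := ψ) (g := (id : Fin n → Fin n)) x

theorem fwd_comp_bwd {m n q : ℕ} (φ : Fin m → Fin q) (ψ : Fin n → Fin q) :
    FinCospan.comp (fwd φ) (bwd ψ) = mk ⟨Fin q, inferInstance, φ, ψ⟩ :=
  Quotient.sound (Cospan.comp_iso (k := ⟨Fin q, inferInstance, φ, ψ⟩) id id
    (fun _ => rfl) (Pushout.desc_bijective (Pushout.inr _ _)
      (fun x => (Pushout.glue (f := (id : Fin q → Fin q)) (g := (id : Fin q → Fin q)) x).symm)
      (fun _ => rfl) fun _ => rfl) (fun _ => rfl) fun _ => rfl)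

/-- Cospans compose by pushout, so any pushout square trades "backwards, then forwards" for
"forwards, then backwards". The Frobenius and sliding laws below are all instances. -/
theorem bwd_comp_fwd {m q q' r : ℕ} {φ : Fin m → Fin q} {ψ : Fin m → Fin q'} {a : Fin q → Fin r}
    {b : Fin q' → Fin r} (h : ∀ y, a (φ y) = b (ψ y))
    (hbij : Function.Bijective (Pushout.desc a b h)) :
    FinCospan.comp (bwd φ) (fwd ψ) = FinCospan.comp (fwd a) (bwd b) := by
  rw [fwd_comp_bwd]
  exact Quotient.sound (Cospan.comp_iso (k := ⟨Fin r, inferInstance, a, b⟩) a b h hbij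
    (fun _ => rfl) fun _ => rfl)

/-- The inverse bijection, acting on the apex, is itself an isomorphism between the two cospans. -/
theorem bwd_eq_fwd_symm {m n : ℕ} (e : Fin m ≃ Fin n) : bwd e = fwd e.symm :=
  Quotient.sound ⟨e.symm, fun _ => rfl, e.symm_apply_apply⟩

theorem fwd_comp_bwd_equiv {m n : ℕ} (e : Fin m ≃ Fin n) :
    FinCospan.comp (fwd e) (bwd e) = FinCospan.id m := by
  rw [bwd_eq_fwd_symm, fwd_comp, e.symm_comp_self, fwd_id]

theorem tensor_mk {m n m' n' : ℕ} (c : Cospan (Fin m) (Fin n)) (d : Cospan (Fin m') (Fin n')) :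
    FinCospan.tensor (mk c) (mk d) =
      mk ⟨c.N ⊕ d.N, inferInstance, Sum.map c.inp d.inp ∘ finSumFinEquiv.symm,
        Sum.map c.out d.out ∘ finSumFinEquiv.symm⟩ :=
  Quotient.sound (Setoid.trans (Cospan.ofEquiv_comp _ _)
    (Cospan.iso_of_circuit_iso (Circuit.comp_ofEquiv (Circuit.ofCospan Empty
      ⟨c.N ⊕ d.N, inferInstance, Sum.map c.inp d.inp ∘ finSumFinEquiv.symm,
        Sum.map c.out d.out⟩) finSumFinEquiv)))

theorem fwd_tensor {m n m' n' : ℕ} (φ : Fin m → Fin n) (ψ : Fin m' → Fin n') :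
    FinCospan.tensor (fwd φ) (fwd ψ) = fwd (finSumMap φ ψ) := by
  refine (tensor_mk _ _).trans (Quotient.sound ⟨finSumFinEquiv, fun x => rfl, fun x => ?_⟩)
  change finSumFinEquiv (Sum.map id id (finSumFinEquiv.symm x)) = x
  simp

theorem bwd_tensor {m n m' n' : ℕ} (φ : Fin m → Fin n) (ψ : Fin m' → Fin n') :
    FinCospan.tensor (bwd φ) (bwd ψ) = bwd (finSumMap φ ψ) := by
  refine (tensor_mk _ _).trans (Quotient.sound ⟨finSumFinEquiv, fun x => ?_, fun x => rfl⟩)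
  change finSumFinEquiv (Sum.map id id (finSumFinEquiv.symm x)) = x
  simp

theorem exists_eq_fwd_comp_bwd {m n : ℕ} (x : FinCospan.Hom m n) :
    ∃ (q : ℕ) (φ : Fin m → Fin q) (ψ : Fin n → Fin q),
      x = FinCospan.comp (fwd φ) (bwd ψ) := by
  obtain ⟨c⟩ := x
  obtain ⟨q, ⟨e⟩⟩ := Finite.exists_equiv_fin c.N
  exact ⟨q, e ∘ c.inp, e ∘ c.out, (Quotient.sound ⟨e, fun _ => rfl, fun _ => rfl⟩ :
    mk c = mk _).trans (fwd_comp_bwd _ _).symm⟩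

end FinCospan

/-! ## Generators of `FinCospan` and `FinCorel` -/

namespace FinCospan

section Generators

variable {T : PROP.{w}} (f f' : PROP.Morphism FinCospan T)

/-- Two morphisms of props agree on a function, as a cospan in both directions. -/
def AgreeOn {m n : ℕ} (φ : Fin m → Fin n) : Prop :=
  f.map (fwd φ) = f'.map (fwd φ) ∧ f.map (bwd φ) = f'.map (bwd φ)

variable {f f'}

theorem agreeOn_id (n : ℕ) : AgreeOn f f' (id : Fin n → Fin n) := by
  rw [AgreeOn, fwd_id, bwd_id, f.map_id, f'.map_id]
  exact ⟨rfl, rfl⟩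

theorem AgreeOn.comp {m n p : ℕ} {ψ : Fin n → Fin p} {φ : Fin m → Fin n} (h' : AgreeOn f f' ψ)
    (h : AgreeOn f f' φ) : AgreeOn f f' (ψ ∘ φ) := by
  constructor
  · rw [← fwd_comp, f.map_comp, f'.map_comp, h.1, h'.1]
  · rw [← bwd_comp, f.map_comp, f'.map_comp, h.2, h'.2]

theorem AgreeOn.sumMap {m n m' n' : ℕ} {φ : Fin m → Fin n} {ψ : Fin m' → Fin n'}
    (h : AgreeOn f f' φ) (h' : AgreeOn f f' ψ) : AgreeOn f f' (finSumMap φ ψ) := by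
  constructor
  · rw [← fwd_tensor, f.map_tensor, f'.map_tensor, h.1, h'.1]
  · rw [← bwd_tensor, f.map_tensor, f'.map_tensor, h.2, h'.2]

theorem agreeOn_swap (m n : ℕ) : AgreeOn f f' (finSwap m n) := by
  have : bwd (finSwap m n) = FinCospan.braid n m := by
    rw [bwd_eq_fwd_symm]; rfl
  rw [AgreeOn, this, fwd_finSwap]
  simp only [f.map_braid, f'.map_braid, and_self]

/-- `n + (1 + 1)` and `(n + 1) + 1` are definitionally equal, so the two functions can be read
through different bracketings and no transport is needed. -/
theorem fin_add_two_ext {S : Type} {n : ℕ} {φ ψ : Fin (n + (1 + 1)) → S}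
    (h : ∀ x : Fin n, φ (finInl x) = ψ (finInl (m := n + 1) (n := 1) (finInl x)))
    (h₁ : φ (finInr (finInl 0)) = ψ (finInl (m := n + 1) (n := 1) (finInr 0)))
    (h₂ : φ (finInr (finInr 0)) = ψ (finInr (m := n + 1) (n := 1) 0)) : φ = ψ :=
  fin_add_ext h (fin_add_ind (fun x => by rw [Subsingleton.elim x 0]; exact h₁)
    fun x => by rw [Subsingleton.elim x 0]; exact h₂)

/-- Induction on `n` for the map that merges an extra last point into `t`. If `t` is the last of the
old points, the map is the identity plus the multiplication. Otherwise the last two points are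
swapped, and the extra point is merged among the first ones by the induction hypothesis. -/
theorem agreeOn_copair_id (hμ : AgreeOn f f' (fun _ : Fin 2 => (0 : Fin 1))) :
    ∀ (n : ℕ) (t : Fin n), AgreeOn f f' (finCopair id fun _ : Fin 1 => t)
  | 0, t => t.elim0
  | n + 1, t => by
    revert t
    refine fin_add_ind (fun t => ?_) fun t => ?_
    · have h₁ := (agreeOn_id (f := f) (f' := f') n).sumMap (agreeOn_swap 1 1)
      have h₂ := (agreeOn_copair_id hμ n t).sumMap (agreeOn_id 1)
      refine (congrArg (AgreeOn f f') (fin_add_two_ext (fun x => ?_) ?_ ?_)).mp (h₂.comp h₁)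
      · rw [Function.comp_apply, finSumMap_inl, finCopair_inl]
        exact (finSumMap_inl (m := n + 1) (finCopair id fun _ : Fin 1 => t) id (finInl x)).trans
          (congrArg finInl (finCopair_inl _ _ x))
      · rw [Function.comp_apply, finSumMap_inr, finSwap_inl, finCopair_inl]
        exact finSumMap_inr (m := n + 1) (finCopair id fun _ : Fin 1 => t) id 0
      · rw [Function.comp_apply, finSumMap_inr, finSwap_inr, finCopair_inr]
        exact (finSumMap_inl (m := n + 1) (finCopair id fun _ : Fin 1 => t) id (finInr 0)).trans
          (congrArg finInl (finCopair_inr _ _ 0))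
    · refine (congrArg (AgreeOn f f') (fin_add_two_ext (fun x => ?_) ?_ ?_)).mp
        ((agreeOn_id (f := f) (f' := f') n).sumMap hμ)
      · rw [finSumMap_inl, finCopair_inl]; rfl
      · rw [finSumMap_inr, finCopair_inl]; rfl
      · rw [finSumMap_inr, finCopair_inr, Subsingleton.elim t 0]

theorem agreeOn_elim0 (hη : AgreeOn f f' (fun i : Fin 0 => (i.elim0 : Fin 1))) :
    ∀ (n : ℕ) (φ : Fin 0 → Fin n), AgreeOn f f' φ
  | 0, φ => by rw [Subsingleton.elim φ id]; exact agreeOn_id 0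
  | n + 1, φ => by
    rw [Subsingleton.elim φ (finSumMap (fun i : Fin 0 => (i.elim0 : Fin n))
      (fun i : Fin 0 => (i.elim0 : Fin 1)))]
    exact (agreeOn_elim0 hη n _).sumMap hη

/-- Induction on the size of the domain: `φ` first acts on all points but the last, keeping the last
one apart, and then merges the last point into its image. -/
theorem agreeOn_of_generators (hμ : AgreeOn f f' (fun _ : Fin 2 => (0 : Fin 1)))
    (hη : AgreeOn f f' (fun i : Fin 0 => (i.elim0 : Fin 1))) {n : ℕ} :
    ∀ {m : ℕ} (φ : Fin m → Fin n), AgreeOn f f' φ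
  | 0, φ => agreeOn_elim0 hη n φ
  | m + 1, φ => by
    have h := (agreeOn_copair_id hμ n (φ (finInr 0))).comp
      ((agreeOn_of_generators hμ hη (fun i : Fin m => φ (finInl i))).sumMap (agreeOn_id 1))
    refine (congrArg (AgreeOn f f') ?_).mp h
    refine fin_add_ext (fun x => by simp) fun x => ?_
    rw [Subsingleton.elim x 0]; simp

/-- Morphisms out of `FinCospan` are determined by the Frobenius monoid `1`. -/
theorem morphism_ext (hμ : AgreeOn f f' (fun _ : Fin 2 => (0 : Fin 1)))
    (hη : AgreeOn f f' (fun i : Fin 0 => (i.elim0 : Fin 1))) : f = f' := by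
  refine PROP.Morphism.ext ?_
  funext m n x
  obtain ⟨q, φ, ψ, rfl⟩ := exists_eq_fwd_comp_bwd x
  rw [f.map_comp, f'.map_comp, (agreeOn_of_generators hμ hη φ).1,
    (agreeOn_of_generators hμ hη ψ).2]

end Generators

end FinCospan

/-! ### Uniqueness of morphisms out of `FinCorel`. -/

namespace FinCorel

/-- The set of parts serves as apex. Fullness of `H` reduces uniqueness out of `FinCorel` to
uniqueness out of `FinCospan`. -/
theorem cospanToCorel_surjective {m n : ℕ} (R : FinCorel.Hom m n) :
    ∃ x : FinCospan.Hom m n, cospanToCorel.map x = R := by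
  refine ⟨FinCospan.mk ⟨Corel.Parts R, Quotient.finite _, fun x => Corel.part R (Sum.inl x),
    fun y => Corel.part R (Sum.inr y)⟩, ?_⟩
  refine Eq.trans (Corel.ofFun_congr fun p q => ?_) (Corel.ofFun_part R)
  rcases p with p | p <;> rcases q with q | q <;> rfl

/-- The generating functions `2 → 1` and `0 → 1`, forwards and backwards, are cospans with apex `Fin
1`; this identifies their images with the four operations of the Frobenius monoid. -/
theorem cospanToCorel_mk_one {m n : ℕ} (a : Fin m → Fin 1) (b : Fin n → Fin 1) :
    cospanToCorel.map (FinCospan.mk ⟨Fin 1, inferInstance, a, b⟩) = corelTop m n :=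
  Setoid.ext fun _ _ => iff_of_true (Subsingleton.elim (α := Fin 1) _ _) trivial

/-- Morphisms out of `FinCorel` are determined by the Frobenius monoid `1`. -/
theorem morphism_ext {T : PROP.{w}} {K K' : PROP.Morphism FinCorel T}
    (hμ : K.map (corelTop 2 1) = K'.map (corelTop 2 1))
    (hη : K.map (corelTop 0 1) = K'.map (corelTop 0 1))
    (hδ : K.map (corelTop 1 2) = K'.map (corelTop 1 2))
    (hε : K.map (corelTop 1 0) = K'.map (corelTop 1 0)) : K = K' := by
  have h : cospanToCorel.comp K = cospanToCorel.comp K' := by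
    refine FinCospan.morphism_ext ⟨?_, ?_⟩ ⟨?_, ?_⟩
    all_goals
      simp only [PROP.Morphism.comp, FinCospan.fwd, FinCospan.bwd]
      rw [cospanToCorel_mk_one]
      assumption
  refine PROP.Morphism.ext ?_
  funext m n R
  obtain ⟨x, rfl⟩ := cospanToCorel_surjective R
  exact congrArg (fun F : PROP.Morphism FinCospan T => F.map x) h

end FinCorel

/-! ## The Lagrangian relation of a corelation -/

namespace Corel

/-- A function on `X ⊕ Y` is compatible with a corelation if it is constant on its parts. -/
def Compat {X Y : Type} {T : Type u} (R : Corel X Y) (ψ : X ⊕ Y → T) : Prop :=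
  ∀ p q, R.part p = R.part q → ψ p = ψ q

theorem compat_ofFun_iff {X Y S : Type} {T : Type u} (f : X ⊕ Y → S) (ψ : X ⊕ Y → T) :
    (ofFun f).Compat ψ ↔ ∀ p q, f p = f q → ψ p = ψ q := by
  simp only [Compat, part_ofFun]

/-- The glued partition is generated by pairs lying in a common part of `R` or of `S`, and on each
such pair one of the two hypotheses applies. -/
theorem Compat.of_glue {X Y Z : Type} {T : Type u} {R : Corel X Y} {S : Corel Y Z}
    {a : X → T} {b : Y → T} {c : Z → T} (h : R.Compat (Sum.elim a b))
    (h' : S.Compat (Sum.elim b c)) {r s : X ⊕ Y ⊕ Z} (hrs : glue R S r s) :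
    Sum.elim a (Sum.elim b c) r = Sum.elim a (Sum.elim b c) s := by
  induction (show Relation.EqvGen _ r s from hrs) with
  | rel r s h =>
    obtain ⟨p, q, hpq, rfl, rfl⟩ | ⟨p, q, hpq, rfl, rfl⟩ := h
    · have := h p q hpq
      rcases p with p | p <;> rcases q with q | q <;> exact this
    · exact h' p q hpq
  | refl => rfl
  | symm _ _ h ih => exact (ih h).symm
  | trans _ _ _ h₁ h₂ ih₁ ih₂ => exact (ih₁ h₁).trans (ih₂ h₂)

theorem Compat.comp {X Y Z : Type} {T : Type u} {R : Corel X Y} {S : Corel Y Z}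
    {a : X → T} {b : Y → T} {c : Z → T} (h : R.Compat (Sum.elim a b))
    (h' : S.Compat (Sum.elim b c)) : (comp R S).Compat (Sum.elim a c) := by
  intro p q hpq
  have := Compat.of_glue h h' (show glue R S (Sum.map id Sum.inr p) (Sum.map id Sum.inr q) from
    (part_eq (Corel.comp R S)).1 hpq)
  rcases p with p | p <;> rcases q with q | q <;> exact this

/-- The function `ψ` descends to the classes of the glued partition that meet `X ⊕ Z`. The remaining
classes lie inside `Y` and may take any value, which is why `T` must be nonempty. Reading the result
on `Y` gives `b`. -/
theorem Compat.exists_extension {X Y Z : Type} {T : Type u} [Nonempty T] {R : Corel X Y}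
    {S : Corel Y Z} {ψ : X ⊕ Z → T} (h : (Corel.comp R S).Compat ψ) :
    ∃ b : Y → T, R.Compat (Sum.elim (fun x => ψ (Sum.inl x)) b) ∧
      S.Compat (Sum.elim b fun z => ψ (Sum.inr z)) := by
  classical
  let G := glue R S
  let e : X ⊕ Z → Quotient G := fun p => Quotient.mk G (Sum.map id Sum.inr p)
  -- The default value is only used on classes with no point of `X ⊕ Z`.
  let F : Quotient G → T := fun t =>
    if ht : ∃ p, e p = t then ψ ht.choose else Classical.arbitrary T
  have hF : ∀ p, F (e p) = ψ p := by
    intro p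
    have hp : ∃ q, e q = e p := ⟨p, rfl⟩
    simp only [F, dif_pos hp]
    exact h _ _ ((part_eq (Corel.comp R S)).2 (Quotient.exact (s := G) hp.choose_spec))
  refine ⟨fun y => F (Quotient.mk G (Sum.inr (Sum.inl y))), fun p q hpq => ?_, fun p q hpq => ?_⟩
  · have key : ∀ p, Sum.elim (fun x => ψ (Sum.inl x))
        (fun y => F (Quotient.mk G (Sum.inr (Sum.inl y)))) p =
        F (Quotient.mk G (Sum.map id Sum.inl p)) := by
      rintro (p | p)
      exacts [(hF (Sum.inl p)).symm, rfl]
    rw [key, key]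
    exact congrArg F (Quotient.sound (Relation.EqvGen.rel _ _ (Or.inl ⟨p, q, hpq, rfl, rfl⟩)))
  · have key : ∀ p, Sum.elim (fun y => F (Quotient.mk G (Sum.inr (Sum.inl y))))
        (fun z => ψ (Sum.inr z)) p = F (Quotient.mk G (Sum.inr p)) := by
      rintro (p | p)
      exacts [rfl, (hF (Sum.inr p)).symm]
    rw [key, key]
    exact congrArg F (Quotient.sound (Relation.EqvGen.rel _ _ (Or.inr ⟨p, q, hpq, rfl, rfl⟩)))

/-! ### Kirchhoff's laws of a corelation, and their functoriality. -/

section Lagrangian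

variable (k : Type u) [Field k]

/-- The potentials and currents at `X` and `Y` such that the potential is constant on each part of
a corelation and the current into each part is the current out of it.  The condition on the
currents is tested against the functions that are constant on the parts. -/
def lagSubmodule {X Y : Type} [Fintype X] [Fintype Y] (R : Corel X Y) :
    Submodule k ((X → k × k) × (Y → k × k)) where
  carrier := {p | R.Compat (Sum.elim (fun x => (p.1 x).1) fun y => (p.2 y).1) ∧
    ∀ a b, R.Compat (Sum.elim a b) → ∑ x, a x * (p.1 x).2 = ∑ y, b y * (p.2 y).2}
  zero_mem' := ⟨fun p q _ => by rcases p with p | p <;> rcases q with q | q <;> rfl,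
    fun a b _ => by simp⟩
  add_mem' := by
    rintro p q ⟨h₁, h₂⟩ ⟨h₃, h₄⟩
    refine ⟨fun i j hij => ?_, fun a b h => ?_⟩
    · have e₁ := h₁ i j hij
      have e₂ := h₃ i j hij
      rcases i with i | i <;> rcases j with j | j <;> simp_all
    · simp only [Prod.fst_add, Prod.snd_add, Pi.add_apply, mul_add, Finset.sum_add_distrib,
        h₂ a b h, h₄ a b h]
  smul_mem' := by
    rintro c p ⟨h₁, h₂⟩
    refine ⟨fun i j hij => ?_, fun a b h => ?_⟩
    · have e₁ := h₁ i j hij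
      rcases i with i | i <;> rcases j with j | j <;> simp_all
    · simp only [Prod.smul_fst, Prod.smul_snd, Pi.smul_apply, smul_eq_mul, mul_left_comm _ c,
        ← Finset.mul_sum, h₂ a b h]

/-- The form pairs the potentials of one vector with the currents of the other. Two members are
orthogonal because the potentials of each are admissible test functions for the currents of the
other. Conversely, orthogonality to dipoles inside a part forces constant potentials, and
orthogonality to pure potentials is the current law. -/
theorem lagSubmodule_isLagrangian {X Y : Type} [Fintype X] [Fintype Y] (R : Corel X Y) :
    IsLagrangian (conjSum (sympForm k X) (sympForm k Y)) (lagSubmodule k R) := by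
  classical
  rw [isLagrangian_iff (LagHom.isAlt _ _)]
  rintro ⟨u, v⟩
  constructor
  · intro h
    refine ⟨fun p q hpq => ?_, fun a b hab => ?_⟩
    -- A dipole: pairing with it computes the difference of the values at `p` and `q`, so it
    -- annihilates every function constant on the parts.
    · let J : X ⊕ Y → k := Pi.single p 1 - Pi.single q 1
      have hJ : ∀ ψ : X ⊕ Y → k, ∑ r, ψ r * J r = ψ p - ψ q := by
        intro ψ
        simp [J, mul_sub, Finset.sum_sub_distrib, Pi.single_apply]
      -- The current law equates the sum over `X` with the sum over `Y`, while `J` annihilates by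
      -- the total sum, hence the sign on `X`.
      have := h (fun x => (0, - J (Sum.inl x)), fun y => (0, J (Sum.inr y))) ⟨?_, fun a b hab => ?_⟩
      · rw [conjSum_apply, sympForm_apply, sympForm_apply] at this
        have e := hJ (Sum.elim (fun x => (u x).1) fun y => (v y).1)
        rw [Fintype.sum_sum_type] at e
        simp only [zero_mul, zero_sub, mul_neg, neg_neg, Finset.sum_neg_distrib,
          Sum.elim_inl, Sum.elim_inr] at this e
        refine sub_eq_zero.1 (e.symm.trans ?_)
        linear_combination -this
      · intro i j _
        rcases i with i | i <;> rcases j with j | j <;> rfl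
      · have e := hJ (Sum.elim a b)
        rw [hab p q hpq, sub_self, Fintype.sum_sum_type] at e
        simp only [mul_neg, Finset.sum_neg_distrib, Sum.elim_inl, Sum.elim_inr] at e ⊢
        linear_combination -e
    -- With zero currents, any potential constant on the parts is allowed as a test vector.
    · have := h (fun x => (a x, 0), fun y => (b y, 0)) ⟨hab, fun a b _ => by simp⟩
      rw [conjSum_apply, sympForm_apply, sympForm_apply] at this
      simp only [mul_zero, sub_zero] at this
      linear_combination -this
  · rintro ⟨h₁, h₂⟩ ⟨u', v'⟩ ⟨h₃, h₄⟩
    rw [conjSum_apply, sympForm_apply, sympForm_apply]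
    have e₁ := h₂ _ _ h₃
    have e₂ := h₄ _ _ h₁
    simp only [Finset.sum_sub_distrib] at e₁ e₂ ⊢
    linear_combination e₂ - e₁

/-- Maximality turns an inclusion into an equality. In each functoriality check below only the easy
inclusion, into the subspace of the resulting corelation, has to be proved. -/
theorem eq_of_le_of_isLagrangian {V : Type v} [AddCommGroup V] [Module k V]
    {ω : LinearMap.BilinForm k V} {S T : Submodule k V} (hS : IsLagrangian ω S)
    (hT : IsLagrangian ω T) (h : S ≤ T) : S = T :=
  (hS.2 T hT.1 h).symm

/-- Corelations as Lagrangian relations. -/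
def toLagrangianMap : FinSetOps.Map ops (LagHom.ops k) where
  map {X Y} _ _ R := (⟨lagSubmodule k R, lagSubmodule_isLagrangian k R⟩ : LagHom k X Y)
  map_ofEquiv {X Y} _ _ e := by
    refine Subtype.ext (eq_of_le_of_isLagrangian k (LagHom.relEquiv_isLagrangian e)
      (lagSubmodule_isLagrangian k _) ?_).symm
    rintro ⟨u, v⟩ (h : u = v ∘ e)
    subst h
    refine ⟨(compat_ofFun_iff _ _).2 fun p q hpq => ?_, fun a b hab => ?_⟩
    · rcases p with p | p <;> rcases q with q | q <;>
        exact congrArg (fun y => (v y).1) hpq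
    · rw [← e.sum_comp]
      refine Finset.sum_congr rfl fun x _ => ?_
      have : a x = b (e x) := (compat_ofFun_iff _ _).1 hab (Sum.inl x) (Sum.inr (e x)) rfl
      rw [this]; rfl
  map_comp {X Y Z} _ _ _ R S := by
    refine Subtype.ext (eq_of_le_of_isLagrangian k (LagHom.relComp_isLagrangian
      (lagSubmodule_isLagrangian k _) (lagSubmodule_isLagrangian k _))
      (lagSubmodule_isLagrangian k _) ?_).symm
    rintro ⟨u, w⟩ ⟨v, h, h'⟩
    refine ⟨h.1.comp h'.1, fun a c hac => ?_⟩
    -- The extension `b` is a common test function on `Y`: chaining the two current laws eliminates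
    -- the sum over `Y`.
    obtain ⟨b, h₁, h₂⟩ := hac.exists_extension
    exact (h.2 _ _ h₁).trans (h'.2 _ _ h₂)
  map_tensor {X Y X' Y'} _ _ _ _ R S := by
    refine Subtype.ext (eq_of_le_of_isLagrangian k (LagHom.relSum_isLagrangian
      (lagSubmodule_isLagrangian k _) (lagSubmodule_isLagrangian k _))
      (lagSubmodule_isLagrangian k _) ?_).symm
    rintro ⟨u, v⟩ ⟨h, h'⟩
    refine ⟨(compat_ofFun_iff _ _).2 ?_, fun a b hab => ?_⟩
    · rintro ((p | p) | p | p) ((q | q) | q | q) hpq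
      all_goals first
        | exact absurd hpq Sum.inl_ne_inr
        | exact absurd hpq Sum.inr_ne_inl
        | exact h.1 (Sum.inl p) (Sum.inl q) (Sum.inl_injective hpq)
        | exact h.1 (Sum.inl p) (Sum.inr q) (Sum.inl_injective hpq)
        | exact h.1 (Sum.inr p) (Sum.inl q) (Sum.inl_injective hpq)
        | exact h.1 (Sum.inr p) (Sum.inr q) (Sum.inl_injective hpq)
        | exact h'.1 (Sum.inl p) (Sum.inl q) (Sum.inr_injective hpq)
        | exact h'.1 (Sum.inl p) (Sum.inr q) (Sum.inr_injective hpq)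
        | exact h'.1 (Sum.inr p) (Sum.inl q) (Sum.inr_injective hpq)
        | exact h'.1 (Sum.inr p) (Sum.inr q) (Sum.inr_injective hpq)
    · rw [Fintype.sum_sum_type, Fintype.sum_sum_type]
      have hab := (compat_ofFun_iff _ _).1 hab
      refine congrArg₂ (· + ·)
        (h.2 (fun x => a (Sum.inl x)) (fun y => b (Sum.inl y)) ?_)
        (h'.2 (fun x => a (Sum.inr x)) (fun y => b (Sum.inr y)) ?_)
      · intro p q hpq
        have := hab (Sum.map Sum.inl Sum.inl p) (Sum.map Sum.inl Sum.inl q)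
        rcases p with p | p <;> rcases q with q | q <;> exact this (congrArg Sum.inl hpq)
      · intro p q hpq
        have := hab (Sum.map Sum.inr Sum.inr p) (Sum.map Sum.inr Sum.inr q)
        rcases p with p | p <;> rcases q with q | q <;> exact this (congrArg Sum.inr hpq)

end Lagrangian

end Corel

/-! ### The morphism `K` and its uniqueness. -/

section Lagrangian

variable (k : Type u) [Field k]

/-- The morphism `K` from corelations to Lagrangian relations. -/
def corelToLagRel : PROP.Morphism FinCorel (LagRel k) :=
  (Corel.toLagrangianMap k).toMorphism Corel.lawful (LagHom.lawful k)

/-- With a single part the compatible functions are the constants, so by linearity the current law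
need only be tested on the constant function `1`. -/
theorem mem_corelToLagRel_corelTop {m n : ℕ} (u : Fin m → k × k) (v : Fin n → k × k) :
    (u, v) ∈ LagRel.rel ((corelToLagRel k).map (corelTop m n)) ↔
      (∃ c, (∀ i, (u i).1 = c) ∧ ∀ i, (v i).1 = c) ∧ ∑ i, (u i).2 = ∑ i, (v i).2 := by
  have htop : ∀ p q, Corel.part (corelTop m n) p = Corel.part (corelTop m n) q := fun p q =>
    (Corel.part_eq _).2 trivial
  constructor
  · rintro ⟨h₁, h₂⟩
    refine ⟨?_, ?_⟩
    swap
    · have h := h₂ (fun _ => 1) (fun _ => 1)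
        fun p q _ => by rcases p with p | p <;> rcases q with q | q <;> rfl
      simpa using h
    -- The common potential is read off at any boundary point; for `m = n = 0` there is none, and
    -- `0` does.
    rcases isEmpty_or_nonempty (Fin m ⊕ Fin n) with h | ⟨⟨p⟩⟩
    · exact ⟨0, fun i => (h.false (Sum.inl i)).elim, fun i => (h.false (Sum.inr i)).elim⟩
    · exact ⟨_, fun i => h₁ (Sum.inl i) p (htop _ _), fun i => h₁ (Sum.inr i) p (htop _ _)⟩
  · rintro ⟨⟨c, h₁, h₂⟩, h₃⟩
    have hc : ∀ p, Sum.elim (fun x => (u x).1) (fun y => (v y).1) p = c := by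
      rintro (p | p)
      exacts [h₁ p, h₂ p]
    refine ⟨fun p q _ => (hc p).trans (hc q).symm, fun a b hab => ?_⟩
    have hab : ∀ p q, Sum.elim a b p = Sum.elim a b q := fun p q => hab p q (htop p q)
    rcases isEmpty_or_nonempty (Fin m ⊕ Fin n) with h | ⟨⟨p⟩⟩
    · rw [Finset.sum_eq_zero fun i _ => (h.false (Sum.inl i)).elim,
        Finset.sum_eq_zero fun i _ => (h.false (Sum.inr i)).elim]
    · change ∑ x, a x * (u x).2 = ∑ y, b y * (v y).2
      have ha : ∀ i, a i = Sum.elim a b p := fun i => hab (Sum.inl i) p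
      have hb : ∀ i, b i = Sum.elim a b p := fun i => hab (Sum.inr i) p
      simp only [ha, hb, ← Finset.mul_sum, h₃]

theorem corelToLagRel_sendsFrobenius : SendsFrobenius (corelToLagRel k) := by
  refine ⟨fun u v => ?_, fun u v => ?_, fun u v => ?_, fun u v => ?_⟩ <;>
    rw [mem_corelToLagRel_corelTop]
  · simp only [Fin.forall_fin_two, Fin.forall_fin_one, Fin.sum_univ_two, Fin.sum_univ_one,
      and_assoc]
    exact ⟨fun ⟨⟨_, h₁, h₂, h₃⟩, h₄⟩ => ⟨h₁.trans h₃.symm, h₂.trans h₃.symm, h₄⟩,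
      fun ⟨h₁, h₂, h₃⟩ => ⟨⟨_, h₁, h₂, rfl⟩, h₃⟩⟩
  all_goals simp [Fin.forall_fin_two, Fin.forall_fin_one, and_assoc, eq_comm]

theorem LagRel.ext {m n : ℕ} {f g : (LagRel k).Hom m n}
    (h : ∀ u v, (u, v) ∈ LagRel.rel f ↔ (u, v) ∈ LagRel.rel g) : f = g :=
  LagHom.ext' h

theorem SendsFrobenius.unique {K K' : PROP.Morphism FinCorel (LagRel k)} (h : SendsFrobenius K)
    (h' : SendsFrobenius K') : K = K' :=
  FinCorel.morphism_ext (LagRel.ext k fun u v => (h.1 u v).trans (h'.1 u v).symm)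
    (LagRel.ext k fun u v => (h.2.1 u v).trans (h'.2.1 u v).symm)
    (LagRel.ext k fun u v => (h.2.2.1 u v).trans (h'.2.2.1 u v).symm)
    (LagRel.ext k fun u v => (h.2.2.2 u v).trans (h'.2.2.2 u v).symm)

end Lagrangian

/-! ## Adding an edge to a graph -/

theorem Pushout.desc_bijective_symm {Y A B S : Type} {f : Y → A} {g : Y → B} {a : A → S}
    {b : B → S} {h : ∀ y, a (f y) = b (g y)} (hbij : Function.Bijective (Pushout.desc a b h)) :
    Function.Bijective (Pushout.desc b a fun y => (h y).symm) := by
  let σ : Pushout g f → Pushout f g :=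
    Pushout.desc (Pushout.inr f g) (Pushout.inl f g) fun y => (Pushout.glue y).symm
  let τ : Pushout f g → Pushout g f :=
    Pushout.desc (Pushout.inr g f) (Pushout.inl g f) fun y => (Pushout.glue y).symm
  have hσ : Function.Bijective σ := Function.bijective_iff_has_inverse.2
    ⟨τ, Pushout.ind (fun _ => rfl) fun _ => rfl, Pushout.ind (fun _ => rfl) fun _ => rfl⟩
  have : Pushout.desc b a (fun y => (h y).symm) = Pushout.desc a b h ∘ σ :=
    funext (Pushout.ind (fun _ => rfl) fun _ => rfl)
  rw [this]
  exact hbij.comp hσ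

namespace FinCospan

theorem bwd_comp_fwd_equiv {m n : ℕ} (e : Fin m ≃ Fin n) :
    FinCospan.comp (bwd e) (fwd e) = FinCospan.id n := by
  rw [bwd_eq_fwd_symm, fwd_comp, e.self_comp_symm, fwd_id]

/-- Two distinct points of `Fin 2` form the pushout of two singletons over the empty set. Entering
at one and leaving at the other is thus counit followed by unit. -/
theorem fwd_zero_comp_bwd_one :
    FinCospan.comp (fwd fun _ : Fin 1 => (0 : Fin 2)) (bwd fun _ : Fin 1 => (1 : Fin 2)) =
      FinCospan.comp (bwd fun i : Fin 0 => (i.elim0 : Fin 1))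
        (fwd fun i : Fin 0 => (i.elim0 : Fin 1)) := by
  refine (bwd_comp_fwd (fun i => i.elim0) (Pushout.desc_bijective
    (fun t : Fin 2 => if t = 0 then Pushout.inl _ _ 0 else Pushout.inr _ _ 0)
    (fun x => ?_) (fun x => ?_) fun t => ?_)).symm
  · rw [Subsingleton.elim x 0]; rfl
  · rw [Subsingleton.elim x 0]; rfl
  · obtain rfl | rfl : t = 0 ∨ t = 1 := by omega
    all_goals rfl

/-! ### Single edges: sliding along functions, juxtaposition and commutation. -/

section AddEdge

variable {T : PROP.{w}} (f : PROP.Morphism FinCospan T)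

theorem map_fwd_comp {m n p : ℕ} (φ : Fin m → Fin n) (ψ : Fin n → Fin p) :
    T.comp (f.map (fwd φ)) (f.map (fwd ψ)) = f.map (fwd (ψ ∘ φ)) := by
  rw [← f.map_comp, fwd_comp]

theorem map_bwd_comp {m n p : ℕ} (φ : Fin m → Fin n) (ψ : Fin n → Fin p) :
    T.comp (f.map (bwd ψ)) (f.map (bwd φ)) = f.map (bwd (ψ ∘ φ)) := by
  rw [← f.map_comp, bwd_comp]

theorem map_fwd_id (n : ℕ) : f.map (fwd (id : Fin n → Fin n)) = T.id n := f.map_id n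

theorem map_bwd_id (n : ℕ) : f.map (bwd (id : Fin n → Fin n)) = T.id n := f.map_id n

theorem map_fwd_tensor {m n m' n' : ℕ} (φ : Fin m → Fin n) (ψ : Fin m' → Fin n') :
    T.tensor (f.map (fwd φ)) (f.map (fwd ψ)) = f.map (fwd (finSumMap φ ψ)) := by
  rw [← f.map_tensor, fwd_tensor]

theorem map_bwd_tensor {m n m' n' : ℕ} (φ : Fin m → Fin n) (ψ : Fin m' → Fin n') :
    T.tensor (f.map (bwd φ)) (f.map (bwd ψ)) = f.map (bwd (finSumMap φ ψ)) := by
  rw [← f.map_tensor, bwd_tensor]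

/-- Replaces transports by images of functions, so that they obey the same composition and tensor
rules as the rest. -/
theorem castHom_eq_comp {m n m' n' : ℕ} (hm : m = m') (hn : n = n') (x : T.Hom m n) :
    castHom (Hom := T.Hom) hm hn x =
      T.comp (f.map (bwd (Fin.cast hm))) (T.comp x (f.map (fwd (Fin.cast hn)))) := by
  subst hm hn
  have h : ∀ m : ℕ, Fin.cast (rfl : m = m) = id := fun _ => rfl
  rw [h, h, map_fwd_id, map_bwd_id, T.comp_id, T.id_comp]
  rfl

/-- The endomorphism that adds an edge `a` between two given nodes. -/
def addEdge (a : T.Hom 1 1) {n : ℕ} (s t : Fin n) : T.Hom n n :=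
  T.comp (f.map (bwd (finCopair (fun _ : Fin 1 => s) id)))
    (T.comp (T.tensor a (T.id n)) (f.map (fwd (finCopair (fun _ : Fin 1 => t) id))))

theorem tensor_id_comp_id_tensor {m n p q : ℕ} (a : T.Hom m n) (b : T.Hom p q) :
    T.comp (T.tensor a (T.id p)) (T.tensor (T.id n) b) =
      T.comp (T.tensor (T.id m) b) (T.tensor a (T.id q)) := by
  rw [← T.tensor_comp, ← T.tensor_comp, T.id_comp, T.comp_id, T.id_comp, T.comp_id]

theorem map_fwd_sumMap_id {n n' : ℕ} (m : ℕ) (φ : Fin n → Fin n') :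
    f.map (fwd (finSumMap (id : Fin m → Fin m) φ)) = T.tensor (T.id m) (f.map (fwd φ)) := by
  rw [← map_fwd_tensor, map_fwd_id]

theorem map_bwd_sumMap_id {n n' : ℕ} (m : ℕ) (φ : Fin n → Fin n') :
    f.map (bwd (finSumMap (id : Fin m → Fin m) φ)) = T.tensor (T.id m) (f.map (bwd φ)) := by
  rw [← map_bwd_tensor, map_bwd_id]

theorem copair_sumMap_condition {n n' : ℕ} (φ : Fin n → Fin n') (s : Fin n) :
    ∀ y, φ (finCopair (fun _ : Fin 1 => s) id y) =
      finCopair (fun _ : Fin 1 => φ s) id (finSumMap id φ y) :=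
  fin_add_ind (fun x => by simp) fun x => by simp

/-- Gluing `n` to `1 + n'` along `1 + n` identifies each `x` with `φ x` and the extra point with
`s`, so exactly the points of `n'` survive. This one square, read in both directions, is behind both
sliding laws. -/
theorem copair_sumMap_isPushout {n n' : ℕ} (φ : Fin n → Fin n') (s : Fin n) :
    Function.Bijective (Pushout.desc _ _ (copair_sumMap_condition φ s)) := by
  have hl : ∀ x, Pushout.inr (finCopair (fun _ : Fin 1 => s) id) (finSumMap id φ) (finInr (φ x)) =
      Pushout.inl _ _ x := by
    intro x
    have := Pushout.glue (f := finCopair (fun _ : Fin 1 => s) id) (g := finSumMap id φ) (finInr x)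
    rw [finCopair_inr, finSumMap_inr] at this
    exact this.symm
  refine Pushout.desc_bijective (fun x => Pushout.inr _ _ (finInr x)) hl
    (fin_add_ind (fun x => ?_) fun x => ?_) fun x => ?_
  · rw [finCopair_inl, hl]
    have := Pushout.glue (f := finCopair (fun _ : Fin 1 => s) id) (g := finSumMap id φ) (finInl x)
    rw [finCopair_inl, finSumMap_inl] at this
    exact this
  · rw [finCopair_inr]; rfl
  · rw [Pushout.desc_inr, finCopair_inr]; rfl

theorem bwd_copair_comp_fwd {n n' : ℕ} (φ : Fin n → Fin n') (s : Fin n) :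
    FinCospan.comp (bwd (finCopair (fun _ : Fin 1 => s) id)) (fwd (finSumMap id φ)) =
      FinCospan.comp (fwd φ) (bwd (finCopair (fun _ : Fin 1 => φ s) id)) :=
  bwd_comp_fwd _ (copair_sumMap_isPushout φ s)

theorem bwd_sumMap_comp_fwd {n n' : ℕ} (φ : Fin n → Fin n') (s : Fin n) :
    FinCospan.comp (bwd (finSumMap id φ)) (fwd (finCopair (fun _ : Fin 1 => s) id)) =
      FinCospan.comp (fwd (finCopair (fun _ : Fin 1 => φ s) id)) (bwd φ) :=
  bwd_comp_fwd _ (Pushout.desc_bijective_symm (copair_sumMap_isPushout φ s))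

/-- The function passes the merge at `t` by a commuting square of functions, passes `a` by the
interchange law, and passes the split at `s` by the pushout exchange. -/
theorem addEdge_comp_fwd (a : T.Hom 1 1) {n n' : ℕ} (φ : Fin n → Fin n') (s t : Fin n) :
    T.comp (addEdge f a s t) (f.map (fwd φ)) =
      T.comp (f.map (fwd φ)) (addEdge f a (φ s) (φ t)) := by
  have h : φ ∘ finCopair (fun _ : Fin 1 => t) id =
      finCopair (fun _ : Fin 1 => φ t) id ∘ finSumMap id φ := by
    rw [finCopair_comp, finCopair_comp_sumMap]; rfl
  simp only [addEdge, T.assoc]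
  rw [map_fwd_comp, h, ← map_fwd_comp, map_fwd_sumMap_id, ← T.assoc (T.tensor a _),
    tensor_id_comp_id_tensor, T.assoc, ← map_fwd_sumMap_id, ← T.assoc, ← f.map_comp,
    bwd_copair_comp_fwd, f.map_comp, T.assoc]

/-- As for `addEdge_comp_fwd` with the roles exchanged: the pushout square is needed at the merge,
and the commuting square at the split. -/
theorem addEdge_comp_bwd (a : T.Hom 1 1) {n n' : ℕ} (φ : Fin n → Fin n') (s t : Fin n) :
    T.comp (addEdge f a (φ s) (φ t)) (f.map (bwd φ)) =
      T.comp (f.map (bwd φ)) (addEdge f a s t) := by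
  have h : φ ∘ finCopair (fun _ : Fin 1 => s) id =
      finCopair (fun _ : Fin 1 => φ s) id ∘ finSumMap id φ := by
    rw [finCopair_comp, finCopair_comp_sumMap]; rfl
  simp only [addEdge, T.assoc]
  rw [← f.map_comp, ← bwd_sumMap_comp_fwd, f.map_comp, map_bwd_sumMap_id, ← T.assoc (T.tensor a _),
    tensor_id_comp_id_tensor, T.assoc, ← map_bwd_sumMap_id, ← T.assoc, map_bwd_comp, ← h,
    ← map_bwd_comp, T.assoc]

theorem comp_tensor_id {n p q : ℕ} (x : T.Hom n p) (y : T.Hom p q) (m : ℕ) :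
    T.tensor (T.comp x y) (T.id m) = T.comp (T.tensor x (T.id m)) (T.tensor y (T.id m)) := by
  rw [← T.tensor_comp, T.id_comp]

/-- The only obstacle is that the edge sits in `(1 + n) + m` on one side and in `1 + (n + m)` on the
other. Strict associativity is expressed by casts, which are absorbed into the split and the merge.
-/
theorem addEdge_tensor_id (a : T.Hom 1 1) {n : ℕ} (s t : Fin n) (m : ℕ) :
    T.tensor (addEdge f a s t) (T.id m) = addEdge f a (finInl s : Fin (n + m)) (finInl t) := by
  have hα : T.tensor (T.tensor a (T.id n)) (T.id m) =
      T.comp (f.map (fwd (Fin.cast (Nat.add_assoc 1 n m)))) (T.comp (T.tensor a (T.id (n + m)))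
        (f.map (bwd (Fin.cast (Nat.add_assoc 1 n m))))) := by
    rw [← T.tensor_id, ← T.tensor_assoc, castHom_eq_comp f]
    have e : T.comp (f.map (fwd (Fin.cast (Nat.add_assoc 1 n m))))
        (f.map (bwd (Fin.cast (Nat.add_assoc 1 n m)))) = T.id _ := by
      rw [← f.map_comp]
      exact (congrArg f.map (fwd_comp_bwd_equiv (finCongr (Nat.add_assoc 1 n m)))).trans
        (f.map_id _)
    simp only [T.assoc]
    rw [e, T.comp_id, ← T.assoc, e, T.id_comp]
  have hc : ∀ s : Fin n, finSumMap (finCopair (fun _ : Fin 1 => s) id) (id : Fin m → Fin m) =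
      finCopair (fun _ : Fin 1 => finInl s) id ∘ Fin.cast (Nat.add_assoc 1 n m) := by
    intro s
    refine fin_add_ext (fin_add_ind (fun x => ?_) fun x => ?_) fun x => ?_
    · have : Fin.cast (Nat.add_assoc 1 n m) (finInl (finInl x)) = finInl x := rfl
      simp [this]
    · have : Fin.cast (Nat.add_assoc 1 n m) (finInl (finInr x)) = finInr (finInl x) := rfl
      simp [this]
    · have : Fin.cast (Nat.add_assoc 1 n m) (finInr x) = finInr (finInr x) :=
        Fin.ext (Nat.add_assoc 1 n x)
      simp [this]
  have e : T.comp (f.map (bwd (Fin.cast (Nat.add_assoc 1 n m))))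
      (f.map (fwd (Fin.cast (Nat.add_assoc 1 n m)))) = T.id _ := by
    rw [← f.map_comp]
    exact (congrArg f.map (bwd_comp_fwd_equiv (finCongr (Nat.add_assoc 1 n m)))).trans
      (f.map_id _)
  have hB : T.tensor (f.map (bwd (finCopair (fun _ : Fin 1 => s) id))) (T.id m) =
      T.comp (f.map (bwd (finCopair (fun _ : Fin 1 => finInl s) id)))
        (f.map (bwd (Fin.cast (Nat.add_assoc 1 n m)))) := by
    rw [map_bwd_comp, ← hc, ← map_bwd_tensor, map_bwd_id]
  have hF : T.tensor (f.map (fwd (finCopair (fun _ : Fin 1 => t) id))) (T.id m) =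
      T.comp (f.map (fwd (Fin.cast (Nat.add_assoc 1 n m))))
        (f.map (fwd (finCopair (fun _ : Fin 1 => finInl t) id))) := by
    rw [map_fwd_comp, ← hc, ← map_fwd_tensor, map_fwd_id]
  rw [addEdge, comp_tensor_id, comp_tensor_id, hB, hF, hα]
  simp only [T.assoc]
  rw [← T.assoc _ (f.map (fwd (Fin.cast (Nat.add_assoc 1 n m)))), e, T.id_comp,
    ← T.assoc _ (f.map (fwd (Fin.cast (Nat.add_assoc 1 n m)))), e, T.id_comp, addEdge]

/-- By naturality of the braiding this follows from the case of nodes added on the right: the edge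
slides through the swap, which is then cancelled. -/
theorem id_tensor_addEdge (a : T.Hom 1 1) {n : ℕ} (s t : Fin n) (m : ℕ) :
    T.tensor (T.id m) (addEdge f a s t) = addEdge f a (finInr s : Fin (m + n)) (finInr t) := by
  have h := T.braid_natural (T.id m) (addEdge f a s t)
  rw [addEdge_tensor_id, ← f.map_braid, ← fwd_finSwap] at h
  have h' := addEdge_comp_fwd f a (finSwap m n) (finInr s) (finInr t)
  rw [finSwap_inr, finSwap_inr] at h'
  have e : T.comp (f.map (fwd (finSwap m n))) (f.map (bwd (finSwap m n))) = T.id _ := by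
    rw [← f.map_comp, fwd_comp_bwd_equiv, f.map_id]
  have := congrArg (fun x => T.comp x (f.map (bwd (finSwap m n)))) (h.trans h'.symm)
  simpa only [T.assoc, e, T.comp_id, T.id_comp] using this

/-- On two disjoint copies of the node set the edges commute by the interchange law. Both then slide
through the map folding the copies together. -/
theorem addEdge_comm (a b : T.Hom 1 1) {n : ℕ} (s t s' t' : Fin n) :
    T.comp (addEdge f a s t) (addEdge f b s' t') =
      T.comp (addEdge f b s' t') (addEdge f a s t) := by
  let φ : Fin (n + n) → Fin n := finCopair id id
  -- The fold has the section `finInl`, so endomorphisms of `n` may be compared after precomposition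
  -- with the fold.
  have hφ : ∀ x : T.Hom n n, x = T.comp (f.map (fwd finInl)) (T.comp (f.map (fwd φ)) x) := by
    intro x
    have : φ ∘ finInl = id := funext fun y => finCopair_inl _ _ y
    rw [← T.assoc, map_fwd_comp, this, map_fwd_id, T.id_comp]
  have ha := addEdge_comp_fwd f a φ (finInl s) (finInl t)
  have hb := addEdge_comp_fwd f b φ (finInr s') (finInr t')
  simp only [φ, finCopair_inl, finCopair_inr, id] at ha hb
  have key := tensor_id_comp_id_tensor (T := T) (addEdge f a s t) (addEdge f b s' t')
  rw [addEdge_tensor_id, id_tensor_addEdge] at key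
  rw [hφ (T.comp (addEdge f a s t) _), hφ (T.comp (addEdge f b s' t') _)]
  refine congrArg (T.comp _) ?_
  rw [← T.assoc, ← T.assoc, ← ha, ← hb, T.assoc, T.assoc, ← ha, ← hb, ← T.assoc, ← T.assoc, key]

/-- Adding an edge between two nodes without other connections. -/
theorem addEdge_two (a : T.Hom 1 1) :
    T.comp (f.map (fwd fun _ : Fin 1 => (0 : Fin 2)))
      (T.comp (addEdge f a (0 : Fin 2) 1) (f.map (bwd fun _ : Fin 1 => (1 : Fin 2)))) = a := by
  -- The two exchanges rewrite the composite as comultiplication, then `a` beside the passage from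
  -- node `0` to node `1`, then multiplication. That passage is counit followed by unit, so the unit
  -- and counit laws leave `a`.
  have h₀ := bwd_copair_comp_fwd (fun _ : Fin 1 => (0 : Fin 2)) 0
  have h₁ := bwd_sumMap_comp_fwd (fun _ : Fin 1 => (1 : Fin 2)) 0
  -- The unit law as an identity of functions, using that `1 + 0` reduces to `1`.
  have hid : finCopair (fun _ : Fin 1 => (0 : Fin 1)) id ∘
      finSumMap (id : Fin 1 → Fin 1) (fun i : Fin 0 => (i.elim0 : Fin 1)) = id :=
    funext fun x => Subsingleton.elim (α := Fin 1) _ _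
  rw [addEdge, T.assoc, T.assoc, ← f.map_comp _ (bwd fun _ : Fin 1 => (1 : Fin 2)), ← h₁,
    ← T.assoc, ← f.map_comp (fwd fun _ : Fin 1 => (0 : Fin 2)), ← h₀, f.map_comp, f.map_comp,
    map_fwd_sumMap_id, map_bwd_sumMap_id, T.assoc, ← T.assoc _ (T.tensor a (T.id 2)),
    ← tensor_id_comp_id_tensor, T.assoc, ← T.assoc (T.tensor (T.id 1) _),
    ← T.tensor_comp, T.id_comp, ← f.map_comp (fwd _), fwd_zero_comp_bwd_one, f.map_comp,
    ← T.id_comp (T.id 1), T.tensor_comp, T.id_comp, T.assoc, ← map_fwd_sumMap_id, map_fwd_comp,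
    hid, map_fwd_id, T.comp_id, tensor_id_comp_id_tensor, ← map_bwd_sumMap_id, ← T.assoc,
    map_bwd_comp, hid, map_bwd_id]
  exact (T.id_comp _).trans (T.tensor_unit a)

end AddEdge

end FinCospan

/-- The monoid of endomorphisms of `n` in a prop, with composition in diagrammatic order. -/
def PROP.End (T : PROP.{w}) (n : ℕ) : Type w := T.Hom n n

instance (T : PROP.{w}) (n : ℕ) : Monoid (T.End n) where
  mul := T.comp
  one := T.id n
  mul_assoc := T.assoc
  one_mul := T.id_comp
  mul_one := T.comp_id

/-! ## Adding a family of edges to a graph -/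

namespace FinCospan

section EdgeProd

variable {T : PROP.{w}} (f : PROP.Morphism FinCospan T) {L : Type v} (g : L → T.Hom 1 1)

/-- The endomorphisms generated by adding edges. -/
def edgeMonoid (n : ℕ) : Submonoid (T.End n) :=
  Submonoid.closure (Set.range fun i : Fin n × Fin n × L => addEdge f (g i.2.2) i.1 i.2.1)

/-- The generators commute, hence so does all they generate; this is what gives meaning to a product
over an unordered set of edges. -/
theorem edgeMonoid_isMulCommutative (n : ℕ) : IsMulCommutative (edgeMonoid f g n) :=
  Submonoid.isMulCommutative_closure (T.End n) (by
    rintro _ ⟨i, rfl⟩ _ ⟨j, rfl⟩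
    exact addEdge_comm f _ _ _ _ _ _)

instance (n : ℕ) : CommMonoid (edgeMonoid f g n) :=
  { (edgeMonoid f g n).toMonoid with
    mul_comm := (edgeMonoid_isMulCommutative f g n).is_comm.comm }

/-- Adding a labelled edge. -/
def edgeElt {n : ℕ} (s t : Fin n) (l : L) : edgeMonoid f g n :=
  ⟨addEdge f (g l) s t, Submonoid.subset_closure ⟨(s, t, l), rfl⟩⟩

/-- Adding a finite family of labelled edges. -/
noncomputable def edgeProd {n : ℕ} {E : Type} (src tgt : E → Fin n) (lab : E → L) : T.Hom n n :=
  (∏ᶠ e, edgeElt f g (src e) (tgt e) (lab e)).1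

theorem edgeProd_equiv {n : ℕ} {E E' : Type} (a : E ≃ E') (src tgt : E' → Fin n) (lab : E' → L) :
    edgeProd f g (src ∘ a) (tgt ∘ a) (lab ∘ a) = edgeProd f g src tgt lab :=
  congrArg Subtype.val (finprod_comp_equiv a (f := fun e =>
    edgeElt f g (src e) (tgt e) (lab e)))

theorem edgeProd_of_isEmpty {n : ℕ} {E : Type} [IsEmpty E] (src tgt : E → Fin n) (lab : E → L) :
    edgeProd f g src tgt lab = T.id n :=
  congrArg Subtype.val (finprod_of_isEmpty fun e => edgeElt f g (src e) (tgt e) (lab e))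

theorem edgeProd_unit {n : ℕ} (src tgt : Unit → Fin n) (lab : Unit → L) :
    edgeProd f g src tgt lab = addEdge f (g (lab ())) (src ()) (tgt ()) :=
  congrArg Subtype.val (finprod_unique fun e => edgeElt f g (src e) (tgt e) (lab e))

theorem edgeProd_sum {n : ℕ} {E E' : Type} [Finite E] [Finite E'] (src tgt : E ⊕ E' → Fin n)
    (lab : E ⊕ E' → L) :
    edgeProd f g src tgt lab =
      T.comp (edgeProd f g (src ∘ Sum.inl) (tgt ∘ Sum.inl) (lab ∘ Sum.inl))
        (edgeProd f g (src ∘ Sum.inr) (tgt ∘ Sum.inr) (lab ∘ Sum.inr)) := by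
  have := Fintype.ofFinite E
  have := Fintype.ofFinite E'
  simp only [edgeProd, finprod_eq_prod_of_fintype, Fintype.prod_sum_type]
  rfl

variable {f g}

/-- Induction over the edges, for a relation between endomorphisms. -/
theorem edgeProd_induction {T' : PROP.{u}} {f' : PROP.Morphism FinCospan T'}
    {g' : L → T'.Hom 1 1} {n n' : ℕ} {E : Type} [Finite E] {src tgt : E → Fin n}
    {src' tgt' : E → Fin n'} {lab : E → L} (r : T.Hom n n → T'.Hom n' n' → Prop)
    (h_id : r (T.id n) (T'.id n'))
    (h_comp : ∀ x y x' y', r x x' → r y y' → r (T.comp x y) (T'.comp x' y'))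
    (h : ∀ e, r (addEdge f (g (lab e)) (src e) (tgt e)) (addEdge f' (g' (lab e)) (src' e) (tgt' e))) :
    r (edgeProd f g src tgt lab) (edgeProd f' g' src' tgt' lab) := by
  classical
  have := Fintype.ofFinite E
  simp only [edgeProd, finprod_eq_prod_of_fintype]
  suffices H : ∀ S : Finset E, r (∏ e ∈ S, edgeElt f g (src e) (tgt e) (lab e)).1
      (∏ e ∈ S, edgeElt f' g' (src' e) (tgt' e) (lab e)).1 from H _
  intro S
  induction S using Finset.induction_on with
  | empty => exact h_id
  | insert e S he ih =>
    rw [Finset.prod_insert he, Finset.prod_insert he]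
    exact h_comp _ _ _ _ (h e) ih

variable (f g)

theorem edgeProd_comp_fwd {n n' : ℕ} {E : Type} [Finite E] (φ : Fin n → Fin n')
    (src tgt : E → Fin n) (lab : E → L) :
    T.comp (edgeProd f g src tgt lab) (f.map (fwd φ)) =
      T.comp (f.map (fwd φ)) (edgeProd f g (φ ∘ src) (φ ∘ tgt) lab) := by
  refine edgeProd_induction (r := fun x x' => T.comp x (f.map (fwd φ)) =
    T.comp (f.map (fwd φ)) x') ?_ ?_ fun e => addEdge_comp_fwd f _ φ _ _
  · rw [T.id_comp, T.comp_id]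
  · intro x y x' y' h h'
    rw [T.assoc, h', ← T.assoc, h, T.assoc]

theorem edgeProd_comp_bwd {n n' : ℕ} {E : Type} [Finite E] (φ : Fin n → Fin n')
    (src tgt : E → Fin n) (lab : E → L) :
    T.comp (edgeProd f g (φ ∘ src) (φ ∘ tgt) lab) (f.map (bwd φ)) =
      T.comp (f.map (bwd φ)) (edgeProd f g src tgt lab) := by
  refine edgeProd_induction (r := fun x x' => T.comp x (f.map (bwd φ)) =
    T.comp (f.map (bwd φ)) x') ?_ ?_ fun e => addEdge_comp_bwd f _ φ _ _
  · rw [T.id_comp, T.comp_id]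
  · intro x y x' y' h h'
    rw [T.assoc, h', ← T.assoc, h, T.assoc]

theorem edgeProd_tensor_id {n : ℕ} {E : Type} [Finite E] (src tgt : E → Fin n) (lab : E → L)
    (m : ℕ) : T.tensor (edgeProd f g src tgt lab) (T.id m) =
      edgeProd f g (finInl ∘ src : E → Fin (n + m)) (finInl ∘ tgt) lab := by
  refine edgeProd_induction (r := fun x x' => T.tensor x (T.id m) = x') (T.tensor_id n m) ?_
    fun e => addEdge_tensor_id f _ _ _ m
  rintro x y _ _ rfl rfl
  exact comp_tensor_id x y m

theorem id_tensor_edgeProd {n : ℕ} {E : Type} [Finite E] (src tgt : E → Fin n) (lab : E → L)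
    (m : ℕ) : T.tensor (T.id m) (edgeProd f g src tgt lab) =
      edgeProd f g (finInr ∘ src : E → Fin (m + n)) (finInr ∘ tgt) lab := by
  refine edgeProd_induction (r := fun x x' => T.tensor (T.id m) x = x') (T.tensor_id m n) ?_
    fun e => id_tensor_addEdge f _ _ _ m
  rintro x y _ _ rfl rfl
  rw [← T.tensor_comp, T.id_comp]

/-- A tensor factors as its first factor beside an identity, followed by an identity beside its
second; each of these adds edges to one half of the nodes. -/
theorem edgeProd_tensor {n n' : ℕ} {E E' : Type} [Finite E] [Finite E'] (src tgt : E → Fin n)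
    (lab : E → L) (src' tgt' : E' → Fin n') (lab' : E' → L) :
    T.tensor (edgeProd f g src tgt lab) (edgeProd f g src' tgt' lab') =
      edgeProd f g (finSumFinEquiv ∘ Sum.map src src') (finSumFinEquiv ∘ Sum.map tgt tgt')
        (Sum.elim lab lab') := by
  rw [← T.comp_id (edgeProd f g src tgt lab), ← T.id_comp (edgeProd f g src' tgt' lab'),
    T.tensor_comp, edgeProd_tensor_id, id_tensor_edgeProd, edgeProd_sum]
  rfl

end EdgeProd

end FinCospan

/-! ## Evaluation of circuits -/

namespace Circ

open FinCospan

variable {L : Type v}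

/-- The class of a circuit. -/
def mk {m n : ℕ} (c : Circuit L (Fin m) (Fin n)) : (Circ L).Hom m n :=
  Quotient.mk (Circuit.setoid L (Fin m) (Fin n)) c

theorem tensor_mk {m n m' n' : ℕ} (c : Circuit L (Fin m) (Fin n))
    (d : Circuit L (Fin m') (Fin n')) :
    (Circ L).tensor (mk c) (mk d) =
      mk ((c.tensor d).reindex finSumFinEquiv.symm finSumFinEquiv.symm) :=
  Quotient.sound (Setoid.trans (Circuit.ofEquiv_comp _ _)
    (Circuit.comp_ofEquiv ((c.tensor d).reindex finSumFinEquiv.symm id) finSumFinEquiv))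

section Eval

variable {T : PROP.{w}} (f : PROP.Morphism FinCospan T) (g : L → T.Hom 1 1)

/-- The value of a circuit with numbered nodes. -/
noncomputable def evalWith {m n q : ℕ} (c : Circuit L (Fin m) (Fin n)) (e : c.N ≃ Fin q) : T.Hom m n :=
  T.comp (f.map (fwd (e ∘ c.inp)))
    (T.comp (edgeProd f g (e ∘ c.src) (e ∘ c.tgt) c.lab) (f.map (bwd (e ∘ c.out))))

/-- A renumbering `τ` of the nodes slides from the inputs through the edges and cancels against its
backward copy at the outputs. Renaming the edges only reindexes a commutative product. -/
theorem evalWith_congr {m n q q' : ℕ} {c d : Circuit L (Fin m) (Fin n)} (h : c ≈ d)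
    (e : c.N ≃ Fin q) (e' : d.N ≃ Fin q') : evalWith f g c e = evalWith f g d e' := by
  obtain ⟨σ, a, hi, ho, hs, ht, hl⟩ := h
  let τ : Fin q ≃ Fin q' := e.symm.trans (σ.trans e')
  have hi' : e' ∘ d.inp = τ ∘ (e ∘ c.inp) := funext fun x => by simp [τ, hi]
  have ho' : e' ∘ d.out = τ ∘ (e ∘ c.out) := funext fun x => by simp [τ, ho]
  have hs' : (e' ∘ d.src) ∘ a = τ ∘ (e ∘ c.src) := funext fun x => by simp [τ, hs]
  have ht' : (e' ∘ d.tgt) ∘ a = τ ∘ (e ∘ c.tgt) := funext fun x => by simp [τ, ht]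
  have hl' : d.lab ∘ a = c.lab := funext fun x => (hl x).symm
  rw [evalWith, evalWith, ← edgeProd_equiv f g a, hi', ho', hs', ht', hl', ← map_fwd_comp,
    ← map_bwd_comp, T.assoc, ← T.assoc (f.map (fwd τ)), ← edgeProd_comp_fwd, T.assoc,
    ← T.assoc (f.map (fwd τ)), ← f.map_comp (fwd τ), fwd_comp_bwd_equiv, f.map_id, T.id_comp]

/-- The value of a circuit. -/
noncomputable def eval {m n : ℕ} : (Circ L).Hom m n → T.Hom m n :=
  Quotient.lift (fun c : Circuit L (Fin m) (Fin n) => evalWith f g c (Finite.equivFin c.N))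
    fun _ _ h => evalWith_congr f g h _ _

theorem eval_mk {m n q : ℕ} (c : Circuit L (Fin m) (Fin n)) (e : c.N ≃ Fin q) :
    eval f g (mk c) = evalWith f g c e :=
  evalWith_congr f g (Setoid.refl c) _ _

/-- In the middle, outputs backwards and then inputs forwards is traded for the pushout legs `a`
forwards and `b` backwards. The edges of `c` slide along `a` and those of `d` along `b` onto the
glued nodes, where they form one product. -/
theorem eval_comp {m n p : ℕ} (x : (Circ L).Hom m n) (y : (Circ L).Hom n p) :
    eval f g ((Circ L).comp x y) = T.comp (eval f g x) (eval f g y) := by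
  obtain ⟨c⟩ := x
  obtain ⟨d⟩ := y
  obtain ⟨q₁, ⟨e₁⟩⟩ := Finite.exists_equiv_fin c.N
  obtain ⟨q₂, ⟨e₂⟩⟩ := Finite.exists_equiv_fin d.N
  obtain ⟨r, ⟨e⟩⟩ := Finite.exists_equiv_fin (c.comp d).N
  let a : Fin q₁ → Fin r := fun x => e (Pushout.inl _ _ (e₁.symm x))
  let b : Fin q₂ → Fin r := fun x => e (Pushout.inr _ _ (e₂.symm x))
  have hab : ∀ y, a ((e₁ ∘ c.out) y) = b ((e₂ ∘ d.inp) y) := by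
    intro y
    simp only [a, b, Function.comp_apply, Equiv.symm_apply_apply]
    exact congrArg e (Pushout.glue y)
  have hbij : Function.Bijective (Pushout.desc a b hab) := by
    -- The comparison between the pushout of the nodes and the pushout of their numbers.
    let ρ : Pushout c.out d.inp → Pushout (e₁ ∘ c.out) (e₂ ∘ d.inp) :=
      Pushout.desc (fun x => Pushout.inl _ _ (e₁ x)) (fun x => Pushout.inr _ _ (e₂ x))
        fun y => Pushout.glue (f := e₁ ∘ c.out) (g := e₂ ∘ d.inp) y
    refine Pushout.desc_bijective (fun t => ρ (e.symm t)) (fun x => ?_) (fun x => ?_) fun t => ?_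
    · exact (congrArg ρ (e.symm_apply_apply _)).trans (by simp [ρ])
    · exact (congrArg ρ (e.symm_apply_apply _)).trans (by simp [ρ])
    · obtain ⟨t, rfl⟩ := e.surjective t
      rw [e.symm_apply_apply]
      revert t
      exact Pushout.ind (fun x => by simp [ρ, a]) fun x => by simp [ρ, b]
  have key : T.comp (f.map (bwd (e₁ ∘ c.out))) (f.map (fwd (e₂ ∘ d.inp))) =
      T.comp (f.map (fwd a)) (f.map (bwd b)) := by
    rw [← f.map_comp, bwd_comp_fwd hab hbij, f.map_comp]
  refine (eval_mk f g (c.comp d) e).trans (Eq.trans ?_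
    (congrArg₂ T.comp (eval_mk f g c e₁) (eval_mk f g d e₂)).symm)
  have hi : (e ∘ (c.comp d).inp : Fin m → Fin r) = a ∘ (e₁ ∘ c.inp) := by
    funext x; simp only [a, Function.comp_apply, Equiv.symm_apply_apply]; rfl
  have ho : (e ∘ (c.comp d).out : Fin p → Fin r) = b ∘ (e₂ ∘ d.out) := by
    funext x; simp only [b, Function.comp_apply, Equiv.symm_apply_apply]; rfl
  have hP : edgeProd f g (e ∘ (c.comp d).src) (e ∘ (c.comp d).tgt) (c.comp d).lab =
      T.comp (edgeProd f g (a ∘ (e₁ ∘ c.src)) (a ∘ (e₁ ∘ c.tgt)) c.lab)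
        (edgeProd f g (b ∘ (e₂ ∘ d.src)) (b ∘ (e₂ ∘ d.tgt)) d.lab) := by
    refine (edgeProd_sum (E := c.E) (E' := d.E) f g _ _ _).trans ?_
    congr 2 <;> funext x <;> simp only [a, b, Function.comp_apply, Equiv.symm_apply_apply] <;> rfl
  change T.comp _ (T.comp _ _) = T.comp (T.comp _ (T.comp _ _)) (T.comp _ (T.comp _ _))
  rw [hP, hi, ho]
  simp only [T.assoc]
  rw [← T.assoc (f.map (bwd (e₁ ∘ c.out))), key, ← map_fwd_comp, ← map_bwd_comp]
  simp only [T.assoc]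
  rw [← T.assoc (f.map (bwd b)), ← edgeProd_comp_bwd,
    ← T.assoc (edgeProd f g (e₁ ∘ c.src) (e₁ ∘ c.tgt) c.lab), edgeProd_comp_fwd]
  simp only [T.assoc]

theorem eval_tensor {m n m' n' : ℕ} (x : (Circ L).Hom m n) (y : (Circ L).Hom m' n') :
    eval f g ((Circ L).tensor x y) = T.tensor (eval f g x) (eval f g y) := by
  obtain ⟨c⟩ := x
  obtain ⟨d⟩ := y
  obtain ⟨q₁, ⟨e₁⟩⟩ := Finite.exists_equiv_fin c.N
  obtain ⟨q₂, ⟨e₂⟩⟩ := Finite.exists_equiv_fin d.N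
  let e : (c.tensor d).N ≃ Fin (q₁ + q₂) := (Equiv.sumCongr e₁ e₂).trans finSumFinEquiv
  refine (congrArg (eval f g) (tensor_mk c d)).trans ((eval_mk f g _ e).trans (Eq.trans ?_
    (congrArg₂ T.tensor (eval_mk f g c e₁) (eval_mk f g d e₂)).symm))
  simp only [evalWith]
  rw [T.tensor_comp, T.tensor_comp, map_fwd_tensor, map_bwd_tensor, edgeProd_tensor]
  have hmap : ∀ {A B : Type} (a : A → c.N) (b : B → d.N),
      e ∘ Sum.map a b = finSumFinEquiv ∘ Sum.map (e₁ ∘ a) (e₂ ∘ b) := by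
    intro A B a b
    funext x
    rcases x with x | x <;> rfl
  have hi : finSumMap (e₁ ∘ c.inp) (e₂ ∘ d.inp) =
      e ∘ ((c.tensor d).reindex finSumFinEquiv.symm finSumFinEquiv.symm).inp := by
    change _ = (e ∘ Sum.map c.inp d.inp) ∘ finSumFinEquiv.symm
    rw [hmap]; rfl
  have ho : finSumMap (e₁ ∘ c.out) (e₂ ∘ d.out) =
      e ∘ ((c.tensor d).reindex finSumFinEquiv.symm finSumFinEquiv.symm).out := by
    change _ = (e ∘ Sum.map c.out d.out) ∘ finSumFinEquiv.symm
    rw [hmap]; rfl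
  rw [hi, ho, ← hmap, ← hmap]
  rfl

theorem eval_cospanIncl {m n : ℕ} (x : FinCospan.Hom m n) :
    eval f g ((cospanIncl L).map x) = f.map x := by
  obtain ⟨c⟩ := x
  obtain ⟨q, ⟨e⟩⟩ := Finite.exists_equiv_fin c.N
  refine (eval_mk f g (Circuit.ofCospan L c) e).trans ?_
  refine (congrArg (T.comp _) (congrArg₂ T.comp (edgeProd_of_isEmpty (E := Empty) f g _ _ _)
    rfl)).trans ?_
  rw [ T.id_comp, ← f.map_comp, fwd_comp_bwd]
  exact congrArg f.map (Quotient.sound (Setoid.symm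
    (⟨e, fun _ => rfl, fun _ => rfl⟩ : c ≈ ⟨Fin q, inferInstance, e ∘ c.inp, e ∘ c.out⟩)))

theorem eval_edge (l : L) : eval f g (mk (Circuit.edge l)) = g l := by
  refine (eval_mk f g (Circuit.edge l) (Equiv.refl (Fin 2))).trans (Eq.trans ?_
    (addEdge_two f (g l)))
  exact congrArg (T.comp _) (congrArg₂ T.comp (edgeProd_unit f g _ _ _) rfl)

/-- The morphism out of `Circ L` with prescribed values on cospans and on edges. -/
noncomputable def desc : PROP.Morphism (Circ L) T where
  map := eval f g
  map_id n := (eval_cospanIncl f g (FinCospan.id n)).trans (f.map_id n)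
  map_comp := eval_comp f g
  map_tensor := eval_tensor f g
  map_braid m n := (eval_cospanIncl f g (FinCospan.braid m n)).trans (f.map_braid m n)

end Eval

end Circ

/-! ## The coproduct property of `Circ` -/

/-- Morphisms out of a free prop are determined by the generators. -/
theorem freeProp.morphism_ext {S : ℕ → ℕ → Type u} {T : PROP.{w}}
    {F G : PROP.Morphism (freeProp S) T}
    (h : ∀ m n (s : S m n), F.map (freeProp.of s) = G.map (freeProp.of s)) : F = G := by
  have H : ∀ {m n : ℕ} (x : PropTerm S m n),
      F.map (Quotient.mk (PropTerm.setoid S m n) x) =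
        G.map (Quotient.mk (PropTerm.setoid S m n) x) := by
    intro m n x
    induction x with
    | gen s => exact h _ _ s
    | id n => exact (F.map_id n).trans (G.map_id n).symm
    | comp x y ihx ihy =>
      exact (F.map_comp (Quotient.mk _ x) (Quotient.mk _ y)).trans
        ((congrArg₂ T.comp ihx ihy).trans (G.map_comp _ _).symm)
    | tensor x y ihx ihy =>
      exact (F.map_tensor (Quotient.mk _ x) (Quotient.mk _ y)).trans
        ((congrArg₂ T.tensor ihx ihy).trans (G.map_tensor _ _).symm)
    | braid m n => exact (F.map_braid m n).trans (G.map_braid m n).symm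
  refine PROP.Morphism.ext ?_
  funext m n x
  obtain ⟨x⟩ := x
  exact H x

theorem labelProp.morphism_ext {L : Type v} {T : PROP.{w}} {F G : PROP.Morphism (labelProp L) T}
    (h : ∀ l, F.map (freeProp.of (LabelSig.label l)) = G.map (freeProp.of (LabelSig.label l))) :
    F = G :=
  freeProp.morphism_ext fun _ _ s => match s with
    | .label l => h l

/-- A recognition principle for composites of circuits. -/
theorem Circuit.comp_iso {L : Type v} {X Y Z : Type} {c : Circuit L X Y} {d : Circuit L Y Z}
    {k : Circuit L X Z} (a : c.N → k.N) (b : d.N → k.N) (h : ∀ y, a (c.out y) = b (d.inp y))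
    (hbij : Function.Bijective (Pushout.desc a b h)) (ε : c.E ⊕ d.E ≃ k.E)
    (hi : ∀ x, a (c.inp x) = k.inp x) (ho : ∀ z, b (d.out z) = k.out z)
    (hs : ∀ i, Sum.elim (a ∘ c.src) (b ∘ d.src) i = k.src (ε i))
    (ht : ∀ i, Sum.elim (a ∘ c.tgt) (b ∘ d.tgt) i = k.tgt (ε i))
    (hl : ∀ i, Sum.elim c.lab d.lab i = k.lab (ε i)) : c.comp d ≈ k := by
  refine ⟨Equiv.ofBijective _ hbij, ε, hi, ho, fun i => ?_, fun i => ?_, hl⟩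
  · rcases i with i | i
    exacts [hs (Sum.inl i), hs (Sum.inr i)]
  · rcases i with i | i
    exacts [ht (Sum.inl i), ht (Sum.inr i)]

namespace Circ

open FinCospan

variable {L : Type v}

/-- The class of the circuit with one edge. -/
def edge (l : L) : (Circ L).Hom 1 1 := mk (Circuit.edge l)

/-- The class of a graph, all of whose nodes are both inputs and outputs. -/
def graph {n : ℕ} {E : Type} [Finite E] (src tgt : E → Fin n) (lab : E → L) :
    (Circ L).Hom n n :=
  mk ⟨⟨Fin n, inferInstance, id, id⟩, E, inferInstance, src, tgt, lab⟩

theorem fwd_comp_mk {m n p : ℕ} (φ : Fin m → Fin n) (c : Circuit L (Fin n) (Fin p)) :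
    (Circ L).comp ((cospanIncl L).map (fwd φ)) (mk c) = mk (c.reindex φ id) := by
  refine Quotient.sound (Circuit.comp_iso (k := c.reindex φ id) c.inp id (fun _ => rfl)
    (Pushout.desc_bijective (Pushout.inr _ _) (fun x => ?_) (fun _ => rfl) fun _ => rfl)
    (Equiv.emptySum Empty _) (fun _ => rfl) (fun _ => rfl) ?_ ?_ ?_)
  · exact (Pushout.glue (f := (id : Fin n → Fin n)) (g := c.inp) x).symm
  all_goals
    rintro (i | i)
    · exact i.elim
    · rfl

theorem mk_comp_bwd {m n p : ℕ} (φ : Fin p → Fin n) (c : Circuit L (Fin m) (Fin n)) :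
    (Circ L).comp (mk c) ((cospanIncl L).map (bwd φ)) = mk (c.reindex id φ) := by
  refine Quotient.sound (Circuit.comp_iso (k := c.reindex id φ) id c.out (fun _ => rfl)
    (Pushout.desc_bijective (Pushout.inl _ _) (fun _ => rfl) (fun x => ?_) fun _ => rfl)
    (Equiv.sumEmpty _ Empty) (fun _ => rfl) (fun _ => rfl) ?_ ?_ ?_)
  · exact Pushout.glue (f := c.out) (g := (id : Fin n → Fin n)) x
  all_goals
    rintro (i | i)
    · rfl
    · exact i.elim

theorem graph_equiv {n : ℕ} {E E' : Type} [Finite E] [Finite E'] (a : E ≃ E')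
    (src tgt : E' → Fin n) (lab : E' → L) :
    graph (src ∘ a) (tgt ∘ a) (lab ∘ a) = graph src tgt lab :=
  Quotient.sound ⟨Equiv.refl _, a, fun _ => rfl, fun _ => rfl, fun _ => rfl, fun _ => rfl,
    fun _ => rfl⟩

theorem graph_of_isEmpty {n : ℕ} {E : Type} [Finite E] [IsEmpty E] (src tgt : E → Fin n)
    (lab : E → L) : graph src tgt lab = (Circ L).id n :=
  Quotient.sound ⟨Equiv.refl _, Equiv.equivOfIsEmpty E Empty, fun _ => rfl, fun _ => rfl,
    fun i => isEmptyElim i, fun i => isEmptyElim i, fun i => isEmptyElim i⟩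

/-- Gluing along identity legs keeps the nodes and unites the edges, so a graph can be split into
one-edge graphs. -/
theorem graph_sum {n : ℕ} {E E' : Type} [Finite E] [Finite E'] (src tgt : E ⊕ E' → Fin n)
    (lab : E ⊕ E' → L) :
    graph src tgt lab = (Circ L).comp
      (graph (src ∘ Sum.inl) (tgt ∘ Sum.inl) (lab ∘ Sum.inl))
      (graph (src ∘ Sum.inr) (tgt ∘ Sum.inr) (lab ∘ Sum.inr)) := by
  refine (Quotient.sound (Circuit.comp_iso
    (c := ⟨⟨Fin n, inferInstance, id, id⟩, E, inferInstance, _, _, _⟩)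
    (d := ⟨⟨Fin n, inferInstance, id, id⟩, E', inferInstance, _, _, _⟩)
    (k := ⟨⟨Fin n, inferInstance, id, id⟩, E ⊕ E', inferInstance, src, tgt, lab⟩) id id
    (fun _ => rfl) (Pushout.desc_bijective (Pushout.inr _ _) (fun x => ?_) (fun _ => rfl)
    fun _ => rfl) (Equiv.refl _) (fun _ => rfl) (fun _ => rfl) ?_ ?_ ?_)).symm
  · exact (Pushout.glue (f := (id : Fin n → Fin n)) (g := (id : Fin n → Fin n)) x).symm
  all_goals rintro (i | i) <;> rfl

/-- The merge glues the target of the edge to `t`. Its source remains a separate node, which is an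
input but not an output. -/
theorem edge_tensor_id_comp_fwd {n : ℕ} (t : Fin n) (l : L) :
    (Circ L).comp ((Circ L).tensor (edge l) ((Circ L).id n))
        ((cospanIncl L).map (fwd (finCopair (fun _ : Fin 1 => t) id))) =
      mk ⟨⟨Fin (1 + n), inferInstance, id, finInr⟩, Unit, inferInstance,
        fun _ => finInl 0, fun _ => finInr t, fun _ => l⟩ := by
  refine (congrArg (fun x => (Circ L).comp x _) (tensor_mk (Circuit.edge l)
    (Circuit.ofCospan L (Cospan.ofEquiv (Equiv.refl (Fin n)))))).trans ?_
  -- Node `0` of the edge becomes the extra node and node `1` is identified with `t`.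
  let a : Fin 2 ⊕ Fin n → Fin (1 + n) :=
    Sum.elim (fun i => if i = 0 then finInl 0 else finInr t) finInr
  have h : ∀ y, a (Sum.map (fun _ : Fin 1 => (1 : Fin 2)) id (finSumFinEquiv.symm y)) =
      finInr (finCopair (fun _ : Fin 1 => t) id y) := by
    refine fin_add_ind (fun x => ?_) fun x => ?_
    · rw [finCopair_inl, finInl, Equiv.symm_apply_apply]; rfl
    · rw [finCopair_inr, finInr, Equiv.symm_apply_apply]; rfl
  refine Quotient.sound (Circuit.comp_iso
    (k := ⟨⟨Fin (1 + n), inferInstance, id, finInr⟩, Unit, inferInstance,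
        fun _ => finInl 0, fun _ => finInr t, fun _ => l⟩) a finInr h
    (Pushout.desc_bijective (finCopair (fun _ => Pushout.inl _ _ (Sum.inl (0 : Fin 2)))
      fun x => Pushout.inr _ _ x) ?_ (fun x => finCopair_inr _ _ x) ?_)
    -- Two empty edge sets are discarded: that of the identity and that of the merging cospan.
    ((Equiv.sumEmpty _ Empty).trans (Equiv.sumEmpty Unit Empty)) ?_ (fun _ => rfl) ?_ ?_ ?_)
  · have hg : ∀ y, Pushout.inl (Sum.map (fun _ : Fin 1 => (1 : Fin 2)) id ∘ finSumFinEquiv.symm)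
        (finCopair (fun _ : Fin 1 => t) id) (Sum.map (fun _ : Fin 1 => (1 : Fin 2)) id y) =
        Pushout.inr _ _ (finCopair (fun _ : Fin 1 => t) id (finSumFinEquiv y)) := by
      intro y
      have := Pushout.glue (f := Sum.map (fun _ : Fin 1 => (1 : Fin 2)) id ∘ finSumFinEquiv.symm)
        (g := finCopair (fun _ : Fin 1 => t) (id : Fin n → Fin n)) (finSumFinEquiv y)
      rwa [Function.comp_apply, Equiv.symm_apply_apply] at this
    rintro ((x : Fin 2) | (x : Fin n))
    · obtain rfl | rfl : x = 0 ∨ x = 1 := by omega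
      · exact finCopair_inl _ _ _
      · refine (finCopair_inr _ _ _).trans (Eq.trans ?_ (hg (Sum.inl 0)).symm)
        exact congrArg (Pushout.inr _ _) (finCopair_inl (fun _ : Fin 1 => t) id 0).symm
    · refine (finCopair_inr _ _ _).trans (Eq.trans ?_ (hg (Sum.inr x)).symm)
      exact congrArg (Pushout.inr _ _) (finCopair_inr (fun _ : Fin 1 => t) id x).symm
  · refine fin_add_ind (fun x => ?_) fun x => ?_
    · rw [finCopair_inl, Subsingleton.elim x 0]; rfl
    · rw [finCopair_inr]; rfl
  · refine fin_add_ind (fun x => ?_) fun x => ?_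
    · change a (Sum.map (fun _ : Fin 1 => (0 : Fin 2)) id
        (finSumFinEquiv.symm (finSumFinEquiv (Sum.inl x)))) = _
      rw [Equiv.symm_apply_apply, Subsingleton.elim x 0]; rfl
    · change a (Sum.map (fun _ : Fin 1 => (0 : Fin 2)) id
        (finSumFinEquiv.symm (finSumFinEquiv (Sum.inr x)))) = _
      rw [Equiv.symm_apply_apply]; rfl
  all_goals
    rintro ((i | i) | i)
    · rfl
    · exact i.elim
    · exact i.elim

/-- All nodes are inputs, so the pushout is along an identity and the whole graph is carried along
`φ`. -/
theorem bwd_comp_mk_id {m n p : ℕ} (φ : Fin m → Fin n) (ψ : Fin p → Fin m) {E : Type} [Finite E]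
    (src tgt : E → Fin m) (lab : E → L) :
    (Circ L).comp ((cospanIncl L).map (bwd φ))
        (mk ⟨⟨Fin m, inferInstance, id, ψ⟩, E, inferInstance, src, tgt, lab⟩) =
      mk ⟨⟨Fin n, inferInstance, id, φ ∘ ψ⟩, E, inferInstance, φ ∘ src, φ ∘ tgt, lab⟩ := by
  refine Quotient.sound (Circuit.comp_iso
    (k := ⟨⟨Fin n, inferInstance, id, φ ∘ ψ⟩, E, inferInstance, φ ∘ src, φ ∘ tgt, lab⟩) id φ
    (fun _ => rfl) (Pushout.desc_bijective (Pushout.inl _ _) (fun _ => rfl) (fun x => ?_)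
    fun _ => rfl) (Equiv.emptySum Empty _) (fun _ => rfl) (fun _ => rfl) ?_ ?_ ?_)
  · exact Pushout.glue (f := φ) (g := (id : Fin m → Fin m)) x
  all_goals
    rintro (i | i)
    · exact i.elim
    · rfl

/-- After the merge the source of the edge is still a separate node; the initial split identifies it
with `s`. -/
theorem addEdge_edge {n : ℕ} (s t : Fin n) (l : L) :
    addEdge (cospanIncl L) (edge l) s t =
      graph (fun _ : Unit => s) (fun _ : Unit => t) fun _ => l := by
  rw [addEdge, edge_tensor_id_comp_fwd, bwd_comp_mk_id]
  have h : finCopair (fun _ : Fin 1 => s) id ∘ finInr = id := funext fun x => finCopair_inr _ _ x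
  have h₁ : finCopair (fun _ : Fin 1 => s) id ∘ (fun _ : Unit => finInl 0) = fun _ => s :=
    funext fun x => finCopair_inl _ _ _
  have h₂ : finCopair (fun _ : Fin 1 => s) id ∘ (fun _ : Unit => finInr t) = fun _ => t :=
    funext fun x => finCopair_inr _ _ _
  rw [h, h₁, h₂]
  rfl

/-- Induction over the finite set of edges, removing one edge at a time; both sides are invariant
under renaming edges and split over disjoint unions. -/
theorem edgeProd_edge {n : ℕ} {E : Type} [Finite E] (src tgt : E → Fin n) (lab : E → L) :
    edgeProd (cospanIncl L) edge src tgt lab = graph src tgt lab := by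
  refine Finite.induction_empty_option (P := fun E => ∀ [Finite E] (src tgt : E → Fin n)
    (lab : E → L), edgeProd (cospanIncl L) edge src tgt lab = graph src tgt lab)
    ?_ ?_ ?_ E src tgt lab
  · intro E E' a ih _ src tgt lab
    have := Finite.of_equiv E' a.symm
    rw [← edgeProd_equiv _ _ a, ← graph_equiv a, ih]
  · intro _ src tgt lab
    rw [edgeProd_of_isEmpty, graph_of_isEmpty]
  · intro E _ ih _ src tgt lab
    let a : E ⊕ Unit ≃ Option E := (Equiv.optionEquivSumPUnit E).symm
    rw [← edgeProd_equiv _ _ a, ← graph_equiv a, edgeProd_sum, graph_sum, ih, edgeProd_unit,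
      addEdge_edge]

/-- A normal form: every circuit is built from cospans and one-edge circuits by the operations of a
prop. This is what forces uniqueness. -/
theorem evalWith_edge {m n q : ℕ} (c : Circuit L (Fin m) (Fin n)) (e : c.N ≃ Fin q) :
    evalWith (cospanIncl L) edge c e = mk c := by
  rw [evalWith, edgeProd_edge, graph, mk_comp_bwd, fwd_comp_mk]
  exact Quotient.sound (Setoid.symm ⟨e, Equiv.refl c.E, fun _ => rfl, fun _ => rfl,
    fun _ => rfl, fun _ => rfl, fun _ => rfl⟩)

/-! ### Morphisms out of `Circ L`: uniqueness and the universal property. -/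

section Coproduct

variable {T : PROP.{w}}

theorem map_addEdge (h : PROP.Morphism (Circ L) T) {n : ℕ} (s t : Fin n) (l : L) :
    h.map (addEdge (cospanIncl L) (edge l) s t) =
      addEdge ((cospanIncl L).comp h) (h.map (edge l)) s t := by
  rw [addEdge, h.map_comp, h.map_comp, h.map_tensor, h.map_id]
  rfl

/-- Applying `h` to the normal form leaves only the values of `h` on cospans and on one-edge
circuits. -/
theorem map_mk (h : PROP.Morphism (Circ L) T) {m n q : ℕ} (c : Circuit L (Fin m) (Fin n))
    (e : c.N ≃ Fin q) :
    h.map (mk c) = evalWith ((cospanIncl L).comp h) (fun l => h.map (edge l)) c e := by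
  rw [← evalWith_edge c e, evalWith, h.map_comp, h.map_comp]
  refine congrArg (T.comp _) (congrArg₂ T.comp ?_ rfl)
  refine edgeProd_induction (r := fun x x' => h.map x = x') (h.map_id q) ?_
    fun i => map_addEdge h _ _ _
  rintro x y _ _ rfl rfl
  exact h.map_comp x y

/-- Morphisms out of `Circ L` are determined by their values on cospans and on edges. -/
theorem morphism_ext {h h' : PROP.Morphism (Circ L) T}
    (hc : (cospanIncl L).comp h = (cospanIncl L).comp h')
    (he : ∀ l, h.map (edge l) = h'.map (edge l)) : h = h' := by
  refine PROP.Morphism.ext ?_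
  funext m n x
  obtain ⟨c⟩ := x
  obtain ⟨q, ⟨e⟩⟩ := Finite.exists_equiv_fin c.N
  refine (map_mk h c e).trans (Eq.trans ?_ (map_mk h' c e).symm)
  rw [hc, funext he]

theorem cospanIncl_comp_desc (f : PROP.Morphism FinCospan T) (g : L → T.Hom 1 1) :
    (cospanIncl L).comp (desc f g) = f := by
  refine PROP.Morphism.ext ?_
  funext m n x
  exact eval_cospanIncl f g x

theorem desc_edge (f : PROP.Morphism FinCospan T) (g : L → T.Hom 1 1) (l : L) :
    (desc f g).map (edge l) = g l :=
  eval_edge f g l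

theorem labelIncl_comp_map (h : PROP.Morphism (Circ L) T) (l : L) :
    ((labelIncl L).comp h).map (freeProp.of (LabelSig.label l)) = h.map (edge l) := rfl

theorem isCoproduct (L : Type v) :
    PROP.IsCoproduct.{w, 1, v, max 1 v} (cospanIncl L) (labelIncl L) := by
  intro T f g
  refine ⟨desc f fun l => g.map (freeProp.of (LabelSig.label l)),
    ⟨cospanIncl_comp_desc f _, labelProp.morphism_ext fun l =>
      (labelIncl_comp_map _ l).trans (desc_edge f _ l)⟩, ?_⟩
  -- The given morphisms become the restrictions of `h`, so `h` is compared with the evaluation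
  -- built from its own values.
  rintro h ⟨rfl, rfl⟩
  exact morphism_ext (cospanIncl_comp_desc _ _).symm fun l =>
    (labelIncl_comp_map h l).symm.trans (desc_edge ((cospanIncl L).comp h)
      (fun l => ((labelIncl L).comp h).map (freeProp.of (LabelSig.label l))) l).symm

end Coproduct

end Circ

/-! ### The three statements together. -/

theorem mainTheorem3 (k : Type u) [Field k] (L : Type v) :
    PROP.IsCoproduct.{w, 1, v, max 1 v} (cospanIncl L) (labelIncl L) ∧
    (∃! K : PROP.Morphism FinCorel (LagRel k), SendsFrobenius K) ∧
    ∀ K : PROP.Morphism FinCorel (LagRel k), SendsFrobenius K →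
      ∀ R : L → (LagRel k).Hom 1 1,
        ∃! B : PROP.Morphism (Circ L) (LagRel k),
          (cospanIncl L).comp B = cospanToCorel.comp K ∧
          ∀ l : L, ((labelIncl L).comp B).map (freeProp.of (LabelSig.label l)) = R l := by
  refine ⟨Circ.isCoproduct L, ⟨corelToLagRel k, corelToLagRel_sendsFrobenius k,
    fun K hK => hK.unique k (corelToLagRel_sendsFrobenius k)⟩, fun K _ R => ?_⟩
  -- The relations `R l` serve directly as the values of the edges, since the condition on `F(L)`
  -- only concerns its generators.
  refine ⟨Circ.desc (cospanToCorel.comp K) R, ⟨Circ.cospanIncl_comp_desc _ _,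
    fun l => (Circ.labelIncl_comp_map _ l).trans (Circ.desc_edge _ _ l)⟩, ?_⟩
  rintro B ⟨hB, hR⟩
  exact Circ.morphism_ext (hB.trans (Circ.cospanIncl_comp_desc _ _).symm)
    fun l => (Circ.labelIncl_comp_map B l).symm.trans
      ((hR l).trans (Circ.desc_edge _ R l).symm)
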